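/- **Proposition (asymptotics on WKB halfstrips).** *Conventions.* Let $\theta\in\mathbb R$ and $A_\theta=(\theta-\frac\pi2,\theta+\frac\pi2)$. A sectorial domain with opening $A_\theta$ is a simply connected domain $S\subset\mathbb C\setminus\{0\}$ whose closure in the real-oriented blowup of $\mathbb C$ at $0$ meets the circle of directions exactly in $\bar A_\theta$, and which contains a Borel disc $\{\hbar : \operatorname{Re}(e^{i\theta}/\hbar)>1/\delta\}$ for some $\delta>0$. For a set $U\subset\mathbb C$ and a function $\chi$ on $U$, we say that $f(x,\hbar)\simeq\hat f=\sum_k f_k(x)\hbar^k$ as $\hbar\to0$ along $\bar A_\theta$, with respect to $\chi$, uniformly for $x\in U$ (for $f$ defined on $U\times S$) if there are a sectorial domain $S_1\subset S$ with opening $A_\theta$ and constants $C,M>0$ with $$\Big|f(x,\hbar)-\sum_{k=0}^{n-1}f_k(x)\hbar^k\Big|\le|\chi(x)|\,C M^n n!\,|\hbar|^n\qquad\text{for all } n\ge0,\ x\in U,\ \hbar\in S_1 .$$ When $\chi$ is not mentioned, $\chi=1$. *Hypotheses.* Let $X\subset\mathbb C$ be a domain and $S$ a sectorial domain with opening $A_\theta$.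 Consider $\hbar\,\partial_xf=af^2+bf+c$, where $a,b,c$ are holomorphic on $X\times S$ and have locally uniform (Poincaré) asymptotic expansions $\hat a=\sum a_k\hbar^k$, $\hat b=\sum b_k\hbar^k$, $\hat c=\sum c_k\hbar^k$ with coefficients holomorphic on $X$, as $\hbar\to0$ along $A_\theta$. Put $D_0=b_0^2-4a_0c_0$ and let $\alpha\in\{+,-\}$. Let $x_0\in X$ lie in a WKB $(\theta,\alpha)$-halfstrip $W=W_\theta^\alpha(x_0',r)\subset X$, with a holomorphic branch $\sqrt{D_0}$ on $W$; that is, $W=\Psi(H_r)$ where $H_r=\{z : \operatorname{dist}(z,e^{i\theta}\mathbb R_\alpha)<r\}$, $r>0$, and $\Psi:H_r\to X$ is holomorphic with $\Psi(0)=x_0'$ and $\sqrt{D_0(\Psi(z))}\,\Psi'(z)=1$ (so $\Psi$ is inverse to the possibly multivalued Liouville transformation $x\mapsto\int_{x_0'}^x\sqrt{D_0}$). For $0<r_0<r$ let $W_\theta^\alpha(x_0',r_0)=\Psi(H_{r_0})$. Assume: 1. if $\alpha=-$, then $a_0$ has no zeros on $W$; if $\alpha=+$, then $\sqrt{D_0}=b_0$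 at every zero of $a_0$ in $W$. Thus the leading-order solution $f_0^\alpha=(-b_0+\alpha\sqrt{D_0})/(2a_0)$, read as $-c_0/b_0$ at zeros of $a_0$, is holomorphic on $W$; 2. $a\simeq\hat a$, $b\simeq\hat b$, $c\simeq\hat c$ as $\hbar\to0$ along $\bar A_\theta$, with respect to $\sqrt{D_0}$, uniformly for $x\in W$. *Conclusion.* There is a unique formal solution $\hat f_\alpha=\sum_kf^\alpha_k\hbar^k$ on $W$, with holomorphic coefficients, whose leading term is $f_0^\alpha$. There are a domain $\mathbb V\subset W\times S$ and a holomorphic solution $f=f^\theta_\alpha$ of the Riccati equation on $\mathbb V$ such that: * **(extension to $W$)** every $x\in W$ has an open neighbourhood $U\subset W$ and a sectorial domain $S_0\subset S$ with opening $A_\theta$ such that $U\times S_0\subset\mathbb V$ and $f\simeq\hat f_\alpha$ as $\hbar\to0$ along $\bar A_\theta$, uniformly for $x\in U$; * **(it extends the canonical local exact solution)** if $U_0\ni x_0$ is a domain compactly contained in $W$, $S_0\subset S$ is a sectorial domain with opening $A_\theta$, and $g$ is a holomorphic solution on $U_0\times S_0$ with $g\simeq\hat f_\alpha$ along $\bar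 A_\theta$ uniformly on $U_0$, then there is a sectorial domain $S_1\subset S_0$ with opening $A_\theta$ such that $U_0\times S_1\subset\mathbb V$ and $g=f$ on $U_0\times S_1$; * **(uniqueness)** let $\mathbb V'\subset W\times S$ be a domain that contains, for every $x\in W$, a product of an open neighbourhood of $x$ in $W$ and a sectorial domain with opening $A_\theta$. If $g$ is a holomorphic solution on $\mathbb V'$ with $g\simeq\hat f_\alpha$ along $\bar A_\theta$ uniformly near $x_0$ (on some such product), then for every $x\in W$ there are an open neighbourhood $U$ of $x$ and a sectorial domain $S_0$ with opening $A_\theta$ such that $U\times S_0\subset\mathbb V\cap\mathbb V'$ and $f=g$ on $U\times S_0$; * **(uniform asymptotics on thinner halfstrips)** for every $r_0\in(0,r)$ such that $f_0^\alpha$ is bounded on $W_0=W_\theta^\alpha(x_0',r_0)$, there is a sectorial domain $S_0\subset S$ with opening $A_\theta$ such that $W_0\times S_0\subset\mathbb V$ (so $f$ is a holomorphic solution on $W_0\times S_0$, hence on the union of these products) and $f\simeq\hat f_\alpha$ as $\hbar\to0$ along $\bar A_\theta$, uniformly for $x\in W_0$. -/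

import Mathlib

open Set Topology
open scoped Nat

noncomputable section

namespace WKB

/-! ### Sectorial domains in the `ħ`-plane -/

/-- The Borel disc of diameter `δ` bisected by the direction `θ`. -/
def borelDisc (θ δ : ℝ) : Set ℂ :=
  {h | 1 / δ < (Complex.exp (θ * Complex.I) / h).re}

/-- The directions (points of the unit circle) in which `S` accumulates at the origin, i.e. the
intersection of the closure of `S` in the real-oriented blowup of `ℂ` at `0` with the boundary
circle. -/
def limitDirections (S : Set ℂ) : Set ℂ :=
  {u | ‖u‖ = 1 ∧ ∀ η > 0, ∃ h ∈ S, ‖h‖ < η ∧ ‖h / (‖h‖ : ℂ) - u‖ < η}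

/-- The closed halfplane arc `[θ - π/2, θ + π/2]`, as a subset of the unit circle. -/
def closedArc (θ : ℝ) : Set ℂ :=
  {u | ‖u‖ = 1 ∧ 0 ≤ (u * Complex.exp (-(θ * Complex.I))).re}

/-- Sectorial domains at the origin with opening `A_θ = (θ - π/2, θ + π/2)`: simply connected
domains in the punctured plane whose closure in the real-oriented blowup meets the boundary circle
in the closed arc, and which fill out a neighbourhood of the open arc in the usual sense for this
opening: they contain a Borel disc. -/
structure IsSectorialDomain (θ : ℝ) (S : Set ℂ) : Prop where
  isOpen : IsOpen S
  simplyConnected : SimplyConnectedSpace S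
  zero_notMem : (0 : ℂ) ∉ S
  directions : limitDirections S = closedArc θ
  borel : ∃ δ > 0, borelDisc θ δ ⊆ S

/-! ### Asymptotic expansions

A formal power series `∑ F k (x) ħ ^ k` with holomorphic coefficients is given by the sequence `F`
of its coefficients; functions of `(x, ħ)` are functions on `ℂ × ℂ`. -/

/-- The order-`n` remainder `f (x, ħ) - ∑_{k < n} F k (x) ħ ^ k`. -/
def remainder (f : ℂ × ℂ → ℂ) (F : ℕ → ℂ → ℂ) (n : ℕ) (x h : ℂ) : ℂ :=
  f (x, h) - ∑ k ∈ Finset.range n, F k x * h ^ k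

/-- Locally uniform Poincaré asymptotics `f ∼ F` on `X` as `ħ → 0` along the open arc `A_θ`:
the bounds may depend on the order and on the compactly contained subarc. -/
def LocUnifAsymptotic (θ : ℝ) (X S : Set ℂ) (f : ℂ × ℂ → ℂ) (F : ℕ → ℂ → ℂ) : Prop :=
  ∀ x₀ ∈ X, ∃ U ∈ 𝓝 x₀, ∀ n : ℕ, ∀ η : ℝ, 0 < η → η < Real.pi / 2 →
    ∃ ρ > 0, ∃ C > 0, ∀ x ∈ U ∩ X, ∀ h ∈ S, ‖h‖ < ρ →
      |(h * Complex.exp (-(θ * Complex.I))).arg| ≤ η →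
        ‖remainder f F n x h‖ ≤ C * ‖h‖ ^ n

/-- Uniform (1-)Gevrey asymptotics `f ≃ F` on `U` as `ħ → 0` along the closed arc
`[θ - π/2, θ + π/2]`, with respect to the asymptotic scale `χ`. -/
def UnifGevrey (θ : ℝ) (U S : Set ℂ) (χ : ℂ → ℂ) (f : ℂ × ℂ → ℂ) (F : ℕ → ℂ → ℂ) : Prop :=
  ∃ S₁ ⊆ S, IsSectorialDomain θ S₁ ∧ ∃ C > 0, ∃ M > 0,
    ∀ n : ℕ, ∀ x ∈ U, ∀ h ∈ S₁,
      ‖remainder f F n x h‖ ≤ ‖χ x‖ * C * M ^ n * (n ! : ℝ) * ‖h‖ ^ n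

/-! ### Formal solutions -/

/-- The leading-order discriminant `b₀ ^ 2 - 4 a₀ c₀`. -/
def discriminant (A B C : ℕ → ℂ → ℂ) (x : ℂ) : ℂ :=
  B 0 x ^ 2 - 4 * A 0 x * C 0 x

/-- The leading-order solution `(-b₀ + ε √D₀) / (2 a₀)`, continued by `-c₀ / b₀` to the zeros of
`a₀`; here `s` is the chosen branch of `√D₀` and `ε = ±1` is the sign. -/
def leadingOrder (ε : ℤˣ) (s : ℂ → ℂ) (A B C : ℕ → ℂ → ℂ) (x : ℂ) : ℂ :=
  open Classical in
  if A 0 x = 0 then -C 0 x / B 0 x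
  else (-B 0 x + ((ε : ℤ) : ℂ) * s x) / (2 * A 0 x)

/-- `F` is a formal solution on `W` of the Riccati equation: its coefficients are holomorphic on
`W` and `ħ ∂ₓ F = A F² + B F + C` as formal power series in `ħ`. -/
def IsFormalSolution (W : Set ℂ) (A B C F : ℕ → ℂ → ℂ) : Prop :=
  (∀ k, DifferentiableOn ℂ (F k) W) ∧
  ∀ x ∈ W,
    (PowerSeries.X * PowerSeries.mk (fun k => deriv (F k) x) : PowerSeries ℂ) =
      PowerSeries.mk (fun k => A k x) * PowerSeries.mk (fun k => F k x) ^ 2 +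
        PowerSeries.mk (fun k => B k x) * PowerSeries.mk (fun k => F k x) +
        PowerSeries.mk (fun k => C k x)

/-! ### WKB halfstrips -/

/-- The ray `ε e^{iθ} ℝ₊`, `ε = ±1`. -/
def ray (θ : ℝ) (ε : ℤˣ) : Set ℂ :=
  {z | ∃ t : ℝ, 0 ≤ t ∧ z = ((ε : ℤ) : ℂ) * t * Complex.exp (θ * Complex.I)}

/-- The halfstrip of points at distance less than `r` from the ray `ε e^{iθ} ℝ₊`. -/
def halfstrip (θ : ℝ) (ε : ℤˣ) (r : ℝ) : Set ℂ :=
  {z | Metric.infDist z (ray θ ε) < r}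

/-- The image in the `x`-plane of the halfstrip of radius `r` under `Ψ`. -/
def wkbHalfstrip (θ : ℝ) (ε : ℤˣ) (Ψ : ℂ → ℂ) (r : ℝ) : Set ℂ :=
  Ψ '' halfstrip θ ε r

/-- `wkbHalfstrip θ ε Ψ r` is the WKB `(θ, ε)`-halfstrip domain `W = W_θ^ε(x₁, r) ⊆ X` for the
branch `s` of the square root of `D₀`. Here `Ψ` is the inverse of the (possibly multivalued)
Liouville transformation `Φ(x) = ∫_{x₁}^x √D₀` based at `x₁`: it takes `0` to `x₁`, and
`(Φ ∘ Ψ)' = s(Ψ) Ψ' = 1`. It need not be injective (closed trajectories). -/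
structure IsWKBHalfstrip (X : Set ℂ) (D₀ s : ℂ → ℂ) (θ : ℝ) (ε : ℤˣ) (x₁ : ℂ) (r : ℝ)
    (Ψ : ℂ → ℂ) : Prop where
  pos : 0 < r
  holo : DifferentiableOn ℂ Ψ (halfstrip θ ε r)
  base : Ψ 0 = x₁
  subset : wkbHalfstrip θ ε Ψ r ⊆ X
  branch_holo : DifferentiableOn ℂ s (wkbHalfstrip θ ε Ψ r)
  branch_sq : ∀ x ∈ wkbHalfstrip θ ε Ψ r, s x ^ 2 = D₀ x
  inverse : ∀ z ∈ halfstrip θ ε r, s (Ψ z) * deriv Ψ z = 1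

/-! ### Exact solutions -/

/-- `f` is a holomorphic solution of `ħ ∂ₓ f = a f² + b f + c` on `V`, a set of pairs `(x, ħ)`. -/
def IsHolomorphicSolution (V : Set (ℂ × ℂ)) (a b c f : ℂ × ℂ → ℂ) : Prop :=
  DifferentiableOn ℂ f V ∧
  ∀ p ∈ V, p.2 * deriv (fun x => f (x, p.2)) p.1 = a p * f p ^ 2 + b p * f p + c p

/-- `V ⊆ W × S` is a domain which around every point of `W` contains a product of a
neighbourhood and of a sectorial domain with opening `A_θ`. -/
structure IsSemisectorialDomain (θ : ℝ) (W S : Set ℂ) (V : Set (ℂ × ℂ)) : Prop where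
  isOpen : IsOpen V
  isConnected : IsConnected V
  subset : V ⊆ W ×ˢ S
  products : ∀ x ∈ W, ∃ U ⊆ W, IsOpen U ∧ x ∈ U ∧
    ∃ S₀ ⊆ S, IsSectorialDomain θ S₀ ∧ U ×ˢ S₀ ⊆ V

/-- Near the point `x` the function `f` on `V` has uniform Gevrey asymptotics `f ≃ F` along the
closed arc: this holds on a product `U × S₀ ⊆ V` of a neighbourhood of `x` and of a sectorial
domain with opening `A_θ`. -/
def GevreyNear (θ : ℝ) (W S : Set ℂ) (V : Set (ℂ × ℂ)) (f : ℂ × ℂ → ℂ) (F : ℕ → ℂ → ℂ)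
    (x : ℂ) : Prop :=
  ∃ U ⊆ W, IsOpen U ∧ x ∈ U ∧ ∃ S₀ ⊆ S, IsSectorialDomain θ S₀ ∧ U ×ˢ S₀ ⊆ V ∧
    UnifGevrey θ U S₀ 1 f F

/-- `f` on `V` and `g` on `V'` agree near `x`, as germs along the arc `A_θ`. -/
def AgreeNear (θ : ℝ) (V V' : Set (ℂ × ℂ)) (f g : ℂ × ℂ → ℂ) (x : ℂ) : Prop :=
  ∃ U, IsOpen U ∧ x ∈ U ∧ ∃ S₀, IsSectorialDomain θ S₀ ∧
    U ×ˢ S₀ ⊆ V ∩ V' ∧ EqOn f g (U ×ˢ S₀)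

/-- `g` on `U₀ × S₀` is a canonical local exact solution near `x₀`: a holomorphic solution, with
`U₀` a domain containing `x₀` compactly contained in `W` and `S₀ ⊆ S` sectorial with opening `A_θ`,
which is Gevrey asymptotic to `F` along the closed arc uniformly on `U₀`. -/
structure IsCanonicalLocalSolution (θ : ℝ) (W S : Set ℂ) (a b c : ℂ × ℂ → ℂ) (F : ℕ → ℂ → ℂ)
    (x₀ : ℂ) (U₀ S₀ : Set ℂ) (g : ℂ × ℂ → ℂ) : Prop where
  isOpen : IsOpen U₀
  isConnected : IsConnected U₀
  mem : x₀ ∈ U₀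
  compact : IsCompact (closure U₀)
  closure_subset : closure U₀ ⊆ W
  sectorial : IsSectorialDomain θ S₀
  subset : S₀ ⊆ S
  solution : IsHolomorphicSolution (U₀ ×ˢ S₀) a b c g
  gevrey : UnifGevrey θ U₀ S₀ 1 g F

end WKB

end

namespace WKB

/-! ### Borel discs -/

/-! In the coordinate `z` with `Ψ' = 1 / √D₀`, the equation becomes `ε ħ ∂_z f = α f² + β f + γ` on
a straight halfstrip, with `(α, β, γ) = (ε / √D₀) (a, b, c)`. Asymptotics with respect to `√D₀`
become Gevrey bounds on `α, β, γ` that are uniform over the halfstrip. The leading discriminant is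
now `1`, and the linearisation `2 α₀ f₀ + β₀` at the chosen root is `1`.

The root `f₀` may be unbounded along the halfstrip, so the scalar equation is not solved directly.
It is the projective form of a linear system `ε ħ y' = m y` with `m` a traceless `2 × 2` matrix
(`riccatiMatrix`). The leading part of `m` has eigenvalues `±1/2`, and `P = 1/2 - m₀` is the
projector onto the line through `(f₀, 1)`; it stays bounded even where `f₀` does not. The exact
invariant line is sought as the image of `P + N`, where `N` solves a matrix Riccati equation `ε ħ N'
= N - ħ (k₀ + k₁ N + N k₂ + N k₃ N)` with bounded coefficients (`exists_exact_line`).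

Such an equation is solved by iterating the Laplace integral `lapl` along the axis of the halfstrip.
Translation in that direction preserves the halfstrip, and the integral has norm at most `δ` over
the Borel disc of diameter `δ`, so the iteration contracts for small `δ`. The matching a priori
estimate `norm_le_of_bounded_solution` for bounded solutions drives everything else: contraction,
the Gevrey bounds on the remainders, and the identities `P N = 0` and `N (1 - P) = 0`. The formal
coefficients of `N` are bounded by Nagumo's method, with weights given by powers of the distance to
the boundary.

Where `f₀` is bounded, the vector `(P + N)(f₀, 1)` has second component close to `1`, and the
quotient of its components is the scalar solution with its uniform Gevrey expansion
(`exists_exact_riccati`). Its coefficients form a formal solution, and this is unique given the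
leading term.

By Watson's lemma on Borel discs (`eq_zero_of_gevrey_flat`), a function is determined by its Gevrey
expansion. Hence the solution at `(Ψ z, ħ)` is the Borel sum of the formal solution at `Ψ z`; it
depends on `Ψ z` alone, and non-injectivity of `Ψ` is harmless. Bounded convex pieces of the
halfstrip containing `0` give products that cover `W` and share the base point, so their union is a
connected domain. Uniqueness near `x₀` is Watson's lemma, and the identity theorem propagates it
over `W`. -/

lemma ne_zero_of_mem_borelDisc {θ δ : ℝ} (hδ : 0 < δ) {h : ℂ} (hh : h ∈ borelDisc θ δ) :
    h ≠ 0 := by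
  rintro rfl
  have : 1 / δ < 0 := by simpa [borelDisc] using hh
  exact absurd this (not_lt.2 (by positivity))

lemma norm_lt_of_mem_borelDisc {θ δ : ℝ} (hδ : 0 < δ) {h : ℂ} (hh : h ∈ borelDisc θ δ) :
    ‖h‖ < δ := by
  have h0 := ne_zero_of_mem_borelDisc hδ hh
  have h1 : 1 / δ < 1 / ‖h‖ := by
    refine lt_of_lt_of_le hh ((Complex.re_le_norm _).trans ?_)
    rw [norm_div, Complex.norm_exp_ofReal_mul_I]
  exact (one_div_lt_one_div hδ (norm_pos_iff.2 h0)).1 h1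

lemma borelDisc_mono {θ δ δ' : ℝ} (hδ : 0 < δ) (h : δ ≤ δ') : borelDisc θ δ ⊆ borelDisc θ δ' :=
  fun _ hh => lt_of_le_of_lt (one_div_le_one_div_of_le hδ h) hh

/-- Inversion turns a half-plane into a disc through the origin: for `h ≠ 0` the condition reads
`‖h‖² < δ Re(e^{iθ} h̄)`, and the square is completed. Openness and convexity are read off from this
form. -/
lemma borelDisc_eq_ball {θ δ : ℝ} (hδ : 0 < δ) :
    borelDisc θ δ = Metric.ball (Complex.exp (θ * Complex.I) * (δ / 2 : ℝ)) (δ / 2) := by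
  ext h
  set κ := Complex.exp (θ * Complex.I) with hκ
  have hκ1 : κ.re ^ 2 + κ.im ^ 2 = 1 := by
    have := Complex.norm_exp_ofReal_mul_I θ
    rw [← hκ] at this
    have h2 := Complex.sq_norm κ
    rw [this, Complex.normSq_apply] at h2
    linarith
  have key : h ∈ Metric.ball (κ * (δ / 2 : ℝ)) (δ / 2) ↔
      h.re ^ 2 + h.im ^ 2 < δ * (κ.re * h.re + κ.im * h.im) := by
    rw [mem_ball_iff_norm, ← abs_of_pos (show 0 < δ / 2 by positivity),
      ← abs_of_nonneg (norm_nonneg (h - _)), ← sq_lt_sq, Complex.sq_norm, Complex.normSq_apply]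
    simp only [Complex.sub_re, Complex.sub_im, Complex.mul_re, Complex.mul_im, Complex.ofReal_re,
      Complex.ofReal_im, mul_zero, sub_zero, zero_add,
      abs_of_pos (show 0 < δ / 2 by positivity)]
    have : (δ / 2) ^ 2 * (κ.re ^ 2 + κ.im ^ 2) = (δ / 2) ^ 2 := by rw [hκ1, mul_one]
    constructor <;> intro H <;> nlinarith
  rw [key]
  by_cases h0 : h = 0
  · subst h0
    simp [borelDisc, hδ.le]
  · have hn : 0 < h.re ^ 2 + h.im ^ 2 := by
      have := Complex.normSq_pos.2 h0
      rw [Complex.normSq_apply] at this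
      nlinarith
    simp only [borelDisc, mem_ofPred_eq, ← hκ, Complex.div_re, Complex.normSq_apply]
    rw [← add_div, div_lt_div_iff₀ hδ (by nlinarith)]
    constructor <;> intro H <;> nlinarith

lemma isOpen_borelDisc {θ δ : ℝ} (hδ : 0 < δ) : IsOpen (borelDisc θ δ) := by
  rw [borelDisc_eq_ball hδ]; exact Metric.isOpen_ball

lemma convex_borelDisc {θ δ : ℝ} (hδ : 0 < δ) : Convex ℝ (borelDisc θ δ) := by
  rw [borelDisc_eq_ball hδ]; exact convex_ball _ _

lemma smul_mem_borelDisc {θ δ : ℝ} {u : ℂ} (hu : ‖u‖ = 1)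
    {t : ℝ} (ht : 0 < t)
    (htδ : t < δ * (u * Complex.exp (-(θ * Complex.I))).re) (hδ : 0 < δ) :
    (t : ℂ) * u ∈ borelDisc θ δ := by
  have hu0 : u ≠ 0 := by intro h; simp [h] at hu
  have e1 : Complex.exp (θ * Complex.I) / (t * u) =
      ((1 / t : ℝ) : ℂ) * (starRingEnd ℂ) (u * Complex.exp (-(θ * Complex.I))) := by
    have hc : (starRingEnd ℂ) (Complex.exp (-(θ * Complex.I))) = Complex.exp (θ * Complex.I) := by
      rw [← Complex.exp_conj]; simp
    have hi : u⁻¹ = (starRingEnd ℂ) u := Complex.inv_eq_conj hu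
    rw [map_mul, hc, ← hi]
    have : (t : ℂ) ≠ 0 := by exact_mod_cast ht.ne'
    push_cast
    field_simp
  simp only [borelDisc, mem_ofPred_eq, e1, Complex.re_ofReal_mul, Complex.conj_re]
  rw [one_div_mul_eq_div, div_lt_div_iff₀ hδ ht]
  linarith

lemma exists_mem_borelDisc_norm_lt (θ : ℝ) {δ η : ℝ} (hδ : 0 < δ) (hη : 0 < η) :
    ∃ h ∈ borelDisc θ δ, ‖h‖ < η := by
  have hre : ((Complex.exp (θ * Complex.I)) * Complex.exp (-(θ * Complex.I))).re = 1 := by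
    rw [← Complex.exp_add]; simp
  refine ⟨((min δ η / 2 : ℝ) : ℂ) * Complex.exp (θ * Complex.I), smul_mem_borelDisc
    (Complex.norm_exp_ofReal_mul_I θ) (by positivity) ?_ hδ, ?_⟩
  · rw [hre]; linarith [min_le_left δ η, lt_min hδ hη]
  · rw [norm_mul, Complex.norm_exp_ofReal_mul_I, mul_one, Complex.norm_real, Real.norm_eq_abs,
      abs_of_pos (by positivity)]
    linarith [min_le_right δ η, lt_min hδ hη]

lemma limitDirections_borelDisc (θ : ℝ) {δ : ℝ} (hδ : 0 < δ) :
    limitDirections (borelDisc θ δ) = closedArc θ := by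
  ext u
  simp only [limitDirections, closedArc, mem_ofPred_eq]
  refine and_congr_right fun hu => ⟨fun H => ?_, fun H η hη => ?_⟩
  · by_contra! hneg
    set e := Complex.exp (-(θ * Complex.I)) with he
    have hen : ‖e‖ = 1 := by
      rw [he, show -((θ : ℂ) * Complex.I) = ((-θ : ℝ) : ℂ) * Complex.I by push_cast; ring]
      exact Complex.norm_exp_ofReal_mul_I _
    -- The tolerance is the distance from `u` to the closed half-plane, while directions of points
    -- of the disc lie in the open half-plane.
    obtain ⟨h, hh, -, h2⟩ := H (-(u * e).re) (by linarith)
    have h0 := ne_zero_of_mem_borelDisc hδ hh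
    have hpos : 0 < (h / (‖h‖ : ℂ) * e).re := by
      have h1 : 0 < (Complex.exp (θ * Complex.I) / h).re := lt_trans (by positivity) hh
      have e1 : h / (‖h‖ : ℂ) * e =
          ((‖h‖ : ℝ) : ℂ) * (starRingEnd ℂ) (Complex.exp (θ * Complex.I) / h) := by
        rw [map_div₀, ← Complex.exp_conj]
        have : (starRingEnd ℂ) (θ * Complex.I) = -(θ * Complex.I) := by simp
        rw [this, ← he]
        have hc : (starRingEnd ℂ) h ≠ 0 := by simpa using h0
        have hn : (‖h‖ : ℂ) ≠ 0 := by simpa using h0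
        have := Complex.mul_conj' h
        field_simp
        linear_combination e * this
      rw [e1, Complex.re_ofReal_mul, Complex.conj_re]
      exact mul_pos (norm_pos_iff.2 h0) h1
    have : (h / (‖h‖ : ℂ) * e).re - (u * e).re ≤ ‖h / (‖h‖ : ℂ) - u‖ := by
      rw [← Complex.sub_re, ← sub_mul]
      refine (Complex.re_le_norm _).trans ?_
      rw [norm_mul, hen, mul_one]
    linarith
  · -- perturb `u` into the open arc
    set e := Complex.exp (-(θ * Complex.I)) with he
    set κ := Complex.exp (θ * Complex.I) with hκ
    have hκe : κ * e = 1 := by rw [hκ, he, ← Complex.exp_add]; simp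
    have hκn : ‖κ‖ = 1 := Complex.norm_exp_ofReal_mul_I θ
    -- The bound `1 / 2` keeps `u + τ κ` away from zero; the bound `η / 4` leaves the normalised
    -- direction within `2 τ < η` of `u`.
    set τ : ℝ := min (1 / 2) (η / 4) with hτ
    have hτ0 : 0 < τ := by positivity
    have hτ1 : τ ≤ 1 / 2 := min_le_left _ _
    have hτ2 : τ ≤ η / 4 := min_le_right _ _
    set w : ℂ := u + τ * κ with hw
    have hwu : ‖w - u‖ = τ := by
      rw [hw, add_sub_cancel_left, norm_mul, hκn, mul_one, Complex.norm_real, Real.norm_eq_abs,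
        abs_of_pos hτ0]
    have hwn : |‖w‖ - 1| ≤ τ := by
      rw [← hu, ← hwu]; exact abs_norm_sub_norm_le w u
    have hwpos : 0 < ‖w‖ := by linarith [(abs_le.1 hwn).1]
    have hw0 : (‖w‖ : ℂ) ≠ 0 := by exact_mod_cast hwpos.ne'
    set v : ℂ := w / ‖w‖ with hv
    have hvn : ‖v‖ = 1 := by rw [hv, norm_div, Complex.norm_real, norm_norm, div_self hwpos.ne']
    have hvre : 0 < (v * e).re := by
      have : v * e = ((1 / ‖w‖ : ℝ) : ℂ) * (u * e + τ) := by
        have h1 : w * e = u * e + τ := by rw [hw]; linear_combination (τ : ℂ) * hκe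
        rw [← h1, hv]; push_cast; ring
      rw [this, Complex.re_ofReal_mul, Complex.add_re, Complex.ofReal_re]
      exact mul_pos (by positivity) (by linarith)
    have hvu : ‖v - u‖ ≤ 2 * τ := by
      have h1 : ‖v - w‖ ≤ τ := by
        have : v - w = ((1 - ‖w‖ : ℝ) : ℂ) * v := by
          rw [hv]; push_cast; field_simp
        rw [this, norm_mul, hvn, mul_one, Complex.norm_real, Real.norm_eq_abs, abs_sub_comm]
        exact hwn
      calc ‖v - u‖ ≤ ‖v - w‖ + ‖w - u‖ := norm_sub_le_norm_sub_add_norm_sub v w u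
        _ ≤ 2 * τ := by rw [hwu]; linarith
    set t : ℝ := min (η / 2) (δ * (v * e).re / 2) with ht
    have ht0 : 0 < t := by positivity
    have htn : ‖(t : ℂ) * v‖ = t := by
      rw [norm_mul, hvn, mul_one, Complex.norm_real, Real.norm_eq_abs, abs_of_pos ht0]
    refine ⟨t * v, smul_mem_borelDisc hvn ht0 ?_ hδ, ?_, ?_⟩
    · have : t ≤ δ * (v * e).re / 2 := min_le_right _ _
      have : 0 < δ * (v * e).re := by positivity
      linarith
    · rw [htn]; linarith [min_le_left (η / 2) (δ * (v * e).re / 2)]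
    · rw [htn, mul_div_cancel_left₀ _ (by exact_mod_cast ht0.ne')]
      linarith

lemma isSectorialDomain_borelDisc (θ : ℝ) {δ : ℝ} (hδ : 0 < δ) :
    IsSectorialDomain θ (borelDisc θ δ) where
  isOpen := isOpen_borelDisc hδ
  simplyConnected := by
    have := (convex_borelDisc (θ := θ) hδ).contractibleSpace
      (by obtain ⟨h, hh, -⟩ := exists_mem_borelDisc_norm_lt θ hδ one_pos; exact ⟨h, hh⟩)
    infer_instance
  zero_notMem := fun h => ne_zero_of_mem_borelDisc hδ h rfl
  directions := limitDirections_borelDisc θ hδ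
  borel := ⟨δ, hδ, subset_rfl⟩

/-! ### Halfstrips -/

/-- The direction of the halfstrip. -/
noncomputable def dir (θ : ℝ) (ε : ℤˣ) : ℂ := ((ε : ℤ) : ℂ) * Complex.exp (θ * Complex.I)

lemma units_cast_sq (ε : ℤˣ) : ((ε : ℤ) : ℂ) * ((ε : ℤ) : ℂ) = 1 := by
  rcases Int.units_eq_one_or ε with rfl | rfl <;> simp

lemma norm_units_cast (ε : ℤˣ) : ‖((ε : ℤ) : ℂ)‖ = 1 := by
  rcases Int.units_eq_one_or ε with rfl | rfl <;> simp

lemma ray_eq_image (θ : ℝ) (ε : ℤˣ) :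
    ray θ ε = (fun t : ℝ => t • dir θ ε) '' Ici 0 := by
  ext z
  simp only [ray, dir, mem_ofPred_eq, mem_image, mem_Ici, Complex.real_smul]
  constructor
  · rintro ⟨t, ht, rfl⟩; exact ⟨t, ht, by ring⟩
  · rintro ⟨t, ht, rfl⟩; exact ⟨t, ht, by ring⟩

lemma zero_mem_ray (θ : ℝ) (ε : ℤˣ) : (0 : ℂ) ∈ ray θ ε := ⟨0, le_rfl, by simp⟩

lemma ray_nonempty (θ : ℝ) (ε : ℤˣ) : (ray θ ε).Nonempty := ⟨0, zero_mem_ray θ ε⟩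

lemma convex_ray (θ : ℝ) (ε : ℤˣ) : Convex ℝ (ray θ ε) := by
  rw [ray_eq_image]
  exact (convex_Ici 0).is_linear_image (f := fun t : ℝ => t • dir θ ε)
    ⟨fun a b => add_smul a b _, fun a b => by simp [mul_smul]⟩

lemma isOpen_halfstrip (θ : ℝ) (ε : ℤˣ) (r : ℝ) : IsOpen (halfstrip θ ε r) :=
  isOpen_lt (Metric.continuous_infDist_pt _) continuous_const

lemma convex_halfstrip (θ : ℝ) (ε : ℤˣ) (r : ℝ) : Convex ℝ (halfstrip θ ε r) := by
  have : halfstrip θ ε r = Metric.thickening r (ray θ ε) := by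
    ext z
    rw [Metric.mem_thickening_iff, halfstrip, mem_ofPred_eq, Metric.infDist_lt_iff (ray_nonempty θ ε)]
  rw [this]
  exact (convex_ray θ ε).thickening r

lemma zero_mem_halfstrip (θ : ℝ) (ε : ℤˣ) {r : ℝ} (hr : 0 < r) : (0 : ℂ) ∈ halfstrip θ ε r := by
  rwa [halfstrip, mem_ofPred_eq, Metric.infDist_zero_of_mem (zero_mem_ray θ ε)]

lemma halfstrip_mono {θ : ℝ} {ε : ℤˣ} {r r' : ℝ} (h : r ≤ r') :
    halfstrip θ ε r ⊆ halfstrip θ ε r' := fun _ hz => lt_of_lt_of_le hz h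

/-- Translation along the axis maps the ray into itself. Thus halfstrips contain the integration
paths issuing from their points, without approaching the boundary. -/
lemma infDist_add_dir_le (θ : ℝ) (ε : ℤˣ) (z : ℂ) {t : ℝ} (ht : 0 ≤ t) :
    Metric.infDist (z + t * dir θ ε) (ray θ ε) ≤ Metric.infDist z (ray θ ε) := by
  rw [Metric.le_infDist (ray_nonempty θ ε)]
  rintro y ⟨s, hs, rfl⟩
  refine (Metric.infDist_le_dist_of_mem
    (y := ((ε : ℤ) : ℂ) * ↑s * Complex.exp (θ * Complex.I) + t * dir θ ε) ?_).trans ?_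
  · exact ⟨s + t, add_nonneg hs ht, by rw [dir]; push_cast; ring⟩
  · rw [dist_add_right]

lemma add_dir_mem_halfstrip {θ : ℝ} {ε : ℤˣ} {r : ℝ} {z : ℂ} (hz : z ∈ halfstrip θ ε r) {t : ℝ}
    (ht : 0 ≤ t) : z + t * dir θ ε ∈ halfstrip θ ε r :=
  lt_of_le_of_lt (infDist_add_dir_le θ ε z ht) hz

/-- The distance from a point of the halfstrip of radius `r` to its boundary. -/
noncomputable def gap (θ : ℝ) (ε : ℤˣ) (r : ℝ) (z : ℂ) : ℝ := r - Metric.infDist z (ray θ ε)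

lemma gap_pos {θ : ℝ} {ε : ℤˣ} {r : ℝ} {z : ℂ} (hz : z ∈ halfstrip θ ε r) : 0 < gap θ ε r z :=
  sub_pos.2 hz

lemma gap_le (θ : ℝ) (ε : ℤˣ) (r : ℝ) (z : ℂ) : gap θ ε r z ≤ r :=
  sub_le_self _ Metric.infDist_nonneg

lemma mem_halfstrip_iff_gap_pos {θ : ℝ} {ε : ℤˣ} {r : ℝ} {z : ℂ} :
    z ∈ halfstrip θ ε r ↔ 0 < gap θ ε r z := by rw [gap, sub_pos]; rfl

lemma gap_sub_dist_le (θ : ℝ) (ε : ℤˣ) (r : ℝ) (z w : ℂ) :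
    gap θ ε r z - dist w z ≤ gap θ ε r w := by
  have := Metric.infDist_le_infDist_add_dist (s := ray θ ε) (x := w) (y := z)
  simp only [gap]; linarith

lemma sub_le_gap {θ : ℝ} {ε : ℤˣ} {r r' : ℝ} {z : ℂ} (hz : z ∈ halfstrip θ ε r') :
    r - r' ≤ gap θ ε r z := by
  have : Metric.infDist z (ray θ ε) < r' := hz
  simp only [gap]; linarith

lemma ball_subset_halfstrip {θ : ℝ} {ε : ℤˣ} {r : ℝ} {z : ℂ} {d : ℝ} (hd : d ≤ gap θ ε r z) :
    Metric.ball z d ⊆ halfstrip θ ε r := fun w hw => by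
  rw [mem_halfstrip_iff_gap_pos]
  have := gap_sub_dist_le θ ε r z w
  have := Metric.mem_ball.1 hw
  linarith

/-! ### Watson's lemma on Borel discs -/

/-- Optimal truncation: for `n = ⌊1 / (2 M x)⌋` one has `M x n ≤ 1 / 2`, and `n! ≤ n ^ n` bounds the
`n`-th term by `2 ^ (-n)`, which is exponentially small in `1 / x`. -/
lemma le_exp_of_forall_le_factorial {y x C M : ℝ} (hx : 0 < x) (hC : 0 ≤ C) (hM : 0 < M)
    (H : ∀ n : ℕ, y ≤ C * M ^ n * (n ! : ℝ) * x ^ n) :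
    y ≤ 2 * C * Real.exp (-(Real.log 2 / (2 * M) * x⁻¹)) := by
  set n := ⌊1 / (2 * M * x)⌋₊ with hn
  have h1 : (n : ℝ) ≤ 1 / (2 * M * x) := Nat.floor_le (by positivity)
  have h2 : 1 / (2 * M * x) < n + 1 := Nat.lt_floor_add_one _
  have h3 : M * x * n ≤ 1 / 2 := by
    rw [le_div_iff₀ (by positivity)] at h1; linarith
  have h4 : M ^ n * (n ! : ℝ) * x ^ n ≤ (1 / 2) ^ n := by
    calc M ^ n * (n ! : ℝ) * x ^ n ≤ M ^ n * (n : ℝ) ^ n * x ^ n := by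
          gcongr; exact_mod_cast Nat.factorial_le_pow n
      _ = (M * x * n) ^ n := by rw [mul_pow, mul_pow]; ring
      _ ≤ (1 / 2) ^ n := by gcongr
  have hl : 0 < Real.log 2 := Real.log_pos (by norm_num)
  have h5 : ((1 : ℝ) / 2) ^ n ≤ 2 * Real.exp (-(Real.log 2 / (2 * M) * x⁻¹)) := by
    have e1 : ((1 : ℝ) / 2) ^ n = Real.exp (-(n * Real.log 2)) := by
      rw [Real.exp_neg, Real.exp_nat_mul, Real.exp_log (by norm_num)]; simp
    have e2 : 2 * Real.exp (-(Real.log 2 / (2 * M) * x⁻¹)) =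
        Real.exp (Real.log 2 + -(Real.log 2 / (2 * M) * x⁻¹)) := by
      rw [Real.exp_add, Real.exp_log (by norm_num)]
    rw [e1, e2, Real.exp_le_exp]
    have e3 : Real.log 2 / (2 * M) * x⁻¹ = 1 / (2 * M * x) * Real.log 2 := by field_simp
    rw [e3]; nlinarith
  calc y ≤ C * M ^ n * (n ! : ℝ) * x ^ n := H n
    _ = C * (M ^ n * (n ! : ℝ) * x ^ n) := by ring
    _ ≤ C * (2 * Real.exp (-(Real.log 2 / (2 * M) * x⁻¹))) :=
        mul_le_mul_of_nonneg_left (h4.trans h5) hC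
    _ = _ := by ring

/-- This multiplier decays superexponentially on the positive axis. In the rest of the half-plane
only the term `Im (q + 1) · arg (q + 1)` can make it grow, hence at rate at most `μ π / 2`. -/
lemma norm_exp_neg_mul_log_le {μ : ℝ} (hμ : 0 ≤ μ) {q : ℂ} (hq : 0 ≤ q.re) :
    ‖Complex.exp (-(μ * ((q + 1) * Complex.log (q + 1))))‖ ≤
      Real.exp (μ * (Real.pi / 2) * ‖q‖) := by
  have hre : 1 ≤ (q + 1).re := by simpa using hq
  have hn : 1 ≤ ‖q + 1‖ := hre.trans (Complex.re_le_norm _)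
  have harg : |(q + 1).arg| ≤ Real.pi / 2 := Complex.abs_arg_le_pi_div_two_iff.2 (by linarith)
  rw [Complex.norm_exp, Real.exp_le_exp, Complex.neg_re, Complex.re_ofReal_mul, Complex.mul_re,
    Complex.log_re, Complex.log_im]
  have h1 : 0 ≤ (q + 1).re * Real.log ‖q + 1‖ := mul_nonneg (by linarith) (Real.log_nonneg hn)
  have h2 : (q + 1).im * (q + 1).arg ≤ ‖q‖ * (Real.pi / 2) := by
    refine (le_abs_self _).trans ?_
    rw [abs_mul]
    have : |(q + 1).im| ≤ ‖q‖ := by simpa using Complex.abs_im_le_norm q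
    gcongr
  nlinarith

/-- With `μ = 2 c / π` the growth of the multiplier `exp (-μ (q + 1) log (q + 1))` is exactly
compensated by the decay of `f`. The product is bounded in the half-plane and superexponentially
small on the axis, so Phragmén–Lindelöf makes it vanish. -/
lemma eq_zero_of_exp_decay {f : ℂ → ℂ} {c K : ℝ} (hc : 0 < c) (hK : 0 ≤ K)
    (hd : ∀ q : ℂ, 0 ≤ q.re → DifferentiableAt ℂ f q)
    (hf : ∀ q : ℂ, 0 ≤ q.re → ‖f q‖ ≤ K * Real.exp (-(c * ‖q‖))) {q : ℂ} (hq : 0 ≤ q.re) :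
    f q = 0 := by
  set μ : ℝ := 2 * c / Real.pi with hμ
  have hμ0 : 0 < μ := by positivity
  set g : ℂ → ℂ := fun q => f q * Complex.exp (-(μ * ((q + 1) * Complex.log (q + 1)))) with hg
  have hslit : ∀ q : ℂ, 0 ≤ q.re → q + 1 ∈ Complex.slitPlane := fun q hq => by
    left; simp; linarith
  have hgb : ∀ q : ℂ, 0 ≤ q.re → ‖g q‖ ≤ K := fun q hq => by
    rw [hg, norm_mul]
    calc _ ≤ K * Real.exp (-(c * ‖q‖)) * Real.exp (μ * (Real.pi / 2) * ‖q‖) :=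
          mul_le_mul (hf q hq) (norm_exp_neg_mul_log_le hμ0.le hq) (norm_nonneg _) (by positivity)
      _ = K := by
        rw [mul_assoc, ← Real.exp_add]
        have : -(c * ‖q‖) + μ * (Real.pi / 2) * ‖q‖ = 0 := by
          rw [hμ]; field_simp; ring
        rw [this, Real.exp_zero, mul_one]
  have hgd : DiffContOnCl ℂ g {z | 0 < z.re} := by
    apply DifferentiableOn.diffContOnCl
    intro q hq
    rw [Complex.closure_setOfPred_lt_re] at hq
    have hq' : 0 ≤ q.re := hq
    refine DifferentiableAt.differentiableWithinAt ?_
    refine (hd q hq').mul ?_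
    have := (differentiableAt_id.add_const (1 : ℂ)).clog (hslit q hq')
    exact (((differentiableAt_id.add_const (1 : ℂ)).mul this).const_mul _).neg.cexp
  have hz := PhragmenLindelof.eq_zero_on_right_half_plane_of_superexponential_decay hgd
    ⟨1, by norm_num, 0, ?_⟩ ?_ ⟨K, fun x => hgb _ (by simp)⟩
  · have h0 : g q = 0 := hz hq
    exact (mul_eq_zero.1 h0).resolve_right (Complex.exp_ne_zero _)
  · simp only [zero_mul, Real.exp_zero]
    refine Asymptotics.IsBigO.of_bound K ?_
    filter_upwards [Filter.mem_inf_of_right (Filter.mem_principal_self _)] with z hz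
    simpa using hgb z (le_of_lt hz)
  · intro n
    have hev : ∀ᶠ x : ℝ in Filter.atTop,
        Real.exp x ^ n * ‖g x‖ ≤ K * Real.exp (-x) := by
      have hlog : Filter.Tendsto (fun x : ℝ => μ * Real.log (x + 1)) Filter.atTop Filter.atTop :=
        (Real.tendsto_log_atTop.comp (Filter.tendsto_atTop_add_const_right _ _
          Filter.tendsto_id)).const_mul_atTop hμ0
      filter_upwards [hlog.eventually_ge_atTop ((n : ℝ) + 1), Filter.eventually_ge_atTop 0]
        with x hx hx0
      have h1 : ‖f x‖ ≤ K := by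
        refine (hf x (by simpa using hx0)).trans ?_
        refine mul_le_of_le_one_right hK (Real.exp_le_one_iff.2 ?_)
        exact neg_nonpos.2 (by positivity)
      have h2 : ‖Complex.exp (-(μ * (((x : ℂ) + 1) * Complex.log (x + 1))))‖ ≤
          Real.exp (-((n + 1) * (x + 1))) := by
        have e : (-(μ * (((x : ℂ) + 1) * Complex.log (x + 1)))) =
            ((-(μ * ((x + 1) * Real.log (x + 1))) : ℝ) : ℂ) := by
          push_cast
          rw [Complex.ofReal_log (by linarith)]; push_cast; ring
        rw [e, Complex.norm_exp, Complex.ofReal_re, Real.exp_le_exp]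
        nlinarith
      rw [hg, norm_mul, ← Real.exp_nat_mul]
      calc _ ≤ Real.exp (n * x) * (K * Real.exp (-((n + 1) * (x + 1)))) := by gcongr
        _ = K * Real.exp (n * x + -((n + 1) * (x + 1))) := by rw [Real.exp_add]; ring
        _ ≤ K * Real.exp (-x) := by
          gcongr
          have : (0 : ℝ) ≤ n := Nat.cast_nonneg n
          nlinarith
    have hlim : Filter.Tendsto (fun x : ℝ => K * Real.exp (-x)) Filter.atTop (𝓝 0) := by
      simpa using (Real.tendsto_exp_neg_atTop_nhds_zero).const_mul K
    exact squeeze_zero' (Filter.Eventually.of_forall fun x => by positivity) hev hlim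

/-- Watson's lemma. Bounds `n! M ^ n ‖h‖ ^ n` for every `n` mean decay `exp (-const / ‖h‖)`, and in
the variable `e^{iθ} / h` the Borel disc is a half-plane, where such decay forces zero. -/
theorem eq_zero_of_gevrey_flat {θ δ : ℝ} (hδ : 0 < δ) {f : ℂ → ℂ}
    (hf : DifferentiableOn ℂ f (borelDisc θ δ)) {C M : ℝ} (hC : 0 ≤ C) (hM : 0 < M)
    (H : ∀ n : ℕ, ∀ h ∈ borelDisc θ δ, ‖f h‖ ≤ C * M ^ n * (n ! : ℝ) * ‖h‖ ^ n)
    {h : ℂ} (hh : h ∈ borelDisc θ δ) : f h = 0 := by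
  set κ := Complex.exp (θ * Complex.I) with hκ
  have hκ0 : κ ≠ 0 := Complex.exp_ne_zero _
  have hκn : ‖κ‖ = 1 := Complex.norm_exp_ofReal_mul_I θ
  have h0 := ne_zero_of_mem_borelDisc hδ hh
  -- In the variable `q = κ / h - x₀` the given point lies on the line `Re q = 0`, and the whole
  -- closed half-plane `0 ≤ Re q` corresponds to points of the disc.
  set x₀ := (κ / h).re with hx₀
  have hx : 1 / δ < x₀ := hh
  have hx0 : 0 < x₀ := lt_trans (by positivity) hx
  have hmem : ∀ q : ℂ, 0 ≤ q.re → κ / (q + x₀) ∈ borelDisc θ δ := fun q hq => by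
    simp only [borelDisc, mem_ofPred_eq, ← hκ]
    rw [div_div_cancel₀ hκ0, Complex.add_re, Complex.ofReal_re]; linarith
  have hne : ∀ q : ℂ, 0 ≤ q.re → q + x₀ ≠ 0 := fun q hq h => by
    have := congrArg Complex.re h
    simp at this; linarith
  have hnorm : ∀ q : ℂ, 0 ≤ q.re → ‖q‖ ≤ ‖q + x₀‖ := fun q hq => by
    rw [← sq_le_sq₀ (norm_nonneg _) (norm_nonneg _), Complex.sq_norm, Complex.sq_norm,
      Complex.normSq_apply, Complex.normSq_apply]
    simp only [Complex.add_re, Complex.add_im, Complex.ofReal_re, Complex.ofReal_im, add_zero]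
    nlinarith
  have hl : 0 < Real.log 2 := Real.log_pos (by norm_num)
  have key : ∀ q : ℂ, 0 ≤ q.re → f (κ / (q + x₀)) = 0 := fun q hq =>
    eq_zero_of_exp_decay (f := fun q => f (κ / (q + x₀))) (c := Real.log 2 / (2 * M)) (K := 2 * C)
      (by positivity) (by positivity)
      (fun q hq => by
        have h1 := hf.differentiableAt ((isOpen_borelDisc hδ).mem_nhds (hmem q hq))
        exact h1.comp q ((differentiableAt_const κ).div (differentiableAt_id.add_const _)
          (hne q hq)))
      (fun q hq => by
        have hp : 0 < ‖q + x₀‖ := norm_pos_iff.2 (hne q hq)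
        have hn : ‖κ / (q + x₀)‖ = ‖q + x₀‖⁻¹ := by rw [norm_div, hκn, one_div]
        refine (le_exp_of_forall_le_factorial (x := ‖q + x₀‖⁻¹) (by positivity) hC hM
          fun n => by rw [← hn]; exact H n _ (hmem q hq)).trans ?_
        rw [inv_inv]
        gcongr
        exact hnorm q hq) hq
  have := key (κ / h - x₀) (by simp [← hx₀])
  rwa [sub_add_cancel, div_div_cancel₀ hκ0] at this

/-! ### Separately holomorphic functions -/

section Osgood

variable {E : Type*} [NormedAddCommGroup E] [NormedSpace ℂ E] [CompleteSpace E]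

/-- Joint continuity makes `f · y` converge locally uniformly to `f · y₀`, and by Weierstrass the
derivatives converge as well. -/
lemma continuousAt_deriv_of_separately {Y : Type*} [TopologicalSpace Y] {U : Set ℂ} {V : Set Y}
    (hU : IsOpen U) (hV : IsOpen V) {f : ℂ → Y → E} (hc : ContinuousOn (Function.uncurry f) (U ×ˢ V))
    (h1 : ∀ y ∈ V, DifferentiableOn ℂ (fun x => f x y) U) {x₀ : ℂ} {y₀ : Y}
    (hx : x₀ ∈ U) (hy : y₀ ∈ V) :
    ContinuousAt (fun p : ℂ × Y => deriv (fun x => f x p.2) p.1) (x₀, y₀) := by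
  have hlu : TendstoLocallyUniformlyOn (fun y x => f x y) (fun x => f x y₀) (𝓝 y₀) U := by
    rw [Metric.tendstoLocallyUniformlyOn_iff]
    intro e he x hx
    have hca : ContinuousAt (Function.uncurry f) (x, y₀) :=
      hc.continuousAt ((hU.prod hV).mem_nhds ⟨hx, hy⟩)
    have := hca.eventually (Metric.ball_mem_nhds _ (half_pos he))
    rw [nhds_prod_eq, Filter.eventually_prod_iff] at this
    obtain ⟨p, hp, q, hq, hpq⟩ := this
    refine ⟨{x | p x}, nhdsWithin_le_nhds hp, hq.mono fun y hqy x' hx' => ?_⟩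
    have e1 := Metric.mem_ball.1 (hpq hx' hqy)
    have e2 := Metric.mem_ball.1 (hpq hx' hq.self_of_nhds)
    simp only [Function.uncurry] at e1 e2
    rw [dist_comm] at e1
    have := dist_triangle (f x' y₀) (f x y₀) (f x' y)
    linarith
  have hd := hlu.deriv (Filter.eventually_of_mem (hV.mem_nhds hy) h1) hU
  have hcont : ContinuousOn (deriv fun x => f x y₀) U :=
    ((h1 y₀ hy).deriv hU).continuousOn
  rw [Metric.tendstoLocallyUniformlyOn_iff] at hd
  rw [Metric.continuousAt_iff']
  intro e he
  obtain ⟨t, ht, ht'⟩ := hd (e / 2) (half_pos he) x₀ hx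
  rw [hU.nhdsWithin_eq hx] at ht
  have h2 := (hcont.continuousAt (hU.mem_nhds hx)).eventually
    (Metric.ball_mem_nhds _ (half_pos he))
  rw [nhds_prod_eq]
  filter_upwards [Filter.Eventually.prod_inl
    (Filter.Eventually.and (show ∀ᶠ x in 𝓝 x₀, x ∈ t from ht) h2) _, Filter.Eventually.prod_inr ht' _]
    with p hp hp'
  have e1 := hp' p.1 hp.1
  have e2 : dist _ _ < e / 2 := hp.2
  simp only [Function.comp_apply] at e1
  rw [dist_comm] at e1
  have := dist_triangle (deriv (fun x => f x p.2) p.1) (deriv (fun x => f x y₀) p.1)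
    (deriv (fun x => f x y₀) x₀)
  linarith

/-- Osgood's lemma: both partial derivatives are jointly continuous, so the function is strictly
differentiable. It gives joint holomorphy of Laplace integrals and of limits of Picard iterates. -/
theorem differentiableOn_of_separately {U V : Set ℂ} (hU : IsOpen U) (hV : IsOpen V)
    {f : ℂ → ℂ → E} (hc : ContinuousOn (Function.uncurry f) (U ×ˢ V))
    (h1 : ∀ y ∈ V, DifferentiableOn ℂ (fun x => f x y) U)
    (h2 : ∀ x ∈ U, DifferentiableOn ℂ (fun y => f x y) V) :
    DifferentiableOn ℂ (Function.uncurry f) (U ×ˢ V) := by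
  rintro ⟨x₀, y₀⟩ ⟨hx, hy⟩
  refine DifferentiableAt.differentiableWithinAt ?_
  have hmem : U ×ˢ V ∈ 𝓝 (x₀, y₀) := (hU.prod hV).mem_nhds ⟨hx, hy⟩
  have c1 := continuousAt_deriv_of_separately hU hV hc h1 hx hy
  have hc' : ContinuousOn (Function.uncurry fun y x => f x y) (V ×ˢ U) :=
    hc.comp continuous_swap.continuousOn fun p hp => ⟨hp.2, hp.1⟩
  have c2 := (continuousAt_deriv_of_separately hV hU hc' h2 hy hx).comp_of_eq
    (continuous_swap.continuousAt (x := (x₀, y₀))) rfl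
  have key := hasStrictFDerivAt_uncurry_coprod (𝕜 := ℂ) (u := (x₀, y₀)) (f := f)
    (f₁ := fun x y => ContinuousLinearMap.toSpanSingleton ℂ (deriv (fun x => f x y) x))
    (f₂ := fun x y => ContinuousLinearMap.toSpanSingleton ℂ (deriv (fun y => f x y) y))
    (Filter.eventually_of_mem hmem fun p hp =>
      ((h1 p.2 hp.2).differentiableAt (hU.mem_nhds hp.1)).hasDerivAt.hasFDerivAt)
    (Filter.eventually_of_mem hmem fun p hp =>
      ((h2 p.1 hp.1).differentiableAt (hV.mem_nhds hp.2)).hasDerivAt.hasFDerivAt)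
    ((ContinuousLinearMap.toSpanSingletonCLE (𝕜 := ℂ) (E := E)).continuous.continuousAt.comp c1)
    ((ContinuousLinearMap.toSpanSingletonCLE (𝕜 := ℂ) (E := E)).continuous.continuousAt.comp c2)
  exact key.hasFDerivAt.differentiableAt

end Osgood

/-! ### Remainders of asymptotic expansions -/

section Remainder

variable {E : Type*} [NormedAddCommGroup E] [NormedSpace ℂ E]

/-- The order-`n` remainder of a value `y` with respect to the formal series `∑ F k h ^ k`. -/
def rem (F : ℕ → E) (h : ℂ) (n : ℕ) (y : E) : E := y - ∑ k ∈ Finset.range n, h ^ k • F k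

@[simp] lemma rem_zero (F : ℕ → E) (h : ℂ) (y : E) : rem F h 0 y = y := by simp [rem]

lemma rem_succ (F : ℕ → E) (h : ℂ) (n : ℕ) (y : E) :
    rem F h (n + 1) y = rem F h n y - h ^ n • F n := by
  rw [rem, rem, Finset.sum_range_succ]; abel

lemma rem_add (F G : ℕ → E) (h : ℂ) (n : ℕ) (x y : E) :
    rem (F + G) h n (x + y) = rem F h n x + rem G h n y := by
  simp only [rem, Pi.add_apply, smul_add, Finset.sum_add_distrib]; abel

lemma rem_map {E' : Type*} [NormedAddCommGroup E'] [NormedSpace ℂ E'] (L : E →L[ℂ] E')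
    (F : ℕ → E) (h : ℂ) (n : ℕ) (y : E) :
    rem (fun k => L (F k)) h n (L y) = L (rem F h n y) := by
  simp [rem, map_sub, map_sum]

/-- `y(h)` for `h ∈ D` has the Gevrey expansion `∑ F k h ^ k` with constants `C`, `M`. -/
def GevreyAt (D : Set ℂ) (C M : ℝ) (y : ℂ → E) (F : ℕ → E) : Prop :=
  ∀ n : ℕ, ∀ h ∈ D, ‖rem F h n (y h)‖ ≤ C * M ^ n * (n ! : ℝ) * ‖h‖ ^ n

lemma GevreyAt.mono {D D' : Set ℂ} {C C' M M' : ℝ} {y : ℂ → E} {F : ℕ → E}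
    (H : GevreyAt D C M y F) (hD : D' ⊆ D) (hC : C ≤ C') (hC0 : 0 ≤ C') (hM0 : 0 ≤ M)
    (hM : M ≤ M') : GevreyAt D' C' M' y F := fun n h hh =>
  (H n h (hD hh)).trans (by gcongr)

/-- `h ^ n • F n` is the difference of two consecutive remainders. Dividing by `‖h‖ ^ n` and letting
`h → 0` in the disc leaves the bound of order `n` alone. -/
lemma GevreyAt.norm_coeff_le {θ δ C M : ℝ} (hδ : 0 < δ) (hC : 0 ≤ C) (hM : 0 ≤ M) {y : ℂ → E}
    {F : ℕ → E} (H : GevreyAt (borelDisc θ δ) C M y F) (n : ℕ) :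
    ‖F n‖ ≤ C * M ^ n * (n ! : ℝ) := by
  refine le_of_forall_pos_le_add fun e he => ?_
  set L : ℝ := C * M ^ (n + 1) * ((n + 1)! : ℝ) with hL
  have hL0 : 0 ≤ L := by positivity
  obtain ⟨h, hh, hsmall⟩ := exists_mem_borelDisc_norm_lt θ hδ (η := e / (L + 1)) (by positivity)
  have h0 : 0 < ‖h‖ := norm_pos_iff.2 (ne_zero_of_mem_borelDisc hδ hh)
  have e1 : h ^ n • F n = rem F h n (y h) - rem F h (n + 1) (y h) := by rw [rem_succ]; abel
  have e2 : ‖h‖ ^ n * ‖F n‖ ≤ ‖h‖ ^ n * (C * M ^ n * (n ! : ℝ) + L * ‖h‖) := by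
    rw [← norm_pow, ← norm_smul, e1]
    refine (norm_sub_le _ _).trans ((add_le_add (H n h hh) (H (n + 1) h hh)).trans (le_of_eq ?_))
    rw [hL, norm_pow]; ring
  have e3 := le_of_mul_le_mul_left e2 (by positivity)
  have e4 : L * ‖h‖ ≤ e := by
    rw [lt_div_iff₀ (by positivity)] at hsmall
    nlinarith
  linarith

end Remainder

/-! ### Cauchy products and their Gevrey estimates -/

section Product

variable {𝔸 : Type*} [NormedRing 𝔸]

/-- Coefficients of the Cauchy product of two formal power series. -/
def conv (F G : ℕ → 𝔸) (n : ℕ) : 𝔸 := ∑ k ∈ Finset.range (n + 1), F (n - k) * G k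

/-- The identity is asymmetric on purpose: the remainder of `y` occurs only at order `n` with the
exact factor `x` in front, so for invertible `x` it can be solved for. Quotients are treated in this
way. -/
lemma rem_mul [NormedAlgebra ℂ 𝔸] (F G : ℕ → 𝔸) (h : ℂ) (n : ℕ) (x y : 𝔸) :
    rem (conv F G) h n (x * y) =
      x * rem G h n y + ∑ k ∈ Finset.range n, rem F h (n - k) x * (h ^ k • G k) := by
  induction n with
  | zero => simp
  | succ n ih =>
    rw [rem_succ, ih, rem_succ, Finset.sum_range_succ]
    have e1 : ∑ k ∈ Finset.range n, rem F h (n + 1 - k) x * (h ^ k • G k) =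
        ∑ k ∈ Finset.range n, rem F h (n - k) x * (h ^ k • G k) -
          ∑ k ∈ Finset.range n, h ^ n • (F (n - k) * G k) := by
      rw [← Finset.sum_sub_distrib]
      refine Finset.sum_congr rfl fun k hk => ?_
      have hk' := Finset.mem_range.1 hk
      rw [Nat.sub_add_comm hk'.le, rem_succ, sub_mul, smul_mul_smul_comm, ← pow_add,
        Nat.sub_add_cancel hk'.le]
    rw [e1, conv, Finset.sum_range_succ, smul_add, Finset.smul_sum, Nat.add_sub_cancel_left,
      rem_succ, rem_zero, Nat.sub_self]
    simp only [pow_zero, one_smul, mul_sub, sub_mul, mul_smul_comm, smul_sub]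
    abel

lemma factorial_mul_factorial_succ_le (k m : ℕ) : (k + 1)! * (m + 1)! ≤ (k + m + 1)! := by
  induction k with
  | zero => simp
  | succ k ih =>
    calc (k + 1 + 1)! * (m + 1)! = (k + 2) * ((k + 1)! * (m + 1)!) := by
          rw [Nat.factorial_succ (k + 1)]; ring
      _ ≤ (k + m + 2) * (k + m + 1)! := by gcongr; omega
      _ = (k + 1 + m + 1)! := by rw [show k + 1 + m + 1 = (k + m + 1) + 1 by ring,
          Nat.factorial_succ (k + m + 1)]

/-- The two extreme terms equal `n!`, and each of the `n - 1` interior ones is at most `(n - 1)!`.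
Hence Gevrey bounds are stable under products at the cost of a factor `3`, with the same `M`. -/
lemma sum_factorial_mul_factorial_le (n : ℕ) :
    ∑ k ∈ Finset.range (n + 1), (n - k)! * k ! ≤ 3 * n ! := by
  rcases n with _ | n
  · simp
  · rw [Finset.sum_range_succ, Finset.sum_range_succ']
    have h1 : ∑ k ∈ Finset.range n, (n + 1 - (k + 1))! * (k + 1)! ≤ ∑ k ∈ Finset.range n, n ! := by
      refine Finset.sum_le_sum fun k hk => ?_
      have hk' := Finset.mem_range.1 hk
      have := factorial_mul_factorial_succ_le (n - 1 - k) k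
      rwa [show n - 1 - k + 1 = n + 1 - (k + 1) by omega, show n - 1 - k + k + 1 = n by omega]
        at this
    have h2 : ∑ k ∈ Finset.range n, n ! ≤ (n + 1)! := by
      rw [Finset.sum_const, Finset.card_range, smul_eq_mul, Nat.factorial_succ]
      gcongr; omega
    simp only [Nat.sub_zero, Nat.factorial_zero, mul_one, Nat.sub_self, one_mul]
    omega

lemma sum_gevrey_le {a b M : ℝ} (ha : 0 ≤ a) (hb : 0 ≤ b) (hM : 0 ≤ M) (n : ℕ) :
    ∑ k ∈ Finset.range (n + 1), (a * M ^ (n - k) * ((n - k)! : ℝ)) * (b * M ^ k * (k ! : ℝ)) ≤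
      3 * a * b * M ^ n * (n ! : ℝ) := by
  have h := sum_factorial_mul_factorial_le n
  have h' : ∑ k ∈ Finset.range (n + 1), (((n - k)! : ℝ) * (k ! : ℝ)) ≤ 3 * (n ! : ℝ) := by
    exact_mod_cast h
  calc _ = (a * b * M ^ n) * ∑ k ∈ Finset.range (n + 1), (((n - k)! : ℝ) * (k ! : ℝ)) := by
        rw [Finset.mul_sum]
        refine Finset.sum_congr rfl fun k hk => ?_
        have hk' := Nat.lt_succ_iff.1 (Finset.mem_range.1 hk)
        rw [← Nat.sub_add_cancel hk', pow_add, Nat.add_sub_cancel]; ring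
    _ ≤ (a * b * M ^ n) * (3 * (n ! : ℝ)) := by gcongr
    _ = _ := by ring

lemma norm_conv_le {F G : ℕ → 𝔸} {a b M : ℝ} (hM : 0 ≤ M) {n : ℕ}
    (hF : ∀ j ≤ n, ‖F j‖ ≤ a * M ^ j * (j ! : ℝ)) (hG : ∀ j ≤ n, ‖G j‖ ≤ b * M ^ j * (j ! : ℝ)) :
    ‖conv F G n‖ ≤ 3 * a * b * M ^ n * (n ! : ℝ) := by
  have ha : 0 ≤ a := by simpa using (norm_nonneg _).trans (hF 0 (Nat.zero_le _))
  have hb : 0 ≤ b := by simpa using (norm_nonneg _).trans (hG 0 (Nat.zero_le _))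
  refine le_trans ((norm_sum_le _ _).trans (Finset.sum_le_sum fun k hk => ?_))
    (sum_gevrey_le ha hb hM n)
  have hk' := Nat.lt_succ_iff.1 (Finset.mem_range.1 hk)
  exact (norm_mul_le _ _).trans (mul_le_mul (hF _ (Nat.sub_le _ _)) (hG k hk') (norm_nonneg _)
    ((norm_nonneg _).trans (hF _ (Nat.sub_le _ _))))

lemma norm_sum_rem_mul_le [NormedAlgebra ℂ 𝔸] {F G : ℕ → 𝔸} {A b M : ℝ} (hM : 0 ≤ M) {h : ℂ} {n : ℕ} {x : 𝔸}
    (hF : ∀ j ≤ n, ‖rem F h j x‖ ≤ A * M ^ j * (j ! : ℝ) * ‖h‖ ^ j)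
    (hG : ∀ j ≤ n, ‖G j‖ ≤ b * M ^ j * (j ! : ℝ)) :
    ‖∑ k ∈ Finset.range n, rem F h (n - k) x * (h ^ k • G k)‖ ≤
      3 * A * b * M ^ n * (n ! : ℝ) * ‖h‖ ^ n := by
  have hA : 0 ≤ A := by simpa using (norm_nonneg _).trans (hF 0 (Nat.zero_le _))
  have hb : 0 ≤ b := by simpa using (norm_nonneg _).trans (hG 0 (Nat.zero_le _))
  calc _ ≤ ∑ k ∈ Finset.range n, ‖rem F h (n - k) x * (h ^ k • G k)‖ := norm_sum_le _ _
    _ ≤ ∑ k ∈ Finset.range n, ((A * M ^ (n - k) * ((n - k)! : ℝ)) * (b * M ^ k * (k ! : ℝ))) *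
        ‖h‖ ^ n := by
      refine Finset.sum_le_sum fun k hk => ?_
      have hk' := (Finset.mem_range.1 hk).le
      calc _ ≤ ‖rem F h (n - k) x‖ * (‖h‖ ^ k * ‖G k‖) := by
            refine (norm_mul_le _ _).trans (le_of_eq ?_); rw [norm_smul, norm_pow]
        _ ≤ (A * M ^ (n - k) * ((n - k)! : ℝ) * ‖h‖ ^ (n - k)) *
            (‖h‖ ^ k * (b * M ^ k * (k ! : ℝ))) := by
          gcongr
          · exact hF _ (Nat.sub_le _ _)
          · exact hG k hk'
        _ = _ := by
          have : ‖h‖ ^ n = ‖h‖ ^ (n - k) * ‖h‖ ^ k := by rw [← pow_add, Nat.sub_add_cancel hk']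
          rw [this]; ring
    _ ≤ ∑ k ∈ Finset.range (n + 1), ((A * M ^ (n - k) * ((n - k)! : ℝ)) *
        (b * M ^ k * (k ! : ℝ))) * ‖h‖ ^ n := by
      refine Finset.sum_le_sum_of_subset_of_nonneg (Finset.range_mono (Nat.le_succ n))
        fun k _ _ => by positivity
    _ ≤ _ := by
      rw [← Finset.sum_mul]
      exact mul_le_mul_of_nonneg_right (sum_gevrey_le hA hb hM n) (by positivity)

lemma norm_rem_mul_le [NormedAlgebra ℂ 𝔸] {F G : ℕ → 𝔸} {a A B b M : ℝ} (hM : 0 ≤ M) {h : ℂ} {n : ℕ} {x y : 𝔸}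
    (hx : ‖x‖ ≤ a) (hF : ∀ j ≤ n, ‖rem F h j x‖ ≤ A * M ^ j * (j ! : ℝ) * ‖h‖ ^ j)
    (hy : ‖rem G h n y‖ ≤ B * M ^ n * (n ! : ℝ) * ‖h‖ ^ n)
    (hG : ∀ j ≤ n, ‖G j‖ ≤ b * M ^ j * (j ! : ℝ)) :
    ‖rem (conv F G) h n (x * y)‖ ≤ (a * B + 3 * A * b) * M ^ n * (n ! : ℝ) * ‖h‖ ^ n := by
  rw [rem_mul]
  refine (norm_add_le _ _).trans ((add_le_add ((norm_mul_le _ _).trans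
    (mul_le_mul hx hy (norm_nonneg _) ((norm_nonneg _).trans hx)))
    (norm_sum_rem_mul_le hM hF hG)).trans (le_of_eq ?_))
  ring

end Product

/-! ### The integral operator along the halfstrip -/

section Integral

open MeasureTheory

variable {E : Type*} [NormedAddCommGroup E] [NormedSpace ℂ E]

lemma norm_deriv_le_of_forall_mem {U : Set ℂ} {f : ℂ → E} (hf : DifferentiableOn ℂ f U)
    {C ρ : ℝ} (hρ : 0 < ρ) {z : ℂ} (hz : Metric.closedBall z ρ ⊆ U) (hC : ∀ w ∈ U, ‖f w‖ ≤ C) :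
    ‖deriv f z‖ ≤ C / ρ :=
  Complex.norm_deriv_le_of_forall_mem_sphere_norm_le hρ
    ((hf.mono (Metric.closure_ball_subset_closedBall.trans hz)).diffContOnCl)
    fun w hw => hC w (hz (Metric.sphere_subset_closedBall hw))

/-- The integral operator `g ↦ ∫ exp (-t e^{iθ} / h) g (z + t ε e^{iθ}, h) e^{iθ} dt`, which inverts
`h⁻¹ - ε ∂_z`. -/
noncomputable def lapl (θ : ℝ) (ε : ℤˣ) (g : ℂ → ℂ → E) (z h : ℂ) : E :=
  ∫ t in Ioi (0 : ℝ), (Complex.exp (-(t * (Complex.exp (θ * Complex.I) / h))) *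
    Complex.exp (θ * Complex.I)) • g (z + t * dir θ ε) h

lemma norm_kernel_le {θ δ : ℝ} {h : ℂ} (hh : h ∈ borelDisc θ δ) {t : ℝ} (ht : 0 ≤ t) :
    ‖Complex.exp (-(t * (Complex.exp (θ * Complex.I) / h))) *
      Complex.exp (θ * Complex.I)‖ ≤ Real.exp (-(1 / δ) * t) := by
  rw [norm_mul, Complex.norm_exp_ofReal_mul_I, mul_one, Complex.norm_exp, Real.exp_le_exp,
    Complex.neg_re, Complex.re_ofReal_mul]
  have : 1 / δ < (Complex.exp (θ * Complex.I) / h).re := hh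
  nlinarith

lemma integral_exp_neg_inv_mul {δ : ℝ} (hδ : 0 < δ) :
    ∫ t in Ioi (0 : ℝ), Real.exp (-(1 / δ) * t) = δ := by
  rw [integral_exp_mul_Ioi (neg_neg_of_pos (by positivity))]; simp

variable {θ : ℝ} {ε : ℤˣ} {r δ : ℝ} {g : ℂ → ℂ → E} {G : ℝ}

lemma norm_lapl_integrand_le (hG : ∀ z ∈ halfstrip θ ε r, ∀ h ∈ borelDisc θ δ, ‖g z h‖ ≤ G)
    {z h : ℂ} (hz : z ∈ halfstrip θ ε r) (hh : h ∈ borelDisc θ δ) {t : ℝ} (ht : t ∈ Ioi (0 : ℝ)) :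
    ‖(Complex.exp (-(t * (Complex.exp (θ * Complex.I) / h))) *
      Complex.exp (θ * Complex.I)) • g (z + t * dir θ ε) h‖ ≤ G * Real.exp (-(1 / δ) * t) := by
  have h1 := hG _ (add_dir_mem_halfstrip hz (le_of_lt ht)) h hh
  rw [norm_smul, mul_comm]
  exact mul_le_mul h1 (norm_kernel_le hh (le_of_lt ht)) (norm_nonneg _)
    ((norm_nonneg _).trans h1)

lemma integrableOn_lapl_bound (hδ : 0 < δ) (G : ℝ) :
    IntegrableOn (fun t : ℝ => G * Real.exp (-(1 / δ) * t)) (Ioi 0) :=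
  (integrableOn_exp_mul_Ioi (neg_neg_of_pos (by positivity)) 0).const_mul G

lemma norm_lapl_le (hδ : 0 < δ)
    (hG : ∀ z ∈ halfstrip θ ε r, ∀ h ∈ borelDisc θ δ, ‖g z h‖ ≤ G)
    {z h : ℂ} (hz : z ∈ halfstrip θ ε r) (hh : h ∈ borelDisc θ δ) :
    ‖lapl θ ε g z h‖ ≤ δ * G := by
  refine (norm_integral_le_of_norm_le (integrableOn_lapl_bound hδ G)
    ((ae_restrict_iff' measurableSet_Ioi).2 (Filter.Eventually.of_forall fun t ht =>
      norm_lapl_integrand_le hG hz hh ht))).trans ?_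
  rw [integral_const_mul, integral_exp_neg_inv_mul hδ, mul_comm]

lemma continuousOn_lapl_integrand (hδ : 0 < δ)
    (hg : DifferentiableOn ℂ (Function.uncurry g) (halfstrip θ ε r ×ˢ borelDisc θ δ)) :
    ContinuousOn (fun p : (ℂ × ℂ) × ℝ =>
      (Complex.exp (-(p.2 * (Complex.exp (θ * Complex.I) / p.1.2))) *
        Complex.exp (θ * Complex.I)) • g (p.1.1 + p.2 * dir θ ε) p.1.2)
      ((halfstrip θ ε r ×ˢ borelDisc θ δ) ×ˢ Ioi 0) := by
  refine ContinuousOn.smul ?_ ?_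
  · refine ContinuousOn.mul (ContinuousOn.cexp (ContinuousOn.neg (ContinuousOn.mul (by fun_prop)
      (ContinuousOn.div (by fun_prop) (by fun_prop) ?_)))) (by fun_prop)
    exact fun p hp => ne_zero_of_mem_borelDisc hδ hp.1.2
  · exact hg.continuousOn.comp
      (f := fun p : (ℂ × ℂ) × ℝ => (p.1.1 + p.2 * dir θ ε, p.1.2)) (by fun_prop)
      fun p hp => ⟨add_dir_mem_halfstrip hp.1.1 (le_of_lt hp.2), hp.1.2⟩

/-- A bounded solution of `ε h e' = e - h g` is bounded in terms of `g`. -/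
lemma norm_le_of_bounded_solution {e g : ℂ → E} {h : ℂ} (hδ : 0 < δ) (hh : h ∈ borelDisc θ δ)
    (he : DifferentiableOn ℂ e (halfstrip θ ε r))
    (hode : ∀ z ∈ halfstrip θ ε r, (((ε : ℤ) : ℂ) * h) • deriv e z = e z - h • g z)
    {B : ℝ} (hB : ∀ z ∈ halfstrip θ ε r, ‖e z‖ ≤ B) (hG : ∀ z ∈ halfstrip θ ε r, ‖g z‖ ≤ G)
    {z : ℂ} (hz : z ∈ halfstrip θ ε r) : ‖e z‖ ≤ δ * G := by
  set κ := Complex.exp (θ * Complex.I) with hκ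
  have h0 := ne_zero_of_mem_borelDisc hδ hh
  have hκn : ‖κ‖ = 1 := Complex.norm_exp_ofReal_mul_I θ
  have hG0 : 0 ≤ G := (norm_nonneg _).trans (hG z hz)
  have hB0 : 0 ≤ B := (norm_nonneg _).trans (hB z hz)
  set w : ℝ → ℂ := fun t => Complex.exp (-(t * (κ / h))) with hw
  have hwn : ∀ t : ℝ, 0 ≤ t → ‖w t‖ ≤ Real.exp (-(1 / δ) * t) := fun t ht => by
    have := norm_kernel_le (δ := δ) hh ht
    rwa [norm_mul, ← hκ, hκn, mul_one] at this
  -- Variation of constants: the equation cancels `e` from the derivative of `ψ`, leaving the kernel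
  -- times `-g`. Since `e` is bounded, `ψ` vanishes at infinity and `e z = ψ 0` is bounded by the
  -- total variation, at most `δ G`.
  set ψ : ℝ → E := fun t => w t • e (z + t * dir θ ε) with hψ
  have hd : ∀ t : ℝ, 0 ≤ t → HasDerivAt ψ (-((w t * κ) • g (z + t * dir θ ε))) t := fun t ht => by
    have hzt := add_dir_mem_halfstrip hz ht
    have d1 : HasDerivAt (fun t : ℝ => z + t * dir θ ε) (dir θ ε) t := by
      simpa using ((Complex.ofRealCLM.hasDerivAt (x := t)).mul_const (dir θ ε)).const_add z
    have d2 : HasDerivAt (fun t : ℝ => e (z + t * dir θ ε))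
        (dir θ ε • deriv e (z + t * dir θ ε)) t :=
      ((he.differentiableAt ((isOpen_halfstrip θ ε r).mem_nhds hzt)).hasDerivAt).scomp t d1
    have d3 : HasDerivAt w (w t * (-(κ / h))) t := by
      have : HasDerivAt (fun t : ℝ => -((t : ℂ) * (κ / h))) (-(κ / h)) t := by
        simpa using ((Complex.ofRealCLM.hasDerivAt (x := t)).mul_const (κ / h)).fun_neg
      exact this.cexp
    refine (d3.smul d2).congr_deriv ?_
    have e1 : dir θ ε • deriv e (z + t * dir θ ε) =
        (κ / h) • ((((ε : ℤ) : ℂ) * h) • deriv e (z + t * dir θ ε)) := by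
      rw [smul_smul, dir, ← hκ]; congr 1; field_simp
    rw [e1, hode _ hzt, smul_sub, smul_sub, smul_smul, smul_smul, smul_smul, mul_assoc (w t),
      div_mul_cancel₀ κ h0, mul_neg, neg_smul]
    abel
  have hdiff : ∀ L : ℝ, 0 ≤ L → ‖ψ L - ψ 0‖ ≤ δ * G := fun L hL => by
    have := image_norm_le_of_norm_deriv_right_le_deriv_boundary (a := 0) (b := L)
      (f := fun t => ψ t - ψ 0) (f' := fun t => -((w t * κ) • g (z + t * dir θ ε)))
      (B := fun t => δ * G * (1 - Real.exp (-(1 / δ) * t)))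
      (B' := fun t => G * Real.exp (-(1 / δ) * t))
      (fun t ht => ((hd t ht.1).sub_const _).continuousAt.continuousWithinAt)
      (fun t ht => ((hd t ht.1).sub_const _).hasDerivWithinAt) (by simp)
      (fun t => by
        have d1 : HasDerivAt (fun t : ℝ => -(1 / δ) * t) (-(1 / δ)) t := by
          simpa using (hasDerivAt_id t).const_mul (-(1 / δ))
        refine ((d1.exp.const_sub 1).const_mul (δ * G)).congr_deriv ?_
        field_simp)
      (fun t ht => by
        rw [norm_neg, norm_smul, norm_mul, hκn, mul_one, mul_comm]
        exact mul_le_mul (hG _ (add_dir_mem_halfstrip hz ht.1)) (hwn t ht.1) (norm_nonneg _) hG0)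
      (right_mem_Icc.2 hL)
    refine this.trans (mul_le_of_le_one_right (by positivity) ?_)
    have := Real.exp_pos (-(1 / δ) * L)
    linarith
  have hlim : Filter.Tendsto (fun L : ℝ => δ * G + Real.exp (-(1 / δ) * L) * B) Filter.atTop
      (𝓝 (δ * G + 0 * B)) :=
    ((Real.tendsto_exp_atBot.comp (Filter.tendsto_id.const_mul_atTop_of_neg
      (neg_neg_of_pos (by positivity)))).mul_const B).const_add _
  rw [zero_mul, add_zero] at hlim
  refine ge_of_tendsto hlim ?_
  filter_upwards [Filter.eventually_ge_atTop 0] with L hL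
  have e0 : ψ 0 = e z := by simp [hψ, hw]
  have e1 : ‖ψ L‖ ≤ Real.exp (-(1 / δ) * L) * B := by
    rw [hψ, norm_smul]
    exact mul_le_mul (hwn L hL) (hB _ (add_dir_mem_halfstrip hz hL)) (norm_nonneg _)
      (Real.exp_pos _).le
  rw [← e0]
  have := norm_sub_norm_le (ψ 0) (ψ L)
  rw [norm_sub_rev] at this
  linarith [hdiff L hL]

variable [CompleteSpace E]

/-- Domination of the integrand suffices for holomorphic dependence: Cauchy's inequality on discs of
radius `ρ / 3` turns `b` into a dominating function for the derivative. -/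
lemma hasDerivAt_integral_Ioi {U : Set ℂ} (hU : IsOpen U) {F : ℂ → ℝ → E} {b : ℝ → ℝ}
    (hc : ContinuousOn (Function.uncurry F) (U ×ˢ Ioi 0))
    (hd : ∀ t ∈ Ioi (0 : ℝ), DifferentiableOn ℂ (fun x => F x t) U)
    (hb : ∀ x ∈ U, ∀ t ∈ Ioi (0 : ℝ), ‖F x t‖ ≤ b t) (hbi : IntegrableOn b (Ioi 0))
    {x : ℂ} (hx : x ∈ U) :
    IntegrableOn (fun t => deriv (fun x => F x t) x) (Ioi 0) ∧
      HasDerivAt (fun x => ∫ t in Ioi 0, F x t) (∫ t in Ioi 0, deriv (fun x => F x t) x) x := by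
  obtain ⟨ρ, hρ, hball⟩ := Metric.isOpen_iff.1 hU x hx
  have hmeas : ∀ x ∈ U, AEStronglyMeasurable (F x) (volume.restrict (Ioi 0)) := fun x hx =>
    ContinuousOn.aestronglyMeasurable
      (hc.comp (by fun_prop : ContinuousOn (fun t : ℝ => (x, t)) (Ioi 0)) fun t ht => ⟨hx, ht⟩)
      measurableSet_Ioi
  have hae : ∀ {p : ℝ → Prop}, (∀ t ∈ Ioi (0 : ℝ), p t) → ∀ᵐ t ∂(volume.restrict (Ioi 0)), p t :=
    fun h => (ae_restrict_iff' measurableSet_Ioi).2 (Filter.Eventually.of_forall h)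
  refine hasDerivAt_integral_of_dominated_loc_of_deriv_le (bound := fun t => b t / (ρ / 3))
    (F' := fun x t => deriv (fun x => F x t) x)
    (Metric.ball_mem_nhds x (by positivity : 0 < ρ / 3))
    (Filter.eventually_of_mem (hU.mem_nhds hx) hmeas)
    (Integrable.mono' hbi (hmeas x hx) (hae fun t ht => hb x hx t ht)) ?_ ?_ (hbi.div_const _) ?_
  · refine ContinuousOn.aestronglyMeasurable (fun t ht => ?_) measurableSet_Ioi
    have := continuousAt_deriv_of_separately hU isOpen_Ioi hc hd hx ht
    exact (this.comp (f := fun t : ℝ => (x, t)) (by fun_prop)).continuousWithinAt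
  · refine hae fun t ht y hy => ?_
    refine norm_deriv_le_of_forall_mem (hd t ht) (by positivity) ?_ fun w hw => hb w hw t ht
    refine Subset.trans ?_ hball
    refine Metric.closedBall_subset_ball' ?_
    have := Metric.mem_ball.1 hy
    linarith
  · refine hae fun t ht y hy => ?_
    refine ((hd t ht).differentiableAt (hU.mem_nhds (hball ?_))).hasDerivAt
    exact Metric.ball_subset_ball (by linarith) hy

/-- Integration by parts along the ray: the `t`-derivative of `exp (-t e^{iθ} / h) g (z + t ε
e^{iθ}, h)` integrates to `-g (z, h)`, and it is a combination of the integrand and of its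
`z`-derivative. -/
lemma hasDerivAt_lapl (hδ : 0 < δ)
    (hg : DifferentiableOn ℂ (Function.uncurry g) (halfstrip θ ε r ×ˢ borelDisc θ δ))
    (hG : ∀ z ∈ halfstrip θ ε r, ∀ h ∈ borelDisc θ δ, ‖g z h‖ ≤ G)
    {z h : ℂ} (hz : z ∈ halfstrip θ ε r) (hh : h ∈ borelDisc θ δ) :
    HasDerivAt (fun z => lapl θ ε g z h)
      (((ε : ℤ) : ℂ) • (h⁻¹ • lapl θ ε g z h - g z h)) z := by
  set κ := Complex.exp (θ * Complex.I) with hκ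
  have h0 := ne_zero_of_mem_borelDisc hδ hh
  have hgh : DifferentiableOn ℂ (fun z => g z h) (halfstrip θ ε r) :=
    hg.comp (f := fun z => (z, h)) (by fun_prop) fun z hz => ⟨hz, hh⟩
  have hc := continuousOn_lapl_integrand hδ hg
  obtain ⟨hi, hd⟩ := hasDerivAt_integral_Ioi (isOpen_halfstrip θ ε r)
    (F := fun z t => (Complex.exp (-(t * (κ / h))) * κ) • g (z + t * dir θ ε) h)
    (b := fun t : ℝ => G * Real.exp (-(1 / δ) * t))
    (hc.comp (f := fun p : ℂ × ℝ => ((p.1, h), p.2)) (by fun_prop)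
      fun p hp => ⟨⟨hp.1, hh⟩, hp.2⟩)
    (fun t ht => (hgh.comp (f := fun z => z + t * dir θ ε) (by fun_prop)
      fun z hz => add_dir_mem_halfstrip hz (le_of_lt ht)).const_smul _)
    (fun z hz t ht => norm_lapl_integrand_le hG hz hh ht) (integrableOn_lapl_bound hδ G) hz
  refine (show HasDerivAt (fun z => lapl θ ε g z h) _ z from hd).congr_deriv ?_
  have hderiv : ∀ t : ℝ, 0 ≤ t →
      deriv (fun x => (Complex.exp (-(t * (κ / h))) * κ) • g (x + t * dir θ ε) h) z =
        (Complex.exp (-(t * (κ / h))) * κ) • deriv (fun z => g z h) (z + t * dir θ ε) :=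
      fun t ht => by
    have := (hgh.differentiableAt ((isOpen_halfstrip θ ε r).mem_nhds
      (add_dir_mem_halfstrip hz ht))).hasDerivAt
    exact ((this.comp_add_const z _).const_smul _).deriv
  set w : ℝ → ℂ := fun t => Complex.exp (-(t * (κ / h))) with hw
  have hI1 : IntegrableOn (fun t => (w t * κ) • g (z + t * dir θ ε) h) (Ioi 0) := by
    refine Integrable.mono' (integrableOn_lapl_bound hδ G) (ContinuousOn.aestronglyMeasurable
      (hc.comp (f := fun t : ℝ => ((z, h), t)) (by fun_prop) fun t ht => ⟨⟨hz, hh⟩, ht⟩)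
      measurableSet_Ioi) ?_
    exact (ae_restrict_iff' measurableSet_Ioi).2 (Filter.Eventually.of_forall fun t ht =>
      norm_lapl_integrand_le hG hz hh ht)
  have hI2 : IntegrableOn (fun t : ℝ => (w t * κ) • deriv (fun z => g z h) (z + t * dir θ ε))
      (Ioi 0) := hi.congr_fun (fun t ht => hderiv t (le_of_lt ht)) measurableSet_Ioi
  have hint : (∫ t in Ioi (0 : ℝ),
      deriv (fun x => (Complex.exp (-(t * (κ / h))) * κ) • g (x + t * dir θ ε) h) z) =
      ∫ t in Ioi (0 : ℝ), (w t * κ) • deriv (fun z => g z h) (z + t * dir θ ε) :=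
    setIntegral_congr_fun measurableSet_Ioi fun t ht => hderiv t (le_of_lt ht)
  rw [hint]
  have hI1' : IntegrableOn (fun t : ℝ => h⁻¹ • ((w t * κ) • g (z + t * dir θ ε) h)) (Ioi 0) :=
    Integrable.smul _ hI1
  have hI2' : IntegrableOn (fun t : ℝ => ((ε : ℤ) : ℂ) •
      ((w t * κ) • deriv (fun z => g z h) (z + t * dir θ ε))) (Ioi 0) := Integrable.smul _ hI2
  have hI3 : IntegrableOn (fun t : ℝ => ((ε : ℤ) : ℂ) •
      ((w t * κ) • deriv (fun z => g z h) (z + t * dir θ ε)) -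
      h⁻¹ • ((w t * κ) • g (z + t * dir θ ε) h)) (Ioi 0) := hI2'.sub hI1'
  have hftc : ∫ t in Ioi (0 : ℝ), (((ε : ℤ) : ℂ) •
      ((w t * κ) • deriv (fun z => g z h) (z + t * dir θ ε)) -
      h⁻¹ • ((w t * κ) • g (z + t * dir θ ε) h)) = 0 - (fun t : ℝ => w t • g (z + t * dir θ ε) h) 0 := by
    refine integral_Ioi_of_hasDerivAt_of_tendsto'
      (f := fun t : ℝ => w t • g (z + t * dir θ ε) h) (m := 0) (fun t ht => ?_)
      hI3 ?_
    · have d1 : HasDerivAt (fun t : ℝ => z + t * dir θ ε) (dir θ ε) t := by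
        simpa using ((Complex.ofRealCLM.hasDerivAt (x := t)).mul_const (dir θ ε)).const_add z
      have d2 : HasDerivAt (fun t : ℝ => g (z + t * dir θ ε) h)
          (dir θ ε • deriv (fun z => g z h) (z + t * dir θ ε)) t :=
        HasDerivAt.scomp (g₁ := fun z => g z h) t
          ((hgh.differentiableAt ((isOpen_halfstrip θ ε r).mem_nhds
            (add_dir_mem_halfstrip hz ht))).hasDerivAt) d1
      have d3 : HasDerivAt w (w t * (-(κ / h))) t := by
        have : HasDerivAt (fun t : ℝ => -((t : ℂ) * (κ / h))) (-(κ / h)) t := by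
          simpa using ((Complex.ofRealCLM.hasDerivAt (x := t)).mul_const (κ / h)).fun_neg
        exact this.cexp
      refine (d3.smul d2).congr_deriv ?_
      rw [dir, ← hκ]
      simp only [smul_smul, mul_neg, neg_smul, ← sub_eq_add_neg]
      congr 2 <;> ring
    · have hz' : Filter.Tendsto (fun t : ℝ => G * Real.exp (-(1 / δ) * t)) Filter.atTop (𝓝 0) := by
        have : Filter.Tendsto (fun t : ℝ => Real.exp (-(1 / δ) * t)) Filter.atTop (𝓝 0) :=
          Real.tendsto_exp_atBot.comp
            (Filter.tendsto_id.const_mul_atTop_of_neg (neg_neg_of_pos (by positivity)))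
        simpa using this.const_mul G
      refine squeeze_zero_norm' ?_ hz'
      filter_upwards [Filter.eventually_gt_atTop 0] with t ht
      have := norm_lapl_integrand_le hG hz hh (t := t) ht
      rwa [norm_smul, norm_mul, Complex.norm_exp_ofReal_mul_I, mul_one, ← norm_smul] at this
  rw [integral_sub hI2' hI1', integral_smul, integral_smul] at hftc
  have hg0 : (fun t : ℝ => w t • g (z + t * dir θ ε) h) 0 = g z h := by simp [hw]
  rw [hg0, zero_sub, sub_eq_iff_eq_add] at hftc
  have hl : lapl θ ε g z h = ∫ t in Ioi (0 : ℝ), (w t * κ) • g (z + t * dir θ ε) h := rfl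
  rw [hl, sub_eq_neg_add, ← hftc, smul_smul, units_cast_sq, one_smul]

lemma differentiableOn_lapl (hδ : 0 < δ)
    (hg : DifferentiableOn ℂ (Function.uncurry g) (halfstrip θ ε r ×ˢ borelDisc θ δ))
    (hG : ∀ z ∈ halfstrip θ ε r, ∀ h ∈ borelDisc θ δ, ‖g z h‖ ≤ G) :
    DifferentiableOn ℂ (Function.uncurry (lapl θ ε g)) (halfstrip θ ε r ×ˢ borelDisc θ δ) := by
  have hc := continuousOn_lapl_integrand hδ hg
  have hmeas : ∀ p ∈ halfstrip θ ε r ×ˢ borelDisc θ δ, AEStronglyMeasurable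
      (fun t : ℝ => (Complex.exp (-(t * (Complex.exp (θ * Complex.I) / p.2))) *
        Complex.exp (θ * Complex.I)) • g (p.1 + t * dir θ ε) p.2) (volume.restrict (Ioi 0)) :=
    fun p hp => ContinuousOn.aestronglyMeasurable
      (hc.comp (f := fun t : ℝ => (p, t)) (by fun_prop) fun t ht => ⟨hp, ht⟩) measurableSet_Ioi
  refine differentiableOn_of_separately (isOpen_halfstrip θ ε r) (isOpen_borelDisc hδ) ?_ ?_ ?_
  · refine continuousOn_of_dominated (bound := fun t : ℝ => G * Real.exp (-(1 / δ) * t)) hmeas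
      (fun p hp => (ae_restrict_iff' measurableSet_Ioi).2 (Filter.Eventually.of_forall
        fun t ht => norm_lapl_integrand_le hG hp.1 hp.2 ht)) (integrableOn_lapl_bound hδ G)
      ((ae_restrict_iff' measurableSet_Ioi).2 (Filter.Eventually.of_forall fun t ht =>
        hc.comp (f := fun p : ℂ × ℂ => (p, t)) (by fun_prop) fun p hp => ⟨hp, ht⟩))
  · exact fun h hh z hz => (hasDerivAt_lapl hδ hg hG hz hh).differentiableAt.differentiableWithinAt
  · intro z hz h hh
    refine (hasDerivAt_integral_Ioi (isOpen_borelDisc hδ)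
      (F := fun h t => (Complex.exp (-(t * (Complex.exp (θ * Complex.I) / h))) *
        Complex.exp (θ * Complex.I)) • g (z + t * dir θ ε) h)
      (b := fun t : ℝ => G * Real.exp (-(1 / δ) * t))
      (hc.comp (f := fun p : ℂ × ℝ => ((z, p.1), p.2)) (by fun_prop)
        fun p hp => ⟨⟨hz, hp.1⟩, hp.2⟩)
      (fun t ht => ?_) (fun h hh t ht => norm_lapl_integrand_le hG hz hh ht)
      (integrableOn_lapl_bound hδ G) hh).2.differentiableAt.differentiableWithinAt
    refine DifferentiableOn.smul ?_ ?_
    · refine DifferentiableOn.mul (DifferentiableOn.cexp (DifferentiableOn.neg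
        (DifferentiableOn.mul (by fun_prop) (DifferentiableOn.div (by fun_prop) (by fun_prop) ?_))))
        (by fun_prop)
      exact fun h hh => ne_zero_of_mem_borelDisc hδ hh
    · exact hg.comp (f := fun h => (z + t * dir θ ε, h)) (by fun_prop)
        fun h hh => ⟨add_dir_mem_halfstrip hz (le_of_lt ht), hh⟩

end Integral

/-! ### Sequences defined by strong recursion -/

/-- The sequence whose `n`-th term is computed from the truncation below `n`. -/
noncomputable def strongSeq {X : Type*} [Zero X] (step : ℕ → (ℕ → X) → X) : ℕ → X
  | n => step n fun j => if _h : j < n then strongSeq step j else 0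

lemma strongSeq_eq {X : Type*} [Zero X] (step : ℕ → (ℕ → X) → X) (n : ℕ) :
    strongSeq step n = step n fun j => if j < n then strongSeq step j else 0 := by
  conv_lhs => rw [strongSeq]
  simp only [dite_eq_ite]

/-! ### Functions with uniform Gevrey expansions -/

/-- `f` is holomorphic on `U × D` and has there a Gevrey expansion with holomorphic coefficients
and uniform constants. -/
structure GevreyFun {E : Type*} [NormedAddCommGroup E] [NormedSpace ℂ E] (U D : Set ℂ) (C M : ℝ)
    (f : ℂ → ℂ → E) (F : ℕ → ℂ → E) : Prop where
  hol : DifferentiableOn ℂ (Function.uncurry f) (U ×ˢ D)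
  coeff_hol : ∀ k, DifferentiableOn ℂ (F k) U
  bound : ∀ z ∈ U, GevreyAt D C M (f z) (fun k => F k z)

section GevreyFun

variable {E : Type*} [NormedAddCommGroup E] [NormedSpace ℂ E] {U D : Set ℂ} {C M : ℝ}
  {f : ℂ → ℂ → E} {F : ℕ → ℂ → E}

lemma GevreyFun.mono {U' D' : Set ℂ} {C' M' : ℝ} (H : GevreyFun U D C M f F) (hU : U' ⊆ U)
    (hD : D' ⊆ D) (hC : C ≤ C') (hC0 : 0 ≤ C') (hM0 : 0 ≤ M) (hM : M ≤ M') :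
    GevreyFun U' D' C' M' f F where
  hol := H.hol.mono (prod_mono hU hD)
  coeff_hol k := (H.coeff_hol k).mono hU
  bound z hz := (H.bound z (hU hz)).mono hD hC hC0 hM0 hM

lemma GevreyFun.norm_le (H : GevreyFun U D C M f F) {z h : ℂ} (hz : z ∈ U) (hh : h ∈ D) :
    ‖f z h‖ ≤ C := by
  simpa using H.bound z hz 0 h hh

end GevreyFun

/-! ### The formal solution of the matrix Riccati equation -/

section Formal

variable {𝔸 : Type*} [NormedRing 𝔸]

lemma conv_congr {F F' G G' : ℕ → 𝔸} {n : ℕ} (hF : ∀ j ≤ n, F j = F' j)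
    (hG : ∀ j ≤ n, G j = G' j) : conv F G n = conv F' G' n :=
  Finset.sum_congr rfl fun k hk => by
    rw [hF _ (Nat.sub_le _ _), hG _ (Nat.lt_succ_iff.1 (Finset.mem_range.1 hk))]

/-- The coefficients of `k₀ + k₁ N + N k₂ + N k₃ N`. -/
def quadCoeff (k₀ k₁ k₂ k₃ N : ℕ → 𝔸) (n : ℕ) : 𝔸 :=
  k₀ n + conv k₁ N n + conv N k₂ n + conv N (conv k₃ N) n

lemma quadCoeff_congr {k₀ k₁ k₂ k₃ N N' : ℕ → 𝔸} {n : ℕ} (hN : ∀ j ≤ n, N j = N' j) :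
    quadCoeff k₀ k₁ k₂ k₃ N n = quadCoeff k₀ k₁ k₂ k₃ N' n := by
  have h3 : ∀ j ≤ n, conv k₃ N j = conv k₃ N' j := fun j hj =>
    conv_congr (fun _ _ => rfl) fun i hi => hN i (hi.trans hj)
  rw [quadCoeff, quadCoeff, conv_congr (fun _ _ => rfl) hN, conv_congr hN (fun _ _ => rfl),
    conv_congr hN h3]

lemma norm_quadCoeff_le {k₀ k₁ k₂ k₃ N : ℕ → 𝔸} {C a M : ℝ} (hM : 0 ≤ M) {n : ℕ}
    (h₀ : ∀ j ≤ n, ‖k₀ j‖ ≤ C * M ^ j * (j ! : ℝ)) (h₁ : ∀ j ≤ n, ‖k₁ j‖ ≤ C * M ^ j * (j ! : ℝ))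
    (h₂ : ∀ j ≤ n, ‖k₂ j‖ ≤ C * M ^ j * (j ! : ℝ)) (h₃ : ∀ j ≤ n, ‖k₃ j‖ ≤ C * M ^ j * (j ! : ℝ))
    (hN : ∀ j ≤ n, ‖N j‖ ≤ a * M ^ j * (j ! : ℝ)) :
    ‖quadCoeff k₀ k₁ k₂ k₃ N n‖ ≤ C * (1 + 6 * a + 9 * a ^ 2) * M ^ n * (n ! : ℝ) := by
  have h3 : ∀ j ≤ n, ‖conv k₃ N j‖ ≤ 3 * C * a * M ^ j * (j ! : ℝ) := fun j hj =>
    norm_conv_le hM (fun i hi => h₃ i (hi.trans hj)) fun i hi => hN i (hi.trans hj)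
  have e1 := norm_conv_le hM h₁ hN
  have e2 := norm_conv_le hM hN h₂
  have e3 := norm_conv_le hM hN h3
  calc _ ≤ ‖k₀ n‖ + ‖conv k₁ N n‖ + ‖conv N k₂ n‖ + ‖conv N (conv k₃ N) n‖ := norm_add₄_le
    _ ≤ C * M ^ n * (n ! : ℝ) + 3 * C * a * M ^ n * (n ! : ℝ) + 3 * a * C * M ^ n * (n ! : ℝ) +
        3 * a * (3 * C * a) * M ^ n * (n ! : ℝ) := by gcongr; exact h₀ n le_rfl
    _ = _ := by ring

variable [NormedAlgebra ℂ 𝔸]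

/-- The Cauchy estimate in the form that preserves the weights `gap ^ (-n)`. -/
lemma norm_deriv_le_gap {E : Type*} [NormedAddCommGroup E] [NormedSpace ℂ E] {θ : ℝ} {ε : ℤˣ}
    {r A : ℝ} (hA : 0 ≤ A) {n : ℕ} {f : ℂ → E}
    (hf : DifferentiableOn ℂ f (halfstrip θ ε r))
    (hb : ∀ z ∈ halfstrip θ ε r, ‖f z‖ ≤ A / gap θ ε r z ^ n) {z : ℂ}
    (hz : z ∈ halfstrip θ ε r) :
    ‖deriv f z‖ ≤ 6 * A * (n + 1) / gap θ ε r z ^ (n + 1) := by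
  set d := gap θ ε r z with hd
  have hd0 : 0 < d := gap_pos hz
  have hn : (0 : ℝ) ≤ n := Nat.cast_nonneg n
  -- On this circle the gap is at least `d (n + 1) / (n + 2)`, so the weight changes by at most `((n
  -- + 2) / (n + 1)) ^ n ≤ e ≤ 3`, while `1 / ρ ≤ 2 (n + 1) / d`. Together these give the factor `6
  -- (n + 1)`.
  set ρ := d / (n + 2) with hρ
  have hρ0 : 0 < ρ := by positivity
  have hρd : d - ρ = d * ((n + 1) / (n + 2)) := by rw [hρ]; field_simp; ring
  have hsub : Metric.closedBall z ρ ⊆ halfstrip θ ε r := by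
    refine (Metric.closedBall_subset_ball ?_).trans (ball_subset_halfstrip (le_of_eq hd))
    rw [hρ]; exact div_lt_self hd0 (by linarith)
  have hpow : (((n : ℝ) + 2) / (n + 1)) ^ n ≤ 3 := by
    have h1 : ((n : ℝ) + 2) / (n + 1) ≤ Real.exp (1 / (n + 1)) := by
      refine le_trans (le_of_eq ?_) (Real.add_one_le_exp _)
      field_simp; ring
    calc (((n : ℝ) + 2) / (n + 1)) ^ n ≤ Real.exp (1 / (n + 1)) ^ n := by gcongr
      _ = Real.exp (n * (1 / (n + 1))) := (Real.exp_nat_mul _ _).symm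
      _ ≤ Real.exp 1 := by
        rw [Real.exp_le_exp, mul_one_div, div_le_one (by positivity)]; linarith
      _ ≤ 3 := by linarith [Real.exp_one_lt_d9]
  have key : ‖deriv f z‖ ≤ (A / (d * ((n + 1) / (n + 2))) ^ n) / ρ := by
    refine norm_deriv_le_of_forall_mem (U := Metric.closedBall z ρ) (hf.mono hsub) hρ0 subset_rfl
      fun w hw => (hb w (hsub hw)).trans ?_
    have h1 := gap_sub_dist_le θ ε r z w
    have h2 := Metric.mem_closedBall.1 hw
    rw [← hρd]
    have : 0 < d - ρ := by rw [hρd]; positivity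
    gcongr
    linarith
  refine key.trans ?_
  have e1 : (A / (d * (((n : ℝ) + 1) / (n + 2))) ^ n) / ρ =
      A * ((((n : ℝ) + 2) / (n + 1)) ^ n * (n + 2)) / d ^ (n + 1) := by
    rw [hρ, mul_pow, div_pow, div_pow]; field_simp; ring
  rw [e1]
  refine div_le_div_of_nonneg_right ?_ (by positivity)
  calc A * ((((n : ℝ) + 2) / (n + 1)) ^ n * (n + 2)) ≤ A * (3 * (2 * (n + 1))) := by
        gcongr; linarith
    _ = _ := by ring

lemma differentiableOn_conv {F G : ℕ → ℂ → 𝔸} {U : Set ℂ} {n : ℕ}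
    (hF : ∀ j ≤ n, DifferentiableOn ℂ (F j) U) (hG : ∀ j ≤ n, DifferentiableOn ℂ (G j) U) :
    DifferentiableOn ℂ (fun z => conv (fun j => F j z) (fun j => G j z) n) U :=
  DifferentiableOn.fun_sum fun k hk => (hF _ (Nat.sub_le _ _)).mul
    (hG k (Nat.lt_succ_iff.1 (Finset.mem_range.1 hk)))

/-- The step of the recursion for the formal solution of `ε h N' = N - h (k₀ + ⋯)`. -/
noncomputable def quadStep (ε : ℤˣ) (k₀ k₁ k₂ k₃ : ℕ → ℂ → 𝔸) : ℕ → (ℕ → ℂ → 𝔸) → ℂ → 𝔸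
  | 0, _ => 0
  | n + 1, N => fun z => ((ε : ℤ) : ℂ) • deriv (N n) z +
      quadCoeff (fun j => k₀ j z) (fun j => k₁ j z) (fun j => k₂ j z) (fun j => k₃ j z)
        (fun j => N j z) n

/-- Nagumo's method. Each step of the recursion differentiates once, and with the weights `gap ^
(-n)` a derivative costs only `n + 1` and one more power of the gap, with no shrinking of the
halfstrip. The factors `n + 1` accumulate to `n!`. -/
theorem exists_formal_quad [CompleteSpace 𝔸] {θ : ℝ} {ε : ℤˣ} {r C M : ℝ} (hr : 0 < r) (hC : 0 ≤ C)
    (hM : 0 ≤ M)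
    {k₀ k₁ k₂ k₃ : ℕ → ℂ → 𝔸} (d₀ : ∀ j, DifferentiableOn ℂ (k₀ j) (halfstrip θ ε r))
    (d₁ : ∀ j, DifferentiableOn ℂ (k₁ j) (halfstrip θ ε r))
    (d₂ : ∀ j, DifferentiableOn ℂ (k₂ j) (halfstrip θ ε r))
    (d₃ : ∀ j, DifferentiableOn ℂ (k₃ j) (halfstrip θ ε r))
    (b₀ : ∀ j, ∀ z ∈ halfstrip θ ε r, ‖k₀ j z‖ ≤ C * M ^ j * (j ! : ℝ))
    (b₁ : ∀ j, ∀ z ∈ halfstrip θ ε r, ‖k₁ j z‖ ≤ C * M ^ j * (j ! : ℝ))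
    (b₂ : ∀ j, ∀ z ∈ halfstrip θ ε r, ‖k₂ j z‖ ≤ C * M ^ j * (j ! : ℝ))
    (b₃ : ∀ j, ∀ z ∈ halfstrip θ ε r, ‖k₃ j z‖ ≤ C * M ^ j * (j ! : ℝ)) :
    ∃ (N : ℕ → ℂ → 𝔸) (L : ℝ), 0 ≤ L ∧ N 0 = 0 ∧
      (∀ n z, N (n + 1) z = ((ε : ℤ) : ℂ) • deriv (N n) z +
        quadCoeff (fun j => k₀ j z) (fun j => k₁ j z) (fun j => k₂ j z) (fun j => k₃ j z)
          (fun j => N j z) n) ∧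
      (∀ n, DifferentiableOn ℂ (N n) (halfstrip θ ε r)) ∧
      ∀ n, ∀ z ∈ halfstrip θ ε r, ‖N n z‖ ≤ L ^ n * (n ! : ℝ) / gap θ ε r z ^ n := by
  set N := strongSeq (quadStep ε k₀ k₁ k₂ k₃) with hN
  have hN0 : N 0 = 0 := by rw [hN, strongSeq_eq]; rfl
  have hNs : ∀ n z, N (n + 1) z = ((ε : ℤ) : ℂ) • deriv (N n) z +
        quadCoeff (fun j => k₀ j z) (fun j => k₁ j z) (fun j => k₂ j z) (fun j => k₃ j z)
          (fun j => N j z) n := fun n z => by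
    rw [hN, strongSeq_eq]
    simp only [quadStep, Nat.lt_succ_self, if_true]
    congr 1
    refine quadCoeff_congr fun j hj => ?_
    rw [if_pos (Nat.lt_succ_iff.2 hj)]
  have hNd : ∀ n, DifferentiableOn ℂ (N n) (halfstrip θ ε r) := fun n => by
    induction n using Nat.strong_induction_on with
    | _ n ih =>
      rcases n with _ | n
      · rw [hN0]; exact differentiableOn_const 0
      · have ih' : ∀ j ≤ n, DifferentiableOn ℂ (N j) (halfstrip θ ε r) := fun j hj =>
          ih j (Nat.lt_succ_iff.2 hj)
        have : N (n + 1) = fun z => _ := funext (hNs n)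
        rw [this]
        have hd : DifferentiableOn ℂ (fun z => ((ε : ℤ) : ℂ) • deriv (N n) z) (halfstrip θ ε r) :=
          ((ih' n le_rfl).deriv (isOpen_halfstrip θ ε r)).fun_const_smul _
        refine hd.add ?_
        refine (((d₀ n).add (differentiableOn_conv (fun j _ => d₁ j) ih')).add
          (differentiableOn_conv ih' fun j _ => d₂ j)).add
          (differentiableOn_conv (G := fun j z => conv (fun j => k₃ j z) (fun j => N j z) j) ih'
            fun j hj => ?_)
        exact differentiableOn_conv (fun i _ => d₃ i) fun i hi => ih' i (hi.trans hj)
  -- The summand `6` pays for the derivative, `16 C r` for the quadratic expression (`1 + 6 + 9 =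
  -- 16`, and the gap is at most `r`), and `M r` ensures `M ≤ L / gap`.
  set L : ℝ := 6 + 16 * C * r + M * r with hL
  have hL0 : 0 ≤ L := by positivity
  refine ⟨N, L, hL0, hN0, hNs, hNd, fun n => ?_⟩
  induction n using Nat.strong_induction_on with
  | _ n ih =>
    rcases n with _ | n
    · intro z _; simp [hN0]
    · intro z hz
      have hg := gap_pos hz
      set d := gap θ ε r z with hd
      have hdr : d ≤ r := gap_le θ ε r z
      have hMd : M ≤ L / d := by
        rw [le_div_iff₀ hg]
        have : M * d ≤ M * r := by gcongr
        have : 0 ≤ C * r := by positivity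
        linarith
      have hk : ∀ {k : ℕ → ℂ → 𝔸}, (∀ j, ∀ z ∈ halfstrip θ ε r, ‖k j z‖ ≤ C * M ^ j * (j ! : ℝ)) →
          ∀ j ≤ n, ‖k j z‖ ≤ C * (L / d) ^ j * (j ! : ℝ) := fun b j _ =>
        (b j z hz).trans (by gcongr)
      have hNj : ∀ j ≤ n, ‖N j z‖ ≤ 1 * (L / d) ^ j * (j ! : ℝ) := fun j hj => by
        refine (ih j (Nat.lt_succ_iff.2 hj) z hz).trans (le_of_eq ?_)
        rw [div_pow]; ring
      have h1 := norm_quadCoeff_le (a := 1) (by positivity) (hk b₀) (hk b₁) (hk b₂) (hk b₃) hNj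
      have h2 := norm_deriv_le_gap (A := L ^ n * (n ! : ℝ)) (by positivity) (hNd n)
        (ih n (Nat.lt_succ_self n)) hz
      rw [hNs]
      refine (norm_add_le _ _).trans ?_
      rw [norm_smul, norm_units_cast, one_mul]
      refine (add_le_add h2 h1).trans ?_
      rw [← hd, div_pow, div_add' _ _ _ (by positivity)]
      gcongr
      have e1 : C * (1 + 6 * 1 + 9 * 1 ^ 2) * (L ^ n / d ^ n) * (n ! : ℝ) * d ^ (n + 1) =
          16 * C * d * L ^ n * (n ! : ℝ) := by field_simp; ring
      rw [e1, Nat.factorial_succ]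
      push_cast
      have e2 : 16 * C * d * L ^ n * (n ! : ℝ) ≤ (16 * C * r) * (L ^ n * (n ! : ℝ) * (n + 1)) := by
        have h3 : 16 * C * d ≤ 16 * C * r := by gcongr
        have h4 : L ^ n * (n ! : ℝ) ≤ L ^ n * (n ! : ℝ) * (n + 1) :=
          le_mul_of_one_le_right (by positivity) (by linarith [Nat.cast_nonneg (α := ℝ) n])
        calc 16 * C * d * L ^ n * (n ! : ℝ) = (16 * C * d) * (L ^ n * (n ! : ℝ)) := by ring
          _ ≤ _ := mul_le_mul h3 h4 (by positivity) (by positivity)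
      have e3 : 0 ≤ M * r * (L ^ n * (n ! : ℝ) * (n + 1)) := by positivity
      calc _ ≤ 6 * (L ^ n * (n ! : ℝ)) * (n + 1) + (16 * C * r) * (L ^ n * (n ! : ℝ) * (n + 1)) := by
            gcongr
        _ ≤ L * (L ^ n * (n ! : ℝ) * (n + 1)) := by
            conv_rhs => rw [hL]
            linarith
        _ = _ := by ring

end Formal

/-! ### The exact solution of the matrix Riccati equation -/

section Exact

variable {𝔸 : Type*} [NormedRing 𝔸]

/-- The quadratic expression `k₀ + k₁ N + N k₂ + N k₃ N`. -/
def quad (k₀ k₁ k₂ k₃ N : 𝔸) : 𝔸 := k₀ + k₁ * N + N * k₂ + N * (k₃ * N)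

lemma norm_quad_le {k₀ k₁ k₂ k₃ N : 𝔸} {C : ℝ} (h₀ : ‖k₀‖ ≤ C) (h₁ : ‖k₁‖ ≤ C) (h₂ : ‖k₂‖ ≤ C)
    (h₃ : ‖k₃‖ ≤ C) (hN : ‖N‖ ≤ 1) : ‖quad k₀ k₁ k₂ k₃ N‖ ≤ 4 * C := by
  have hC : 0 ≤ C := (norm_nonneg _).trans h₀
  have e1 : ‖k₁ * N‖ ≤ C * 1 := (norm_mul_le _ _).trans (by gcongr)
  have e2 : ‖N * k₂‖ ≤ 1 * C := (norm_mul_le _ _).trans (by gcongr)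
  have e3 : ‖k₃ * N‖ ≤ C * 1 := (norm_mul_le _ _).trans (by gcongr)
  have e4 : ‖N * (k₃ * N)‖ ≤ 1 * (C * 1) := (norm_mul_le _ _).trans (by gcongr)
  have := norm_add₄_le (a := k₀) (b := k₁ * N) (c := N * k₂) (d := N * (k₃ * N))
  rw [quad]; linarith

lemma norm_quad_sub_le {k₀ k₁ k₂ k₃ N N' : 𝔸} {C x : ℝ} (h₁ : ‖k₁‖ ≤ C)
    (h₂ : ‖k₂‖ ≤ C) (h₃ : ‖k₃‖ ≤ C) (hN : ‖N‖ ≤ 1) (hN' : ‖N'‖ ≤ 1) (hx : ‖N - N'‖ ≤ x) :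
    ‖quad k₀ k₁ k₂ k₃ N - quad k₀ k₁ k₂ k₃ N'‖ ≤ 4 * C * x := by
  have hC : 0 ≤ C := (norm_nonneg _).trans h₁
  have hx0 : 0 ≤ x := (norm_nonneg _).trans hx
  have e : quad k₀ k₁ k₂ k₃ N - quad k₀ k₁ k₂ k₃ N' = k₁ * (N - N') + (N - N') * k₂ +
      (N - N') * (k₃ * N) + N' * (k₃ * (N - N')) := by
    simp only [quad]; noncomm_ring
  have e1 : ‖k₁ * (N - N')‖ ≤ C * x := (norm_mul_le _ _).trans (by gcongr)
  have e2 : ‖(N - N') * k₂‖ ≤ x * C := (norm_mul_le _ _).trans (by gcongr)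
  have e3 : ‖(N - N') * (k₃ * N)‖ ≤ x * (C * 1) :=
    (norm_mul_le _ _).trans (by gcongr; exact (norm_mul_le _ _).trans (by gcongr))
  have e4 : ‖N' * (k₃ * (N - N'))‖ ≤ 1 * (C * x) :=
    (norm_mul_le _ _).trans (by gcongr; exact (norm_mul_le _ _).trans (by gcongr))
  rw [e]
  refine norm_add₄_le.trans ?_
  linarith

variable [NormedAlgebra ℂ 𝔸]

lemma norm_rem_quad_le {k₀ k₁ k₂ k₃ N : ℕ → 𝔸} {x₀ x₁ x₂ x₃ y : 𝔸} {C B M : ℝ} (hM : 0 ≤ M)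
    {h : ℂ} {n : ℕ}
    (h₀ : ‖rem k₀ h n x₀‖ ≤ C * M ^ n * (n ! : ℝ) * ‖h‖ ^ n)
    (h₁ : ∀ j ≤ n, ‖rem k₁ h j x₁‖ ≤ C * M ^ j * (j ! : ℝ) * ‖h‖ ^ j)
    (h₂ : ∀ j ≤ n, ‖rem k₂ h j x₂‖ ≤ C * M ^ j * (j ! : ℝ) * ‖h‖ ^ j)
    (h₃ : ∀ j ≤ n, ‖rem k₃ h j x₃‖ ≤ C * M ^ j * (j ! : ℝ) * ‖h‖ ^ j)
    (c₂ : ∀ j ≤ n, ‖k₂ j‖ ≤ C * M ^ j * (j ! : ℝ)) (c₃ : ∀ j ≤ n, ‖k₃ j‖ ≤ C * M ^ j * (j ! : ℝ))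
    (hy : ‖y‖ ≤ 1) (hN : ∀ j ≤ n, ‖rem N h j y‖ ≤ B * M ^ j * (j ! : ℝ) * ‖h‖ ^ j)
    (cN : ∀ j ≤ n, ‖N j‖ ≤ 1 * M ^ j * (j ! : ℝ)) :
    ‖rem (quadCoeff k₀ k₁ k₂ k₃ N) h n (quad x₀ x₁ x₂ x₃ y)‖ ≤
      C * (8 + 14 * B) * M ^ n * (n ! : ℝ) * ‖h‖ ^ n := by
  have hx : ∀ {k : ℕ → 𝔸} {x : 𝔸},
      (∀ j ≤ n, ‖rem k h j x‖ ≤ C * M ^ j * (j ! : ℝ) * ‖h‖ ^ j) → ‖x‖ ≤ C := fun H => by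
    simpa using H 0 (Nat.zero_le _)
  have e : quadCoeff k₀ k₁ k₂ k₃ N = k₀ + conv k₁ N + conv N k₂ + conv N (conv k₃ N) := rfl
  rw [e, quad, rem_add, rem_add, rem_add]
  have e1 := norm_rem_mul_le hM (hx h₁) h₁ (hN n le_rfl) cN
  have e2 := norm_rem_mul_le hM hy hN (h₂ n le_rfl) c₂
  have e3 : ∀ j ≤ n, ‖rem (conv k₃ N) h j (x₃ * y)‖ ≤
      (C * B + 3 * C * 1) * M ^ j * (j ! : ℝ) * ‖h‖ ^ j := fun j hj =>
    norm_rem_mul_le hM (hx h₃) (fun i hi => h₃ i (hi.trans hj)) (hN j hj)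
      fun i hi => cN i (hi.trans hj)
  have e4 : ∀ j ≤ n, ‖conv k₃ N j‖ ≤ (3 * C * 1) * M ^ j * (j ! : ℝ) := fun j hj =>
    norm_conv_le hM (fun i hi => c₃ i (hi.trans hj)) fun i hi => cN i (hi.trans hj)
  have e5 := norm_rem_mul_le hM hy hN (e3 n le_rfl) e4
  refine norm_add₄_le.trans ((add_le_add (add_le_add (add_le_add h₀ e1) e2) e5).trans
    (le_of_eq ?_))
  ring

lemma DifferentiableOn.quad {k₀ k₁ k₂ k₃ N : ℂ × ℂ → 𝔸} {s : Set (ℂ × ℂ)}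
    (h₀ : DifferentiableOn ℂ k₀ s) (h₁ : DifferentiableOn ℂ k₁ s) (h₂ : DifferentiableOn ℂ k₂ s)
    (h₃ : DifferentiableOn ℂ k₃ s) (hN : DifferentiableOn ℂ N s) :
    DifferentiableOn ℂ (fun p => quad (k₀ p) (k₁ p) (k₂ p) (k₃ p) (N p)) s :=
  ((h₀.add (h₁.mul hN)).add (hN.mul h₂)).add (hN.mul (h₃.mul hN))

lemma DifferentiableOn.slice {E : Type*} [NormedAddCommGroup E] [NormedSpace ℂ E] {U D : Set ℂ}
    {f : ℂ → ℂ → E} (hf : DifferentiableOn ℂ (Function.uncurry f) (U ×ˢ D)) {h : ℂ} (hh : h ∈ D) :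
    DifferentiableOn ℂ (fun z => f z h) U :=
  hf.comp (f := fun z => (z, h)) (by fun_prop) fun _ hz => ⟨hz, hh⟩

lemma DifferentiableOn.slice_right {E : Type*} [NormedAddCommGroup E] [NormedSpace ℂ E]
    {U D : Set ℂ} {f : ℂ → ℂ → E} (hf : DifferentiableOn ℂ (Function.uncurry f) (U ×ˢ D)) {z : ℂ}
    (hz : z ∈ U) : DifferentiableOn ℂ (f z) D :=
  hf.comp (f := fun h => (z, h)) (by fun_prop) fun _ hh => ⟨hz, hh⟩

variable {θ : ℝ} {ε : ℤˣ} {r δ : ℝ}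

/-- The difference of two bounded solutions is a bounded solution with the difference of the source
terms, so the a priori estimate applies. -/
lemma eq_of_ode_of_small {C : ℝ} (hδ : 0 < δ) {u v g g' : ℂ → 𝔸} {h : ℂ}
    (hh : h ∈ borelDisc θ δ)
    (hu : DifferentiableOn ℂ u (halfstrip θ ε r)) (hv : DifferentiableOn ℂ v (halfstrip θ ε r))
    (ou : ∀ z ∈ halfstrip θ ε r, (((ε : ℤ) : ℂ) * h) • deriv u z = u z - h • g z)
    (ov : ∀ z ∈ halfstrip θ ε r, (((ε : ℤ) : ℂ) * h) • deriv v z = v z - h • g' z)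
    {B : ℝ} (bu : ∀ z ∈ halfstrip θ ε r, ‖u z‖ ≤ B) (bv : ∀ z ∈ halfstrip θ ε r, ‖v z‖ ≤ B)
    (hC : ∀ z ∈ halfstrip θ ε r, ‖g z - g' z‖ ≤ C) {z : ℂ} (hz : z ∈ halfstrip θ ε r) :
    ‖u z - v z‖ ≤ δ * C := by
  refine norm_le_of_bounded_solution (e := fun z => u z - v z) (g := fun z => g z - g' z)
    (B := B + B) hδ hh (hu.sub hv) (fun z hz => ?_)
    (fun z hz => (norm_sub_le _ _).trans (add_le_add (bu z hz) (bv z hz))) hC hz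
  have hn := (isOpen_halfstrip θ ε r).mem_nhds hz
  rw [deriv_fun_sub (hu.differentiableAt hn) (hv.differentiableAt hn), smul_sub, ou z hz, ov z hz,
    smul_sub]
  abel

/-- The solution is a fixed point of `f ↦ lapl (quad f)` on the unit ball. There the quadratic
expression is bounded by `4 C` and is `4 C`-Lipschitz, while the integral gains `δ`; thus `8 C δ ≤
1` gives invariance of the ball and contraction by `1 / 2`. -/
theorem exists_exact_quad_bounded [CompleteSpace 𝔸] {C : ℝ} (hδ : 0 < δ) (hδC : 8 * C * δ ≤ 1)
    {k₀ k₁ k₂ k₃ : ℂ → ℂ → 𝔸}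
    (d₀ : DifferentiableOn ℂ (Function.uncurry k₀) (halfstrip θ ε r ×ˢ borelDisc θ δ))
    (d₁ : DifferentiableOn ℂ (Function.uncurry k₁) (halfstrip θ ε r ×ˢ borelDisc θ δ))
    (d₂ : DifferentiableOn ℂ (Function.uncurry k₂) (halfstrip θ ε r ×ˢ borelDisc θ δ))
    (d₃ : DifferentiableOn ℂ (Function.uncurry k₃) (halfstrip θ ε r ×ˢ borelDisc θ δ))
    (b₀ : ∀ z ∈ halfstrip θ ε r, ∀ h ∈ borelDisc θ δ, ‖k₀ z h‖ ≤ C)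
    (b₁ : ∀ z ∈ halfstrip θ ε r, ∀ h ∈ borelDisc θ δ, ‖k₁ z h‖ ≤ C)
    (b₂ : ∀ z ∈ halfstrip θ ε r, ∀ h ∈ borelDisc θ δ, ‖k₂ z h‖ ≤ C)
    (b₃ : ∀ z ∈ halfstrip θ ε r, ∀ h ∈ borelDisc θ δ, ‖k₃ z h‖ ≤ C) :
    ∃ f : ℂ → ℂ → 𝔸,
      DifferentiableOn ℂ (Function.uncurry f) (halfstrip θ ε r ×ˢ borelDisc θ δ) ∧
      (∀ z ∈ halfstrip θ ε r, ∀ h ∈ borelDisc θ δ, ‖f z h‖ ≤ 1) ∧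
      ∀ z ∈ halfstrip θ ε r, ∀ h ∈ borelDisc θ δ,
        (((ε : ℤ) : ℂ) * h) • deriv (fun z => f z h) z =
          f z h - h • quad (k₀ z h) (k₁ z h) (k₂ z h) (k₃ z h) (f z h) := by
  set T : (ℂ → ℂ → 𝔸) → ℂ → ℂ → 𝔸 := fun f =>
    lapl θ ε fun z h => quad (k₀ z h) (k₁ z h) (k₂ z h) (k₃ z h) (f z h) with hT
  have hTq : ∀ f : ℂ → ℂ → 𝔸,
      DifferentiableOn ℂ (Function.uncurry f) (halfstrip θ ε r ×ˢ borelDisc θ δ) →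
      DifferentiableOn ℂ (Function.uncurry
        fun z h => quad (k₀ z h) (k₁ z h) (k₂ z h) (k₃ z h) (f z h))
        (halfstrip θ ε r ×ˢ borelDisc θ δ) := fun f hf => DifferentiableOn.quad d₀ d₁ d₂ d₃ hf
  have hTb : ∀ f : ℂ → ℂ → 𝔸, (∀ z ∈ halfstrip θ ε r, ∀ h ∈ borelDisc θ δ, ‖f z h‖ ≤ 1) →
      ∀ z ∈ halfstrip θ ε r, ∀ h ∈ borelDisc θ δ,
        ‖quad (k₀ z h) (k₁ z h) (k₂ z h) (k₃ z h) (f z h)‖ ≤ 4 * C := fun f hf z hz h hh =>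
    norm_quad_le (b₀ z hz h hh) (b₁ z hz h hh) (b₂ z hz h hh) (b₃ z hz h hh) (hf z hz h hh)
  have hT1 : ∀ f : ℂ → ℂ → 𝔸,
      DifferentiableOn ℂ (Function.uncurry f) (halfstrip θ ε r ×ˢ borelDisc θ δ) →
      (∀ z ∈ halfstrip θ ε r, ∀ h ∈ borelDisc θ δ, ‖f z h‖ ≤ 1) →
      DifferentiableOn ℂ (Function.uncurry (T f)) (halfstrip θ ε r ×ˢ borelDisc θ δ) ∧
      (∀ z ∈ halfstrip θ ε r, ∀ h ∈ borelDisc θ δ, ‖T f z h‖ ≤ 1) ∧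
      ∀ h ∈ borelDisc θ δ, ∀ z ∈ halfstrip θ ε r,
        (((ε : ℤ) : ℂ) * h) • deriv (fun z => T f z h) z =
          T f z h - h • quad (k₀ z h) (k₁ z h) (k₂ z h) (k₃ z h) (f z h) := fun f hf hb => by
    refine ⟨differentiableOn_lapl hδ (hTq f hf) (hTb f hb), fun z hz h hh => ?_,
      fun h hh z hz => ?_⟩
    · refine (norm_lapl_le hδ (hTb f hb) hz hh).trans ?_
      have := (norm_nonneg _).trans (b₀ z hz h hh)
      nlinarith
    · have h0 := ne_zero_of_mem_borelDisc hδ hh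
      rw [(hasDerivAt_lapl hδ (hTq f hf) (hTb f hb) hz hh).deriv, smul_smul, mul_right_comm,
        units_cast_sq, one_mul, smul_sub, smul_smul, mul_inv_cancel₀ h0, one_smul]
  -- Contraction is read off from the differential equations of the two images, not from the
  -- integrals.
  have hT2 : ∀ f g : ℂ → ℂ → 𝔸,
      DifferentiableOn ℂ (Function.uncurry f) (halfstrip θ ε r ×ˢ borelDisc θ δ) →
      DifferentiableOn ℂ (Function.uncurry g) (halfstrip θ ε r ×ˢ borelDisc θ δ) →
      (∀ z ∈ halfstrip θ ε r, ∀ h ∈ borelDisc θ δ, ‖f z h‖ ≤ 1) →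
      (∀ z ∈ halfstrip θ ε r, ∀ h ∈ borelDisc θ δ, ‖g z h‖ ≤ 1) → ∀ x : ℝ,
      (∀ z ∈ halfstrip θ ε r, ∀ h ∈ borelDisc θ δ, ‖f z h - g z h‖ ≤ x) →
      ∀ z ∈ halfstrip θ ε r, ∀ h ∈ borelDisc θ δ, ‖T f z h - T g z h‖ ≤ x / 2 :=
      fun f g hf hg bf bg x hx z hz h hh => by
    obtain ⟨df, nf, of⟩ := hT1 f hf bf
    obtain ⟨dg, ng, og⟩ := hT1 g hg bg
    refine (eq_of_ode_of_small hδ hh (DifferentiableOn.slice df hh) (DifferentiableOn.slice dg hh)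
      (of h hh) (og h hh) (fun z hz => nf z hz h hh) (fun z hz => ng z hz h hh)
      (fun z hz => norm_quad_sub_le (b₁ z hz h hh) (b₂ z hz h hh) (b₃ z hz h hh) (bf z hz h hh)
        (bg z hz h hh) (hx z hz h hh)) hz).trans ?_
    have := (norm_nonneg _).trans (hx z hz h hh)
    nlinarith
  set P : ℕ → ℂ → ℂ → 𝔸 := fun n => T^[n] 0 with hP
  have hPs : ∀ n, P (n + 1) = T (P n) := fun n => Function.iterate_succ_apply' T n 0
  have hP1 : ∀ n, DifferentiableOn ℂ (Function.uncurry (P n))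
      (halfstrip θ ε r ×ˢ borelDisc θ δ) ∧
      ∀ z ∈ halfstrip θ ε r, ∀ h ∈ borelDisc θ δ, ‖P n z h‖ ≤ 1 := fun n => by
    induction n with
    | zero => exact ⟨differentiableOn_const 0, fun z _ h _ => by simp [hP]⟩
    | succ n ih => rw [hPs]; exact ⟨(hT1 _ ih.1 ih.2).1, (hT1 _ ih.1 ih.2).2.1⟩
  have hPd : ∀ n, ∀ z ∈ halfstrip θ ε r, ∀ h ∈ borelDisc θ δ,
      ‖P n z h - P (n + 1) z h‖ ≤ 1 * (1 / 2) ^ n := fun n => by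
    induction n with
    | zero =>
      intro z hz h hh
      simpa [hP] using (hP1 1).2 z hz h hh
    | succ n ih =>
      intro z hz h hh
      have := hT2 _ _ (hP1 n).1 (hP1 (n + 1)).1 (hP1 n).2 (hP1 (n + 1)).2 _ ih z hz h hh
      rw [← hPs, ← hPs] at this
      refine this.trans (le_of_eq ?_)
      rw [pow_succ]; ring
  -- The limit function is given the value `0` outside the domain, where convergence is not claimed.
  have hlim : ∀ p : ℂ × ℂ, ∃ y : 𝔸, p ∈ halfstrip θ ε r ×ˢ borelDisc θ δ →
      Filter.Tendsto (fun n => P n p.1 p.2) Filter.atTop (𝓝 y) := fun p => by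
    by_cases hp : p ∈ halfstrip θ ε r ×ˢ borelDisc θ δ
    · have := cauchySeq_of_le_geometric (1 / 2) 1 (by norm_num)
        (f := fun n => P n p.1 p.2)
        (fun n => by rw [dist_eq_norm]; exact hPd n p.1 hp.1 p.2 hp.2)
      obtain ⟨y, hy⟩ := cauchySeq_tendsto_of_complete this
      exact ⟨y, fun _ => hy⟩
    · exact ⟨0, fun h => absurd h hp⟩
  choose F hF using hlim
  set f : ℂ → ℂ → 𝔸 := fun z h => F (z, h) with hf
  have hFd : ∀ n, ∀ z ∈ halfstrip θ ε r, ∀ h ∈ borelDisc θ δ,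
      ‖f z h - P n z h‖ ≤ 2 * (1 / 2) ^ n := fun n z hz h hh => by
    have := dist_le_of_le_geometric_of_tendsto (1 / 2) 1 (by norm_num)
        (fun n => by rw [dist_eq_norm]; exact hPd n z hz h hh) (hF (z, h) ⟨hz, hh⟩) n
    rw [dist_comm, dist_eq_norm] at this
    refine this.trans (le_of_eq ?_)
    ring
  have htend : Filter.Tendsto (fun n : ℕ => 2 * (1 / 2 : ℝ) ^ n) Filter.atTop (𝓝 0) := by
    simpa using (tendsto_pow_atTop_nhds_zero_of_lt_one (r := (1 / 2 : ℝ)) (by norm_num)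
      (by norm_num)).const_mul 2
  have hunif : TendstoUniformlyOn (fun n => Function.uncurry (P n)) (Function.uncurry f)
      Filter.atTop (halfstrip θ ε r ×ˢ borelDisc θ δ) := by
    rw [Metric.tendstoUniformlyOn_iff]
    intro e he
    filter_upwards [htend.eventually_lt_const he] with n hn p hp
    rw [dist_eq_norm]
    exact (hFd n p.1 hp.1 p.2 hp.2).trans_lt hn
  have hfd : DifferentiableOn ℂ (Function.uncurry f) (halfstrip θ ε r ×ˢ borelDisc θ δ) := by
    refine differentiableOn_of_separately (isOpen_halfstrip θ ε r) (isOpen_borelDisc hδ)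
      (hunif.continuousOn (Filter.Eventually.of_forall fun n => (hP1 n).1.continuousOn).frequently)
      (fun h hh => ?_) (fun z hz => ?_)
    · have h1 : TendstoUniformlyOn (fun n z => P n z h) (fun z => f z h) Filter.atTop
          (halfstrip θ ε r) := (hunif.comp fun z => (z, h)).mono fun z hz => ⟨hz, hh⟩
      exact h1.tendstoLocallyUniformlyOn.differentiableOn
        (Filter.Eventually.of_forall fun n => DifferentiableOn.slice (hP1 n).1 hh)
        (isOpen_halfstrip θ ε r)
    · have h1 : TendstoUniformlyOn (fun n h => P n z h) (fun h => f z h) Filter.atTop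
          (borelDisc θ δ) := (hunif.comp fun h => (z, h)).mono fun h hh => ⟨hz, hh⟩
      exact h1.tendstoLocallyUniformlyOn.differentiableOn
        (Filter.Eventually.of_forall fun n => DifferentiableOn.slice_right (hP1 n).1 hz)
        (isOpen_borelDisc hδ)
  have hfb : ∀ z ∈ halfstrip θ ε r, ∀ h ∈ borelDisc θ δ, ‖f z h‖ ≤ 1 := fun z hz h hh =>
    le_of_tendsto (hF (z, h) ⟨hz, hh⟩).norm
      (Filter.Eventually.of_forall fun n => (hP1 n).2 z hz h hh)
  have hfT : ∀ z ∈ halfstrip θ ε r, ∀ h ∈ borelDisc θ δ, f z h = T f z h := fun z hz h hh => by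
    refine tendsto_nhds_unique ((hF (z, h) ⟨hz, hh⟩).comp (Filter.tendsto_add_atTop_nat 1)) ?_
    rw [tendsto_iff_norm_sub_tendsto_zero]
    refine squeeze_zero (fun _ => norm_nonneg _) (fun n => ?_)
      (show Filter.Tendsto (fun n : ℕ => 2 * (1 / 2 : ℝ) ^ n / 2) Filter.atTop (𝓝 0) by
        simpa only [zero_div] using htend.div_const 2)
    · rw [Function.comp_apply, hPs, norm_sub_rev]
      exact hT2 _ _ hfd (hP1 n).1 hfb (hP1 n).2 _ (hFd n) z hz h hh
  refine ⟨f, hfd, hfb, fun z hz h hh => ?_⟩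
  have hev : (fun z => f z h) =ᶠ[𝓝 z] fun z => T f z h :=
    Filter.eventually_of_mem ((isOpen_halfstrip θ ε r).mem_nhds hz) fun w hw => hfT w hw h hh
  rw [hev.deriv_eq, (hT1 f hfd hfb).2.2 h hh z hz, ← hfT z hz h hh]

end Exact

/-! ### Uniform Gevrey asymptotics of the exact matrix solution -/

section ExactGevrey

variable {𝔸 : Type*} [NormedRing 𝔸] [NormedAlgebra ℂ 𝔸] {θ : ℝ} {ε : ℤˣ} {r r₁ δ : ℝ}

/-- The remainders of an exact solution satisfy a linear equation. -/
lemma deriv_rem_formal {k₀ k₁ k₂ k₃ N : ℕ → ℂ → 𝔸} {x₀ x₁ x₂ x₃ : 𝔸} {f : ℂ → 𝔸}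
    (hN0 : N 0 = 0) {z h : ℂ}
    (hNs : ∀ n, N (n + 1) z = ((ε : ℤ) : ℂ) • deriv (N n) z +
        quadCoeff (fun j => k₀ j z) (fun j => k₁ j z) (fun j => k₂ j z) (fun j => k₃ j z)
          (fun j => N j z) n)
    (hNd : ∀ n, DifferentiableAt ℂ (N n) z) (hf : DifferentiableAt ℂ f z)
    (hode : (((ε : ℤ) : ℂ) * h) • deriv f z = f z - h • quad x₀ x₁ x₂ x₃ (f z)) (n : ℕ) :
    (((ε : ℤ) : ℂ) * h) • deriv (fun z => rem (fun k => N k z) h (n + 1) (f z)) z =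
      rem (fun k => N k z) h (n + 1) (f z) - h • (rem (quadCoeff (fun j => k₀ j z)
        (fun j => k₁ j z) (fun j => k₂ j z) (fun j => k₃ j z) (fun j => N j z)) h n
          (quad x₀ x₁ x₂ x₃ (f z)) + h ^ n • ((ε : ℤ) : ℂ) • deriv (N n) z) := by
  induction n with
  | zero =>
    have e : (fun z => rem (fun k => N k z) h (0 + 1) (f z)) = f := by
      funext w; simp [rem, hN0]
    rw [e, hode]
    simp [rem, hN0]
  | succ n ih =>
    have e : (fun z => rem (fun k => N k z) h (n + 1 + 1) (f z)) =
        fun z => rem (fun k => N k z) h (n + 1) (f z) - h ^ (n + 1) • N (n + 1) z := by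
      funext w; rw [rem_succ]
    have d1 : DifferentiableAt ℂ (fun z => rem (fun k => N k z) h (n + 1) (f z)) z :=
      hf.sub (DifferentiableAt.fun_sum fun k _ => (hNd k).const_smul _)
    have d2 : DifferentiableAt ℂ (fun z => h ^ (n + 1) • N (n + 1) z) z := (hNd _).fun_const_smul _
    rw [e, deriv_fun_sub d1 d2, smul_sub, ih, deriv_fun_const_smul _ (hNd _)]
    simp only [rem_succ _ h (n + 1), rem_succ (quadCoeff _ _ _ _ _) h n]
    rw [hNs n]
    simp only [smul_add, smul_sub, smul_smul, pow_succ]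
    module

/-- The map `B ↦ 2 + B / 2` has fixed point `4` and halves distances to it. Any finite starting
constant, however it depends on `m` or on hidden parameters, therefore improves to `4` in the limit.
-/
lemma le_of_halving {ι : Type*} {H : Set ι} {R : ℕ → ι → ℝ} {w T : ℕ → ℝ} (hw : ∀ n, 0 < w n)
    (hT0 : ∀ n, 0 ≤ T n) (hT : ∀ n, ∀ z ∈ H, R n z ≤ T n)
    (step : ∀ m : ℕ, ∀ B : ℝ, 0 ≤ B → (∀ n ≤ m, ∀ z ∈ H, R n z ≤ B * w n) →
      ∀ n ≤ m, ∀ z ∈ H, R n z ≤ (2 + B / 2) * w n) (m : ℕ) {z : ι} (hz : z ∈ H) :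
    R m z ≤ 4 * w m := by
  set B₀ : ℝ := ∑ n ∈ Finset.range (m + 1), T n / w n with hB₀
  have hB₀0 : 0 ≤ B₀ := Finset.sum_nonneg fun n _ => div_nonneg (hT0 n) (hw n).le
  have init : ∀ n ≤ m, ∀ z ∈ H, R n z ≤ B₀ * w n := by
    intro n hn z hz
    have e2 : T n / w n ≤ B₀ := Finset.single_le_sum (f := fun n => T n / w n)
      (fun n _ => div_nonneg (hT0 n) (hw n).le) (Finset.mem_range.2 (Nat.lt_succ_of_le hn))
    rw [div_le_iff₀ (hw n)] at e2
    exact (hT n z hz).trans e2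
  have iter : ∀ j : ℕ, ∀ n ≤ m, ∀ z ∈ H, R n z ≤ (4 + B₀ * (1 / 2) ^ j) * w n := by
    intro j
    induction j with
    | zero =>
      intro n hn z hz
      refine (init n hn z hz).trans (mul_le_mul_of_nonneg_right ?_ (hw n).le)
      simp
    | succ j ih =>
      intro n hn z hz
      refine (step m _ (by positivity) ih n hn z hz).trans (le_of_eq ?_)
      ring
  have hlim : Filter.Tendsto (fun j : ℕ => (4 + B₀ * (1 / 2 : ℝ) ^ j) * w m)
      Filter.atTop (𝓝 ((4 + B₀ * 0) * w m)) :=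
    (((tendsto_pow_atTop_nhds_zero_of_lt_one (r := (1 / 2 : ℝ)) (by norm_num)
      (by norm_num)).const_mul B₀).const_add 4).mul_const _
  rw [mul_zero, add_zero] at hlim
  exact ge_of_tendsto' hlim fun j => iter j m le_rfl z hz

/-- The remainder of order `n + 1` is a bounded solution of a linear equation whose source involves
only remainders of order at most `n`, so the a priori estimate gains `δ`. Adding back `h ^ n • N n`
bounds the remainder of order `n`; a constant `B` for all orders up to `m` improves to `2 + B / 2`.
-/
theorem norm_rem_exact_le {C M L ρ : ℝ} (hδ : 0 < δ)
    (hρ : 0 < ρ) (hL : 0 ≤ L) (hM : 1 ≤ M) (hLM : 2 * (L / ρ) ≤ M) (hC : 0 ≤ C)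
    (hδC : δ * (28 * C + 6 / ρ) ≤ 1)
    {k₀ k₁ k₂ k₃ : ℕ → ℂ → 𝔸} {x₀ x₁ x₂ x₃ : ℂ → ℂ → 𝔸}
    (g₀ : GevreyFun (halfstrip θ ε r₁) (borelDisc θ δ) C M x₀ k₀)
    (g₁ : GevreyFun (halfstrip θ ε r₁) (borelDisc θ δ) C M x₁ k₁)
    (g₂ : GevreyFun (halfstrip θ ε r₁) (borelDisc θ δ) C M x₂ k₂)
    (g₃ : GevreyFun (halfstrip θ ε r₁) (borelDisc θ δ) C M x₃ k₃)
    {N : ℕ → ℂ → 𝔸} {f : ℂ → ℂ → 𝔸} (hN0 : N 0 = 0)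
    (hNs : ∀ n z, N (n + 1) z = ((ε : ℤ) : ℂ) • deriv (N n) z +
        quadCoeff (fun j => k₀ j z) (fun j => k₁ j z) (fun j => k₂ j z) (fun j => k₃ j z)
          (fun j => N j z) n)
    (hNd : ∀ n, DifferentiableOn ℂ (N n) (halfstrip θ ε r₁))
    (hNb : ∀ n, ∀ z ∈ halfstrip θ ε r₁, ‖N n z‖ ≤ (L / ρ) ^ n * (n ! : ℝ))
    (hNb' : ∀ n, ∀ z ∈ halfstrip θ ε r₁,
      ‖deriv (N n) z‖ ≤ 6 / ρ * (n + 1) * ((L / ρ) ^ n * (n ! : ℝ)))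
    (hfd : DifferentiableOn ℂ (Function.uncurry f) (halfstrip θ ε r₁ ×ˢ borelDisc θ δ))
    (hfb : ∀ z ∈ halfstrip θ ε r₁, ∀ h ∈ borelDisc θ δ, ‖f z h‖ ≤ 1)
    (hode : ∀ z ∈ halfstrip θ ε r₁, ∀ h ∈ borelDisc θ δ,
        (((ε : ℤ) : ℂ) * h) • deriv (fun z => f z h) z =
          f z h - h • quad (x₀ z h) (x₁ z h) (x₂ z h) (x₃ z h) (f z h)) :
    ∀ z ∈ halfstrip θ ε r₁, GevreyAt (borelDisc θ δ) 4 M (f z) (fun k => N k z) := by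
  have hM0 : 0 ≤ M := zero_le_one.trans hM
  have hLρ : 0 ≤ L / ρ := by positivity
  have hN1 : ∀ n, ∀ z ∈ halfstrip θ ε r₁, ‖N n z‖ ≤ 1 * M ^ n * (n ! : ℝ) := fun n z hz => by
    refine (hNb n z hz).trans ?_
    rw [one_mul]; gcongr; linarith
  have hN1' : ∀ n, ∀ z ∈ halfstrip θ ε r₁, ‖deriv (N n) z‖ ≤ 6 / ρ * M ^ n * (n ! : ℝ) :=
      fun n z hz => by
    refine (hNb' n z hz).trans ?_
    -- The factor `n + 1` from Cauchy's inequality is absorbed by `2 ^ n`; this is the role of `2 (L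
    -- / ρ) ≤ M`.
    have h1 : ((n : ℝ) + 1) * (L / ρ) ^ n ≤ M ^ n := by
      have h2 : (n : ℝ) + 1 ≤ 2 ^ n := by exact_mod_cast Nat.lt_two_pow_self (n := n)
      calc ((n : ℝ) + 1) * (L / ρ) ^ n ≤ 2 ^ n * (L / ρ) ^ n := by gcongr
        _ = (2 * (L / ρ)) ^ n := (mul_pow _ _ _).symm
        _ ≤ M ^ n := by gcongr
    calc _ = 6 / ρ * (((n : ℝ) + 1) * (L / ρ) ^ n) * (n ! : ℝ) := by ring
      _ ≤ _ := by gcongr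
  -- improvement of a bound for the first remainders, at a fixed `h`
  have step : ∀ h ∈ borelDisc θ δ, ∀ m : ℕ, ∀ B : ℝ, 0 ≤ B →
      (∀ n ≤ m, ∀ z ∈ halfstrip θ ε r₁,
        ‖rem (fun k => N k z) h n (f z h)‖ ≤ B * M ^ n * (n ! : ℝ) * ‖h‖ ^ n) →
      ∀ n ≤ m, ∀ z ∈ halfstrip θ ε r₁,
        ‖rem (fun k => N k z) h n (f z h)‖ ≤ (2 + B / 2) * M ^ n * (n ! : ℝ) * ‖h‖ ^ n := by
    intro h hh m B hB0 hB n hn z hz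
    have hfh := DifferentiableOn.slice hfd hh
    set W : ℝ := M ^ n * (n ! : ℝ) * ‖h‖ ^ n with hW
    have hW0 : 0 ≤ W := by positivity
    -- A crude bound at fixed `h` and `n`. It certifies boundedness of the remainder and does not
    -- enter the resulting estimate.
    set S : ℝ := 1 + ∑ k ∈ Finset.range (n + 1), ‖h‖ ^ k * (1 * M ^ k * (k ! : ℝ)) with hS
    have key : ‖rem (fun k => N k z) h (n + 1) (f z h)‖ ≤ δ * ((C * (8 + 14 * B) + 6 / ρ) * W) := by
      refine norm_le_of_bounded_solution (B := S)
        (e := fun z => rem (fun k => N k z) h (n + 1) (f z h))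
        (g := fun z => rem (quadCoeff (fun j => k₀ j z) (fun j => k₁ j z) (fun j => k₂ j z)
          (fun j => k₃ j z) (fun j => N j z)) h n (quad (x₀ z h) (x₁ z h) (x₂ z h) (x₃ z h) (f z h))
          + h ^ n • ((ε : ℤ) : ℂ) • deriv (N n) z) hδ hh ?_ ?_ ?_ ?_ hz
      · exact hfh.sub (DifferentiableOn.fun_sum fun k _ => (hNd k).fun_const_smul _)
      · intro z hz
        have hn := (isOpen_halfstrip θ ε r₁).mem_nhds hz
        exact deriv_rem_formal hN0 (fun n => hNs n z) (fun n => (hNd n).differentiableAt hn)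
          (hfh.differentiableAt hn) (hode z hz h hh) n
      · intro z hz
        refine (norm_sub_le _ _).trans (add_le_add (hfb z hz h hh)
          ((norm_sum_le _ _).trans (Finset.sum_le_sum fun k _ => ?_)))
        rw [norm_smul, norm_pow]
        gcongr
        exact hN1 k z hz
      · intro z hz
        have e1 := norm_rem_quad_le hM0 (g₀.bound z hz n h hh) (fun j _ => g₁.bound z hz j h hh)
          (fun j _ => g₂.bound z hz j h hh) (fun j _ => g₃.bound z hz j h hh)
          (fun j _ => (g₂.bound z hz).norm_coeff_le hδ hC hM0 j)
          (fun j _ => (g₃.bound z hz).norm_coeff_le hδ hC hM0 j)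
          (hfb z hz h hh) (fun j hj => hB j (hj.trans hn) z hz) (fun j _ => hN1 j z hz)
        refine (norm_add_le _ _).trans ?_
        have e2 : ‖h ^ n • ((ε : ℤ) : ℂ) • deriv (N n) z‖ ≤ 6 / ρ * W := by
          rw [norm_smul, norm_smul, norm_units_cast, one_mul, norm_pow]
          calc _ ≤ ‖h‖ ^ n * (6 / ρ * M ^ n * (n ! : ℝ)) := by gcongr; exact hN1' n z hz
            _ = _ := by rw [hW]; ring
        refine (add_le_add e1 e2).trans (le_of_eq ?_)
        rw [hW]; ring
    have e3 : rem (fun k => N k z) h n (f z h) =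
        rem (fun k => N k z) h (n + 1) (f z h) + h ^ n • N n z := by rw [rem_succ]; abel
    have e4 : ‖h ^ n • N n z‖ ≤ W := by
      rw [norm_smul, norm_pow]
      calc _ ≤ ‖h‖ ^ n * (1 * M ^ n * (n ! : ℝ)) := by gcongr; exact hN1 n z hz
        _ = _ := by rw [hW]; ring
    rw [e3]
    refine (norm_add_le _ _).trans ((add_le_add key e4).trans ?_)
    -- From `δ (28 C + 6 / ρ) ≤ 1`: the terms without `B` contribute at most `1`, and `14 δ C B ≤ B
    -- / 2`.
    have e5 : δ * (C * (8 + 14 * B) + 6 / ρ) ≤ 1 + B / 2 := by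
      have h1 : 0 ≤ δ * (6 / ρ) := by positivity
      have h2 : 0 ≤ δ * C := by positivity
      nlinarith
    calc δ * ((C * (8 + 14 * B) + 6 / ρ) * W) + W
        = (δ * (C * (8 + 14 * B) + 6 / ρ) + 1) * W := by ring
      _ ≤ (1 + B / 2 + 1) * W := by gcongr
      _ = _ := by rw [hW]; ring
  intro z hz m h hh
  have h0 : 0 < ‖h‖ := norm_pos_iff.2 (ne_zero_of_mem_borelDisc hδ hh)
  have := le_of_halving (H := halfstrip θ ε r₁)
    (R := fun n z => ‖rem (fun k => N k z) h n (f z h)‖)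
    (w := fun n => M ^ n * (n ! : ℝ) * ‖h‖ ^ n)
    (T := fun n => 1 + ∑ k ∈ Finset.range n, ‖h‖ ^ k * (1 * M ^ k * (k ! : ℝ)))
    (fun n => by positivity) (fun n => by positivity) (fun n z hz => ?_) (fun m B hB0 hB => ?_) m hz
  · simpa only [mul_assoc] using this
  · refine (norm_sub_le _ _).trans (add_le_add (hfb z hz h hh)
      ((norm_sum_le _ _).trans (Finset.sum_le_sum fun k _ => ?_)))
    rw [norm_smul, norm_pow]
    gcongr
    exact hN1 k z hz
  · have := step h hh m B hB0 (by simpa only [mul_assoc] using hB)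
    simpa only [mul_assoc] using this

/-- Existence of an exact solution of the matrix Riccati equation with uniform Gevrey
asymptotics on thinner halfstrips. -/
theorem exists_exact_quad [CompleteSpace 𝔸] {C M : ℝ} (hδ : 0 < δ) (hr₁ : 0 < r₁) (hr : r₁ < r)
    (hC : 0 ≤ C) (hM : 0 ≤ M)
    {k₀ k₁ k₂ k₃ : ℕ → ℂ → 𝔸} {x₀ x₁ x₂ x₃ : ℂ → ℂ → 𝔸}
    (g₀ : GevreyFun (halfstrip θ ε r) (borelDisc θ δ) C M x₀ k₀)
    (g₁ : GevreyFun (halfstrip θ ε r) (borelDisc θ δ) C M x₁ k₁)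
    (g₂ : GevreyFun (halfstrip θ ε r) (borelDisc θ δ) C M x₂ k₂)
    (g₃ : GevreyFun (halfstrip θ ε r) (borelDisc θ δ) C M x₃ k₃) :
    ∃ δ' > 0, δ' ≤ δ ∧ ∃ M' ≥ 0, ∃ (N : ℕ → ℂ → 𝔸) (f : ℂ → ℂ → 𝔸), N 0 = 0 ∧
      GevreyFun (halfstrip θ ε r₁) (borelDisc θ δ') 4 M' f N ∧
      ∀ z ∈ halfstrip θ ε r₁, ∀ h ∈ borelDisc θ δ',
        (((ε : ℤ) : ℂ) * h) • deriv (fun z => f z h) z =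
          f z h - h • quad (x₀ z h) (x₁ z h) (x₂ z h) (x₃ z h) (f z h) := by
  have hr0 : 0 < r := hr₁.trans hr
  have cb : ∀ {x : ℂ → ℂ → 𝔸} {k : ℕ → ℂ → 𝔸},
      GevreyFun (halfstrip θ ε r) (borelDisc θ δ) C M x k → ∀ j, ∀ z ∈ halfstrip θ ε r,
        ‖k j z‖ ≤ C * M ^ j * (j ! : ℝ) := fun g j z hz => (g.bound z hz).norm_coeff_le hδ hC hM j
  obtain ⟨N, L, hL, hN0, hNs, hNd, hNb⟩ := exists_formal_quad hr0 hC hM g₀.coeff_hol g₁.coeff_hol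
    g₂.coeff_hol g₃.coeff_hol (cb g₀) (cb g₁) (cb g₂) (cb g₃)
  set ρ := r - r₁ with hρ
  have hρ0 : 0 < ρ := sub_pos.2 hr
  set M' : ℝ := 2 * (L / ρ) + M + 1 with hM'
  have hLρ : 0 ≤ L / ρ := by positivity
  set δ' : ℝ := min δ (1 / (28 * C + 6 / ρ)) with hδ'
  have hK : 0 < 28 * C + 6 / ρ := by positivity
  have hδ'0 : 0 < δ' := lt_min hδ (by positivity)
  have hδ'1 : δ' * (28 * C + 6 / ρ) ≤ 1 := by
    rw [← le_div_iff₀ hK]; exact min_le_right _ _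
  have hsub : halfstrip θ ε r₁ ⊆ halfstrip θ ε r := halfstrip_mono hr.le
  have gm : ∀ {x : ℂ → ℂ → 𝔸} {k : ℕ → ℂ → 𝔸},
      GevreyFun (halfstrip θ ε r) (borelDisc θ δ) C M x k →
      GevreyFun (halfstrip θ ε r₁) (borelDisc θ δ') C M' x k := fun g =>
    g.mono hsub (borelDisc_mono hδ'0 (min_le_left _ _)) le_rfl hC hM (by rw [hM']; linarith)
  have hgap : ∀ z ∈ halfstrip θ ε r₁, ρ ≤ gap θ ε r z := fun z hz => sub_le_gap hz
  obtain ⟨f, hfd, hfb, hode⟩ := exists_exact_quad_bounded (C := C) hδ'0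
    (by nlinarith [show 0 ≤ δ' * (6 / ρ) by positivity, mul_nonneg hδ'0.le hC])
    (gm g₀).hol (gm g₁).hol (gm g₂).hol (gm g₃).hol (fun z hz h hh => (gm g₀).norm_le hz hh)
    (fun z hz h hh => (gm g₁).norm_le hz hh) (fun z hz h hh => (gm g₂).norm_le hz hh)
    (fun z hz h hh => (gm g₃).norm_le hz hh)
  refine ⟨δ', hδ'0, min_le_left _ _, M', by positivity, N, f, hN0,
    ⟨hfd, fun k => (hNd k).mono hsub, ?_⟩, hode⟩
  refine norm_rem_exact_le hδ'0 hρ0 hL (by rw [hM']; linarith) (by rw [hM']; linarith) hC hδ'1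
    (gm g₀) (gm g₁) (gm g₂) (gm g₃) hN0 hNs (fun k => (hNd k).mono hsub) ?_ ?_ hfd hfb hode
  · intro n z hz
    refine (hNb n z (hsub hz)).trans ?_
    rw [div_pow, div_mul_eq_mul_div]
    gcongr
    exact hgap z hz
  · intro n z hz
    refine (norm_deriv_le_gap (by positivity) (hNd n) (hNb n) (hsub hz)).trans ?_
    calc _ ≤ 6 * (L ^ n * (n ! : ℝ)) * (n + 1) / ρ ^ (n + 1) := by
          gcongr
          exact hgap z hz
      _ = _ := by rw [div_pow, pow_succ]; field_simp

end ExactGevrey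

/-! ### The exact invariant line -/

section Algebra

variable {𝔸 : Type*} [Ring 𝔸] {P P' K N : 𝔸}

/-- The quadratic expression attached to a projector `P`, its derivative `P'` and a perturbation
`K`. -/
lemma proj_mul_quad (hP : P * P = P) (hP' : P' = P' * P + P * P') :
    P * ((1 - P) * P' - (1 - P) * K * P + (P' - (1 - P) * K) * N + N * (K * P - P') +
      N * ((P' + K) * N)) - P' * N =
    -(P' * (P * N) - P * N * (P' * N) + P * N * (P' - K * (P + N))) := by
  linear_combination (norm := noncomm_ring)
    -hP * P' + hP * K * P + hP * K * N - hP' * N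

/-- Along the matrix equation this turns the equation for `N (1 - P)` into a homogeneous linear one,
just as `proj_mul_quad` does for `P N`. The inhomogeneous part drops out because the derivative of a
projector satisfies `(1 - P) P' (1 - P) = 0`. -/
lemma quad_mul_compl (hP : P * P = P) (hP' : P' = P' * P + P * P') :
    ((1 - P) * P' - (1 - P) * K * P + (P' - (1 - P) * K) * N + N * (K * P - P') +
      N * ((P' + K) * N)) * (1 - P) + N * P' =
    P' * (N * (1 - P)) - (1 - P) * K * (N * (1 - P)) + N * (1 - P) * P' +
      N * (P' + K) * (N * (1 - P)) := by
  have h1 : (1 - P) * P' * (1 - P) = 0 := by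
    linear_combination (norm := noncomm_ring) hP' * (1 - P) - P' * hP
  linear_combination (norm := noncomm_ring) h1 + (1 - P) * K * hP - N * K * hP - N * hP'

/-- The two constraints give `N² = 0`, so that `P + N` is again a projector. The identity is the
part of the invariance of its image that carries a factor `h`; the remaining part is
`compl_mul_self`. -/
lemma compl_mul_quad (hP : P * P = P) (hP' : P' = P' * P + P * P') (h1 : P * N = 0)
    (h2 : N * (1 - P) = 0) :
    (1 - (P + N)) * (P' - ((1 - P) * P' - (1 - P) * K * P + (P' - (1 - P) * K) * N +
      N * (K * P - P') + N * ((P' + K) * N)) - K * (P + N)) = 0 := by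
  have h3 : N * N = 0 := by
    linear_combination (norm := noncomm_ring) h2 * N + N * h1
  have h4 : (1 - (P + N)) * (1 - (P + N)) = 1 - (P + N) := by
    linear_combination (norm := noncomm_ring) hP + h1 - h2 + h3
  have h5 : (1 - (P + N)) * (P' * N + N * P' * N) = 0 := by
    have h6 : (1 - P) * P' * N = 0 := by
      linear_combination (norm := noncomm_ring) hP' * N + P' * h1
    linear_combination (norm := noncomm_ring) h6 - h1 * P' * N - h3 * P' * N
  linear_combination (norm := noncomm_ring) -h5 - h4 * (P' - K * (P + N))

lemma compl_mul_self (hP : P * P = P) (h1 : P * N = 0) (h2 : N * (1 - P) = 0) :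
    (1 - (P + N)) * (P + N) = 0 := by
  have h3 : N * N = 0 := by
    linear_combination (norm := noncomm_ring) h2 * N + N * h1
  linear_combination (norm := noncomm_ring) -hP - h1 + h2 - h3

end Algebra

/-! ### From the matrix equation to the invariant line -/

section Line

variable {𝔸 : Type*} [NormedRing 𝔸] [NormedAlgebra ℂ 𝔸] {θ : ℝ} {ε : ℤˣ} {r r₁ δ : ℝ}

/-- The divided difference `(f - f₀) / h` of a Gevrey function. -/
lemma GevreyFun.shift {E : Type*} [NormedAddCommGroup E] [NormedSpace ℂ E] {U D : Set ℂ} {C M : ℝ}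
    {f : ℂ → ℂ → E} {F : ℕ → ℂ → E} (H : GevreyFun U D C M f F) (hC : 0 ≤ C) (hM : 0 ≤ M)
    (hD : (0 : ℂ) ∉ D) :
    GevreyFun U D (C * M) (2 * M) (fun z h => h⁻¹ • (f z h - F 0 z)) (fun k => F (k + 1)) where
  hol := by
    have h1 : DifferentiableOn ℂ (fun p : ℂ × ℂ => F 0 p.1) (U ×ˢ D) :=
      (H.coeff_hol 0).comp (by fun_prop) fun p hp => hp.1
    have h2 : DifferentiableOn ℂ (fun p : ℂ × ℂ => p.2⁻¹) (U ×ˢ D) :=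
      DifferentiableOn.inv (by fun_prop) fun p hp h => hD (h ▸ hp.2)
    exact h2.smul (H.hol.sub h1)
  coeff_hol k := H.coeff_hol (k + 1)
  bound z hz n h hh := by
    have h0 : h ≠ 0 := fun h' => hD (h' ▸ hh)
    have h0' : 0 < ‖h‖ := norm_pos_iff.2 h0
    have e : rem (fun k => F (k + 1) z) h n (h⁻¹ • (f z h - F 0 z)) =
        h⁻¹ • rem (fun k => F k z) h (n + 1) (f z h) := by
      rw [rem, rem, Finset.sum_range_succ', smul_sub, smul_sub, smul_add, Finset.smul_sum]
      have : ∀ k ∈ Finset.range n, h⁻¹ • h ^ (k + 1) • F (k + 1) z = h ^ k • F (k + 1) z :=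
        fun k _ => by rw [smul_smul, pow_succ', inv_mul_cancel_left₀ h0]
      rw [Finset.sum_congr rfl this, pow_zero, one_smul]
      abel
    -- Dividing by `h` shifts the order by one, and `(n + 1)! = (n + 1) n!` costs the doubling of
    -- `M`.
    have h2 : (n : ℝ) + 1 ≤ 2 ^ n := by exact_mod_cast Nat.lt_two_pow_self (n := n)
    rw [e, norm_smul, norm_inv]
    calc ‖h‖⁻¹ * ‖rem (fun k => F k z) h (n + 1) (f z h)‖
        ≤ ‖h‖⁻¹ * (C * M ^ (n + 1) * ((n + 1)! : ℝ) * ‖h‖ ^ (n + 1)) := by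
          gcongr; exact H.bound z hz (n + 1) h hh
      _ = C * M * M ^ n * (n ! : ℝ) * ‖h‖ ^ n * (n + 1) := by
          rw [Nat.factorial_succ, pow_succ ‖h‖]; push_cast; field_simp; ring
      _ ≤ C * M * M ^ n * (n ! : ℝ) * ‖h‖ ^ n * 2 ^ n := by gcongr
      _ = _ := by rw [mul_pow]; ring

lemma GevreyFun.affine {U D : Set ℂ} {C M p₀ A₀ B₀ : ℝ} {f : ℂ → ℂ → 𝔸} {F : ℕ → ℂ → 𝔸}
    (H : GevreyFun U D C M f F) (hC : 0 ≤ C) (hM : 0 ≤ M) {p A B : ℂ → 𝔸}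
    (hp : DifferentiableOn ℂ p U) (hA : DifferentiableOn ℂ A U) (hB : DifferentiableOn ℂ B U)
    (hp₀ : ∀ z ∈ U, ‖p z‖ ≤ p₀) (hA₀ : ∀ z ∈ U, ‖A z‖ ≤ A₀) (hB₀ : ∀ z ∈ U, ‖B z‖ ≤ B₀)
    (hp₀' : 0 ≤ p₀) :
    GevreyFun U D (p₀ + A₀ * C * B₀) M (fun z h => p z + A z * f z h * B z)
      (fun k z => (if k = 0 then p z else 0) + A z * F k z * B z) where
  hol := by
    have h1 : ∀ {q : ℂ → 𝔸}, DifferentiableOn ℂ q U →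
        DifferentiableOn ℂ (fun p : ℂ × ℂ => q p.1) (U ×ˢ D) := fun hq =>
      hq.comp (by fun_prop) fun p hp => hp.1
    exact (h1 hp).add (((h1 hA).mul H.hol).mul (h1 hB))
  coeff_hol k := by
    refine DifferentiableOn.add ?_ ((hA.mul (H.coeff_hol k)).mul hB)
    split_ifs
    · exact hp
    · exact differentiableOn_const 0
  bound z hz n h hh := by
    have hA0 := (norm_nonneg _).trans (hA₀ z hz)
    have hB0 := (norm_nonneg _).trans (hB₀ z hz)
    have e : rem (fun k => (if k = 0 then p z else 0) + A z * F k z * B z) h n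
        (p z + A z * f z h * B z) = (if n = 0 then p z else 0) +
          A z * rem (fun k => F k z) h n (f z h) * B z := by
      induction n with
      | zero => simp
      | succ n ih =>
        rw [rem_succ, ih, rem_succ, if_neg (Nat.succ_ne_zero n), mul_sub, sub_mul, smul_add,
          mul_smul_comm, smul_mul_assoc]
        split_ifs with hn
        · simp [hn]
        · simp
    have e1 : ‖A z * rem (fun k => F k z) h n (f z h) * B z‖ ≤
        A₀ * (C * M ^ n * (n ! : ℝ) * ‖h‖ ^ n) * B₀ := by
      refine (norm_mul_le _ _).trans ?_
      gcongr
      · refine (norm_mul_le _ _).trans ?_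
        gcongr
        · exact hA₀ z hz
        · exact H.bound z hz n h hh
      · exact hB₀ z hz
    have e2 : ‖(if n = 0 then p z else 0)‖ ≤ p₀ * (M ^ n * (n ! : ℝ) * ‖h‖ ^ n) := by
      split_ifs with hn
      · subst hn; simpa using hp₀ z hz
      · rw [norm_zero]; positivity
    rw [e]
    refine (norm_add_le _ _).trans ((add_le_add e2 e1).trans (le_of_eq ?_))
    ring

/-- The a priori estimate, applied to a source bounded by `c ‖e‖`, halves any bound for `e`;
iteration leaves only zero. -/
lemma eq_zero_of_linear_ode {c : ℝ} (hδ : 0 < δ) (hc : δ * c ≤ 1 / 2) {e g : ℂ → 𝔸} {h : ℂ}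
    (hh : h ∈ borelDisc θ δ) (he : DifferentiableOn ℂ e (halfstrip θ ε r))
    (hode : ∀ z ∈ halfstrip θ ε r, (((ε : ℤ) : ℂ) * h) • deriv e z = e z - h • g z)
    {B : ℝ} (hB : ∀ z ∈ halfstrip θ ε r, ‖e z‖ ≤ B)
    (hg : ∀ z ∈ halfstrip θ ε r, ‖g z‖ ≤ c * ‖e z‖) (hc0 : 0 ≤ c) {z : ℂ}
    (hz : z ∈ halfstrip θ ε r) : e z = 0 := by
  have hB0 := (norm_nonneg _).trans (hB z hz)
  have iter : ∀ j : ℕ, ∀ z ∈ halfstrip θ ε r, ‖e z‖ ≤ B * (1 / 2) ^ j := fun j => by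
    induction j with
    | zero => simpa using hB
    | succ j ih =>
      intro z hz
      refine (norm_le_of_bounded_solution hδ hh he hode hB (G := c * (B * (1 / 2) ^ j))
        (fun z hz => (hg z hz).trans (by gcongr; exact ih z hz)) hz).trans ?_
      rw [← mul_assoc, pow_succ]
      have : 0 ≤ B * (1 / 2) ^ j := by positivity
      nlinarith
  have hlim : Filter.Tendsto (fun j : ℕ => B * (1 / 2 : ℝ) ^ j) Filter.atTop (𝓝 (B * 0)) :=
    (tendsto_pow_atTop_nhds_zero_of_lt_one (r := (1 / 2 : ℝ)) (by norm_num) (by norm_num)).const_mul B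
  rw [mul_zero] at hlim
  exact norm_le_zero_iff.1 (ge_of_tendsto' hlim fun j => iter j z hz)

/-- Given a bounded Gevrey matrix `m` whose leading part squares to `1 / 4`, the eigenline of the
leading part deforms to a line which is invariant under `h ∂ - m` : it is the image of the projector
`1 / 2 - m₀ + N`. -/
theorem exists_exact_line [CompleteSpace 𝔸] {C M : ℝ} (hδ : 0 < δ) (hr₁ : 0 < r₁) (hr : r₁ < r)
    (hC : 0 ≤ C) (hM : 0 ≤ M) {m : ℂ → ℂ → 𝔸} {μ : ℕ → ℂ → 𝔸}
    (hm : GevreyFun (halfstrip θ ε r) (borelDisc θ δ) C M m μ) {P : ℂ → 𝔸}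
    (hPμ : ∀ z, μ 0 z = (1 / 2 : ℂ) • (1 : 𝔸) - P z)
    (hPP : ∀ z ∈ halfstrip θ ε r, P z * P z = P z) :
    ∃ δ' > 0, δ' ≤ δ ∧ ∃ M' ≥ 0, ∃ (N : ℕ → ℂ → 𝔸) (f : ℂ → ℂ → 𝔸), N 0 = 0 ∧
      GevreyFun (halfstrip θ ε r₁) (borelDisc θ δ') 4 M' f N ∧
      ∀ z ∈ halfstrip θ ε r₁, ∀ h ∈ borelDisc θ δ', f z h * (1 - P z) = 0 ∧
        (1 - (P z + f z h)) * ((((ε : ℤ) : ℂ) * h) • deriv (fun z => P z + f z h) z -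
          m z h * (P z + f z h)) = 0 := by
  set H := halfstrip θ ε r with hH
  -- Width is lost twice: from `r` to `r₂` in bounding the derivative of `P` by Cauchy's inequality,
  -- and from `r₂` to `r₁` in solving the matrix equation.
  set r₂ := (r₁ + r) / 2 with hr₂
  have hr₁₂ : r₁ < r₂ := by rw [hr₂]; linarith
  have hr₂r : r₂ < r := by rw [hr₂]; linarith
  have hsub2 : halfstrip θ ε r₂ ⊆ H := halfstrip_mono hr₂r.le
  have hsub1 : halfstrip θ ε r₁ ⊆ halfstrip θ ε r₂ := halfstrip_mono hr₁₂.le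
  have h0D : (0 : ℂ) ∉ borelDisc θ δ := fun h => ne_zero_of_mem_borelDisc hδ h rfl
  have hPd : DifferentiableOn ℂ P H := by
    have : P = fun z => (1 / 2 : ℂ) • (1 : 𝔸) - μ 0 z := by funext z; rw [hPμ]; abel
    rw [this]
    exact (differentiableOn_const _).sub (hm.coeff_hol 0)
  set c₀ : ℝ := ‖(1 : 𝔸)‖ + C with hc₀
  have hc₀0 : 0 ≤ c₀ := by positivity
  have hPb : ∀ z ∈ H, ‖P z‖ ≤ c₀ := fun z hz => by
    have e : P z = (1 / 2 : ℂ) • (1 : 𝔸) - μ 0 z := by rw [hPμ]; abel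
    have h1 : ‖μ 0 z‖ ≤ C := by simpa using (hm.bound z hz).norm_coeff_le hδ hC hM 0
    rw [e]
    refine (norm_sub_le _ _).trans (add_le_add ?_ h1)
    rw [norm_smul]
    have : ‖(1 / 2 : ℂ)‖ ≤ 1 := by norm_num
    exact mul_le_of_le_one_left (norm_nonneg _) this
  set d₀ : ℝ := ‖(1 : 𝔸)‖ + c₀ with hd₀
  have hd₀0 : 0 ≤ d₀ := by positivity
  have hQb : ∀ z ∈ H, ‖1 - P z‖ ≤ d₀ := fun z hz =>
    (norm_sub_le _ _).trans (by rw [hd₀]; gcongr; exact hPb z hz)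
  -- the derivative of the projector
  set P' : ℂ → 𝔸 := fun z => ((ε : ℤ) : ℂ) • deriv P z with hP'
  set ρ := (r - r₂) / 2 with hρ
  have hρ0 : 0 < ρ := by rw [hρ]; linarith
  set p₀ : ℝ := c₀ / ρ with hp₀
  have hp₀0 : 0 ≤ p₀ := by positivity
  have hP'b : ∀ z ∈ halfstrip θ ε r₂, ‖P' z‖ ≤ p₀ := fun z hz => by
    rw [hP', norm_smul, norm_units_cast, one_mul]
    refine norm_deriv_le_of_forall_mem hPd hρ0 ?_ hPb
    refine (Metric.closedBall_subset_ball ?_).trans (ball_subset_halfstrip (sub_le_gap hz))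
    rw [hρ]; linarith
  have hP'd : DifferentiableOn ℂ P' (halfstrip θ ε r₂) :=
    ((hPd.deriv (isOpen_halfstrip θ ε r)).mono hsub2).fun_const_smul _
  have hP'P : ∀ z ∈ H, P' z = P' z * P z + P z * P' z := fun z hz => by
    have hn := (isOpen_halfstrip θ ε r).mem_nhds hz
    have hd := hPd.differentiableAt hn
    have h1 : deriv P z = deriv P z * P z + P z * deriv P z := by
      have h2 := (hd.hasDerivAt.mul hd.hasDerivAt).deriv
      have h3 : (P * P) =ᶠ[𝓝 z] P := Filter.eventually_of_mem hn fun w hw => hPP w hw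
      rw [h3.deriv_eq] at h2
      exact h2
    rw [hP']
    simp only
    conv_lhs => rw [h1]
    rw [smul_add, smul_mul_assoc, mul_smul_comm]
  -- the perturbation
  set K : ℂ → ℂ → 𝔸 := fun z h => h⁻¹ • (m z h - μ 0 z) with hK
  set C₁ := C * M with hC₁
  have hC₁0 : 0 ≤ C₁ := by positivity
  have hKg : GevreyFun (halfstrip θ ε r₂) (borelDisc θ δ) C₁ (2 * M) K fun k => μ (k + 1) :=
    (hm.shift hC hM h0D).mono hsub2 subset_rfl le_rfl hC₁0 (by positivity) le_rfl
  have hM2 : 0 ≤ 2 * M := by positivity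
  have hPd2 := hPd.mono hsub2
  have hQd2 : DifferentiableOn ℂ (fun z => 1 - P z) (halfstrip θ ε r₂) := hPd2.const_sub 1
  have h1d : DifferentiableOn ℂ (fun _ : ℂ => (1 : 𝔸)) (halfstrip θ ε r₂) := differentiableOn_const _
  have hPb2 : ∀ z ∈ halfstrip θ ε r₂, ‖P z‖ ≤ d₀ := fun z hz =>
    (hPb z (hsub2 hz)).trans (by rw [hd₀]; linarith [norm_nonneg (1 : 𝔸)])
  have hQb2 : ∀ z ∈ halfstrip θ ε r₂, ‖1 - P z‖ ≤ d₀ := fun z hz => hQb z (hsub2 hz)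
  have hnQb2 : ∀ z ∈ halfstrip θ ε r₂, ‖-(1 - P z)‖ ≤ d₀ := fun z hz => by
    rw [norm_neg]; exact hQb2 z hz
  have h1b : ∀ z ∈ halfstrip θ ε r₂, ‖(1 : 𝔸)‖ ≤ d₀ := fun z _ => by
    rw [hd₀]; linarith
  set q₀ : ℝ := p₀ + d₀ * p₀ with hq₀
  have hq₀0 : 0 ≤ q₀ := by positivity
  set C₂ : ℝ := q₀ + d₀ * C₁ * d₀ with hC₂
  have hC₂0 : 0 ≤ C₂ := by positivity
  have hpq : p₀ ≤ q₀ := by rw [hq₀]; linarith [mul_nonneg hd₀0 hp₀0]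
  have g₀ := hKg.affine hC₁0 hM2 (p := fun z => (1 - P z) * P' z) (A := fun z => -(1 - P z))
    (B := P) (hQd2.mul hP'd) hQd2.neg hPd2 (p₀ := q₀)
    (fun z hz => (norm_mul_le _ _).trans (by
      rw [hq₀]
      have := mul_le_mul (hQb2 z hz) (hP'b z hz) (norm_nonneg _) hd₀0
      linarith)) hnQb2 hPb2 hq₀0
  have g₁ := hKg.affine hC₁0 hM2 (p := P') (A := fun z => -(1 - P z)) (B := fun _ => 1)
    hP'd hQd2.neg h1d (p₀ := q₀) (fun z hz => (hP'b z hz).trans hpq) hnQb2 h1b hq₀0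
  have g₂ := hKg.affine hC₁0 hM2 (p := fun z => -P' z) (A := fun _ => 1) (B := P)
    hP'd.neg h1d hPd2 (p₀ := q₀) (fun z hz => by rw [norm_neg]; exact (hP'b z hz).trans hpq)
    h1b hPb2 hq₀0
  have g₃ := hKg.affine hC₁0 hM2 (p := P') (A := fun _ => 1) (B := fun _ => 1)
    hP'd h1d h1d (p₀ := q₀) (fun z hz => (hP'b z hz).trans hpq) h1b h1b hq₀0
  obtain ⟨δ₁, hδ₁, hδ₁δ, M', hM', N, f, hN0, hfN, hode⟩ :=
    exists_exact_quad hδ hr₁ hr₁₂ hC₂0 hM2 g₀ g₁ g₂ g₃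
  have hquad : ∀ z h, quad ((1 - P z) * P' z + -(1 - P z) * K z h * P z)
      (P' z + -(1 - P z) * K z h * 1) (-P' z + 1 * K z h * P z) (P' z + 1 * K z h * 1) (f z h) =
      (1 - P z) * P' z - (1 - P z) * K z h * P z + (P' z - (1 - P z) * K z h) * f z h +
        f z h * (K z h * P z - P' z) + f z h * ((P' z + K z h) * f z h) := fun z h => by
    rw [quad]; noncomm_ring
  simp only [hquad] at hode
  -- shrink the disc
  set c : ℝ := 4 * p₀ + 16 * p₀ + (p₀ + C₁ * (c₀ + 4)) + (d₀ * C₁ + 5 * p₀ + 4 * C₁) with hc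
  have hc0 : 0 ≤ c := by positivity
  set δ' : ℝ := min δ₁ (1 / (2 * c + 1)) with hδ'
  have hδ'0 : 0 < δ' := lt_min hδ₁ (by positivity)
  have hδ'c : δ' * c ≤ 1 / 2 := by
    have h1 : δ' * (2 * c + 1) ≤ 1 := by
      rw [← le_div_iff₀ (by positivity)]; exact min_le_right _ _
    linarith
  have hD1 : borelDisc θ δ' ⊆ borelDisc θ δ₁ := borelDisc_mono hδ'0 (min_le_left _ _)
  have hDδ : borelDisc θ δ' ⊆ borelDisc θ δ := borelDisc_mono hδ'0 ((min_le_left _ _).trans hδ₁δ)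
  have hsubr : halfstrip θ ε r₁ ⊆ H := hsub1.trans hsub2
  have hfb : ∀ z ∈ halfstrip θ ε r₁, ∀ h ∈ borelDisc θ δ', ‖f z h‖ ≤ 4 := fun z hz h hh =>
    hfN.norm_le hz (hD1 hh)
  have hKb : ∀ z ∈ halfstrip θ ε r₁, ∀ h ∈ borelDisc θ δ', ‖K z h‖ ≤ C₁ := fun z hz h hh =>
    hKg.norm_le (hsub1 hz) (hDδ hh)
  have hfd : ∀ h ∈ borelDisc θ δ', DifferentiableOn ℂ (fun z => f z h) (halfstrip θ ε r₁) :=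
    fun h hh => DifferentiableOn.slice hfN.hol (hD1 hh)
  have hPd1 := hPd.mono hsubr
  have hPode : ∀ z ∈ H, ∀ h : ℂ, (((ε : ℤ) : ℂ) * h) • deriv P z = h • P' z := fun z _ h => by
    rw [hP', smul_smul, mul_comm]
  have c1 : ∀ z ∈ halfstrip θ ε r₁, ∀ h ∈ borelDisc θ δ', P z * f z h = 0 := by
    intro z hz h hh
    refine eq_zero_of_linear_ode (e := fun z => P z * f z h)
      (g := fun z => -(P' z * (P z * f z h) - P z * f z h * (P' z * f z h) +
        P z * f z h * (P' z - K z h * (P z + f z h)))) (B := c₀ * 4) (c := c) hδ'0 hδ'c hh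
      (hPd1.mul (hfd h hh)) ?_ ?_ ?_ hc0 hz
    · intro z hz
      have hn := (isOpen_halfstrip θ ε r₁).mem_nhds hz
      have dP := (hPd1.differentiableAt hn).hasDerivAt
      have df := ((hfd h hh).differentiableAt hn).hasDerivAt
      rw [(dP.fun_mul df).deriv, ← proj_mul_quad (K := K z h) (N := f z h) (hPP z (hsubr hz))
        (hP'P z (hsubr hz)), smul_add, ← smul_mul_assoc, ← mul_smul_comm, hPode z (hsubr hz),
        hode z hz h (hD1 hh), mul_sub, mul_smul_comm, smul_mul_assoc, smul_sub]
      abel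
    · intro z hz
      exact (norm_mul_le _ _).trans (mul_le_mul (hPb z (hsubr hz)) (hfb z hz h hh)
        (norm_nonneg _) hc₀0)
    · intro z hz
      have b1 := hP'b z (hsub1 hz)
      have b2 := hPb z (hsubr hz)
      have b3 := hfb z hz h hh
      have b4 := hKb z hz h hh
      rw [norm_neg]
      set e := P z * f z h
      have n1 : ‖P' z * e‖ ≤ p₀ * ‖e‖ := (norm_mul_le _ _).trans (by gcongr)
      have n2 : ‖e * (P' z * f z h)‖ ≤ ‖e‖ * (p₀ * 4) :=
        (norm_mul_le _ _).trans (by gcongr; exact (norm_mul_le _ _).trans (by gcongr))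
      have n3 : ‖P' z - K z h * (P z + f z h)‖ ≤ p₀ + C₁ * (c₀ + 4) :=
        (norm_sub_le _ _).trans (add_le_add b1 ((norm_mul_le _ _).trans
          (mul_le_mul b4 ((norm_add_le _ _).trans (add_le_add b2 b3)) (norm_nonneg _) hC₁0)))
      have n4 : ‖e * (P' z - K z h * (P z + f z h))‖ ≤ ‖e‖ * (p₀ + C₁ * (c₀ + 4)) :=
        (norm_mul_le _ _).trans (by gcongr)
      refine (norm_add_le _ _).trans ((add_le_add ((norm_sub_le _ _).trans (add_le_add n1 n2))
        n4).trans ?_)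
      have : 0 ≤ ‖e‖ * (19 * p₀ - 4 * p₀ + (d₀ * C₁ + 5 * p₀ + 4 * C₁)) := by
        have : 0 ≤ 19 * p₀ - 4 * p₀ + (d₀ * C₁ + 5 * p₀ + 4 * C₁) := by
          have : 0 ≤ d₀ * C₁ := by positivity
          linarith
        positivity
      rw [hc]; linarith
  have c2 : ∀ z ∈ halfstrip θ ε r₁, ∀ h ∈ borelDisc θ δ', f z h * (1 - P z) = 0 := by
    intro z hz h hh
    refine eq_zero_of_linear_ode (e := fun z => f z h * (1 - P z))
      (g := fun z => P' z * (f z h * (1 - P z)) - (1 - P z) * K z h * (f z h * (1 - P z)) +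
        f z h * (1 - P z) * P' z + f z h * (P' z + K z h) * (f z h * (1 - P z)))
      (B := 4 * d₀) (c := c) hδ'0 hδ'c hh
      ((hfd h hh).mul (hPd1.const_sub 1)) ?_ ?_ ?_ hc0 hz
    · intro z hz
      have hn := (isOpen_halfstrip θ ε r₁).mem_nhds hz
      have dP := ((hPd1.differentiableAt hn).hasDerivAt).const_sub (1 : 𝔸)
      have df := ((hfd h hh).differentiableAt hn).hasDerivAt
      rw [(df.fun_mul dP).deriv, ← quad_mul_compl (K := K z h) (N := f z h) (hPP z (hsubr hz))
        (hP'P z (hsubr hz)), smul_add, ← smul_mul_assoc, ← mul_smul_comm, smul_neg,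
        hPode z (hsubr hz), hode z hz h (hD1 hh), sub_mul, smul_mul_assoc, mul_neg,
        mul_smul_comm, smul_add, mul_smul_comm h (f z h) (P' z)]
      abel
    · intro z hz
      exact (norm_mul_le _ _).trans (mul_le_mul (hfb z hz h hh) (hQb z (hsubr hz))
        (norm_nonneg _) (by norm_num))
    · intro z hz
      have b1 := hP'b z (hsub1 hz)
      have b2 := hQb z (hsubr hz)
      have b3 := hfb z hz h hh
      have b4 := hKb z hz h hh
      set e := f z h * (1 - P z)
      have n1 : ‖P' z * e‖ ≤ p₀ * ‖e‖ := (norm_mul_le _ _).trans (by gcongr)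
      have n2 : ‖(1 - P z) * K z h * e‖ ≤ d₀ * C₁ * ‖e‖ :=
        (norm_mul_le _ _).trans (by gcongr; exact (norm_mul_le _ _).trans (by gcongr))
      have n3 : ‖e * P' z‖ ≤ ‖e‖ * p₀ := (norm_mul_le _ _).trans (by gcongr)
      have n4 : ‖f z h * (P' z + K z h) * e‖ ≤ 4 * (p₀ + C₁) * ‖e‖ := by
        refine (norm_mul_le _ _).trans ?_
        gcongr
        exact (norm_mul_le _ _).trans (by gcongr; exact (norm_add_le _ _).trans (by gcongr))
      refine (norm_add_le _ _).trans ((add_le_add ((norm_add_le _ _).trans (add_le_add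
        ((norm_sub_le _ _).trans (add_le_add n1 n2)) n3)) n4).trans ?_)
      have : 0 ≤ ‖e‖ * (20 * p₀ + C₁ * (c₀ + 4)) := by positivity
      rw [hc]; linarith
  refine ⟨δ', hδ'0, (min_le_left _ _).trans hδ₁δ, M', hM', N, f, hN0,
    hfN.mono subset_rfl hD1 le_rfl (by norm_num) hM' le_rfl, fun z hz h hh => ⟨c2 z hz h hh, ?_⟩⟩
  have hn := (isOpen_halfstrip θ ε r₁).mem_nhds hz
  have h0 := ne_zero_of_mem_borelDisc hδ'0 hh
  have dP := (hPd1.differentiableAt hn).hasDerivAt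
  have df := ((hfd h hh).differentiableAt hn).hasDerivAt
  have hPPz := hPP z (hsubr hz)
  have hmK : m z h = (1 / 2 : ℂ) • (1 : 𝔸) - P z + h • K z h := by
    rw [hK]
    simp only [smul_smul, mul_inv_cancel₀ h0, one_smul, hPμ]
    abel
  have k1 := compl_mul_quad (K := K z h) hPPz (hP'P z (hsubr hz)) (c1 z hz h hh) (c2 z hz h hh)
  have k2 := compl_mul_self hPPz (c1 z hz h hh) (c2 z hz h hh)
  have k3 : P z * (P z + f z h) = P z := by rw [mul_add, hPPz, c1 z hz h hh, add_zero]
  rw [(dP.fun_add df).deriv, smul_add, hPode z (hsubr hz), hode z hz h (hD1 hh), hmK]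
  set q := (1 - P z) * P' z - (1 - P z) * K z h * P z + (P' z - (1 - P z) * K z h) * f z h +
        f z h * (K z h * P z - P' z) + f z h * ((P' z + K z h) * f z h)
  -- Since `P (P + N) = P`, the terms of order zero collapse to half of `P + N`, which `1 - (P + N)`
  -- annihilates.
  have e : h • P' z + (f z h - h • q) -
      ((1 / 2 : ℂ) • (1 : 𝔸) - P z + h • K z h) * (P z + f z h) =
      h • (P' z - q - K z h * (P z + f z h)) + (1 / 2 : ℂ) • (P z + f z h) := by
    rw [add_mul, sub_mul, smul_mul_assoc, one_mul, k3, smul_mul_assoc]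
    module
  rw [e, mul_add, mul_smul_comm, k1, mul_smul_comm, k2, smul_zero, smul_zero, add_zero]

end Line

/-! ### The scalar Riccati equation -/

section Operations

variable {E E' : Type*} [NormedAddCommGroup E] [NormedSpace ℂ E] [NormedAddCommGroup E']
  [NormedSpace ℂ E'] {U D : Set ℂ} {C C' M : ℝ} {f g : ℂ → ℂ → E} {F G : ℕ → ℂ → E}

lemma GevreyFun.map (H : GevreyFun U D C M f F) (L : E →L[ℂ] E') :
    GevreyFun U D (‖L‖ * C) M (fun z h => L (f z h)) (fun k z => L (F k z)) where
  hol := L.differentiable.comp_differentiableOn H.hol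
  coeff_hol k := L.differentiable.comp_differentiableOn (H.coeff_hol k)
  bound z hz n h hh := by
    rw [rem_map]
    refine (L.le_opNorm _).trans ?_
    calc _ ≤ ‖L‖ * (C * M ^ n * (n ! : ℝ) * ‖h‖ ^ n) := by gcongr; exact H.bound z hz n h hh
      _ = _ := by ring

lemma GevreyFun.add (H : GevreyFun U D C M f F) (H' : GevreyFun U D C' M g G) :
    GevreyFun U D (C + C') M (fun z h => f z h + g z h) (fun k z => F k z + G k z) where
  hol := H.hol.add H'.hol
  coeff_hol k := (H.coeff_hol k).add (H'.coeff_hol k)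
  bound z hz n h hh := by
    have := rem_add (fun k => F k z) (fun k => G k z) h n (f z h) (g z h)
    refine le_trans (le_of_eq (congrArg _ this)) ((norm_add_le _ _).trans ?_)
    calc _ ≤ C * M ^ n * (n ! : ℝ) * ‖h‖ ^ n + C' * M ^ n * (n ! : ℝ) * ‖h‖ ^ n :=
          add_le_add (H.bound z hz n h hh) (H'.bound z hz n h hh)
      _ = _ := by ring

/-- A function of `z` alone has the expansion which consists of its leading term. -/
lemma GevreyFun.of_leading {p : ℂ → E} (hp : DifferentiableOn ℂ p U) (hC : ∀ z ∈ U, ‖p z‖ ≤ C)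
    (hM : 0 ≤ M) : GevreyFun U D C M (fun z _ => p z) (fun k z => if k = 0 then p z else 0) where
  hol := hp.comp (by fun_prop) fun p hp => hp.1
  coeff_hol k := by
    by_cases hk : k = 0
    · simpa [hk] using hp
    · simp [hk]
  bound z hz n h hh := by
    have e : rem (fun k => if k = 0 then p z else 0) h n (p z) = if n = 0 then p z else 0 := by
      induction n with
      | zero => simp
      | succ n ih =>
        rw [rem_succ, ih, if_neg (Nat.succ_ne_zero n)]
        split_ifs with hn <;> simp [hn]
    have hC0 := (norm_nonneg _).trans (hC z hz)
    rw [e]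
    split_ifs with hn
    · subst hn; simpa using hC z hz
    · rw [norm_zero]; positivity

end Operations

/-- The coefficients of the quotient of two formal series, the denominator having leading
coefficient `1`. -/
noncomputable def quotCoeff (u v : ℕ → ℂ) : ℕ → ℂ :=
  strongSeq fun n q => u n - ∑ k ∈ Finset.range n, v (n - k) * q k

lemma quotCoeff_eq (u v : ℕ → ℂ) (n : ℕ) :
    quotCoeff u v n = u n - ∑ k ∈ Finset.range n, v (n - k) * quotCoeff u v k := by
  rw [quotCoeff, strongSeq_eq, ← quotCoeff]
  congr 1
  exact Finset.sum_congr rfl fun k hk => by simp only [if_pos (Finset.mem_range.1 hk)]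

lemma conv_quotCoeff {u v : ℕ → ℂ} (hv : v 0 = 1) : conv v (quotCoeff u v) = u := by
  ext n
  rw [conv, Finset.sum_range_succ, Nat.sub_self, hv, one_mul, quotCoeff_eq u v n]
  ring

/-- Enlarging the rate by `L = 1 + 6 A` gains a factor `L⁻¹` in every term of the recursion, because
`n - k ≥ 1` there. The sum is then at most `6 A² / L ≤ A` times the weight, which closes the
induction with constant `2 A`. -/
lemma norm_quotCoeff_le {u v : ℕ → ℂ} {A M : ℝ} (hM : 0 ≤ M)
    (hu : ∀ n, ‖u n‖ ≤ A * M ^ n * (n ! : ℝ)) (hv : ∀ n, ‖v n‖ ≤ A * M ^ n * (n ! : ℝ)) (n : ℕ) :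
    ‖quotCoeff u v n‖ ≤ 2 * A * (M * (1 + 6 * A)) ^ n * (n ! : ℝ) := by
  have hA : 0 ≤ A := by simpa using (norm_nonneg _).trans (hu 0)
  set L := 1 + 6 * A with hL
  have hL0 : 0 < L := by positivity
  have hL1 : 1 ≤ L := by rw [hL]; linarith
  induction n using Nat.strong_induction_on with
  | _ n ih =>
    rw [quotCoeff_eq]
    have h1 : ‖∑ k ∈ Finset.range n, v (n - k) * quotCoeff u v k‖ ≤
        L⁻¹ * (3 * A * (2 * A) * (M * L) ^ n * (n ! : ℝ)) := by
      calc _ ≤ ∑ k ∈ Finset.range n, L⁻¹ * ((A * (M * L) ^ (n - k) * ((n - k)! : ℝ)) *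
            (2 * A * (M * L) ^ k * (k ! : ℝ))) := by
            refine (norm_sum_le _ _).trans (Finset.sum_le_sum fun k hk => ?_)
            have hk' := Finset.mem_range.1 hk
            have e : M ^ (n - k) ≤ L⁻¹ * (M * L) ^ (n - k) := by
              rw [mul_pow]
              have : L ≤ L ^ (n - k) := le_self_pow₀ hL1 (Nat.sub_pos_of_lt hk').ne'
              calc M ^ (n - k) = L⁻¹ * (M ^ (n - k) * L) := by field_simp
                _ ≤ _ := by gcongr
            rw [norm_mul]
            calc _ ≤ (A * M ^ (n - k) * ((n - k)! : ℝ)) * (2 * A * (M * L) ^ k * (k ! : ℝ)) :=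
                  mul_le_mul (hv _) (ih k hk') (norm_nonneg _) (by positivity)
              _ ≤ (A * (L⁻¹ * (M * L) ^ (n - k)) * ((n - k)! : ℝ)) *
                  (2 * A * (M * L) ^ k * (k ! : ℝ)) := by gcongr
              _ = _ := by ring
        _ ≤ ∑ k ∈ Finset.range (n + 1), L⁻¹ * ((A * (M * L) ^ (n - k) * ((n - k)! : ℝ)) *
            (2 * A * (M * L) ^ k * (k ! : ℝ))) :=
            Finset.sum_le_sum_of_subset_of_nonneg (Finset.range_mono (Nat.le_succ n))
              fun _ _ _ => by positivity
        _ ≤ _ := by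
            rw [← Finset.mul_sum]
            gcongr
            exact sum_gevrey_le hA (by positivity) (by positivity) n
    have h2 : ‖u n‖ ≤ A * (M * L) ^ n * (n ! : ℝ) := by
      refine (hu n).trans ?_
      gcongr
      exact le_mul_of_one_le_right hM hL1
    have h3 : L⁻¹ * (3 * A * (2 * A) * (M * L) ^ n * (n ! : ℝ)) ≤ A * (M * L) ^ n * (n ! : ℝ) := by
      rw [inv_mul_le_iff₀ hL0]
      have : 0 ≤ A * (M * L) ^ n * (n ! : ℝ) := by positivity
      rw [hL] at *
      nlinarith
    refine (norm_sub_le _ _).trans ((add_le_add h2 (h1.trans h3)).trans (le_of_eq ?_))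
    ring

/-- The product formula for `u = v (u / v)` is solved for the remainder of the quotient, using the
lower bound on `v` and the bounds on the quotient's formal coefficients. -/
lemma GevreyFun.div {θ δ : ℝ} (hδ : 0 < δ) {U : Set ℂ} {A M : ℝ} {u v : ℂ → ℂ → ℂ}
    {u' v' : ℕ → ℂ → ℂ} (hA : 0 ≤ A) (hM : 0 ≤ M) (Hu : GevreyFun U (borelDisc θ δ) A M u u')
    (Hv : GevreyFun U (borelDisc θ δ) A M v v') (hv0 : ∀ z ∈ U, v' 0 z = 1)
    (hv : ∀ z ∈ U, ∀ h ∈ borelDisc θ δ, 1 / 2 ≤ ‖v z h‖) :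
    GevreyFun U (borelDisc θ δ) (2 * (A + 6 * A ^ 2)) (M * (1 + 6 * A)) (fun z h => u z h / v z h)
      (fun k z => quotCoeff (fun j => u' j z) (fun j => v' j z) k) where
  hol := (Hu.hol.mul (Hv.hol.inv fun (p : ℂ × ℂ) (hp : p ∈ U ×ˢ borelDisc θ δ) h => by
    have := hv p.1 hp.1 p.2 hp.2
    rw [show v p.1 p.2 = 0 from h] at this
    norm_num at this)).congr fun p _ => div_eq_mul_inv (u p.1 p.2) (v p.1 p.2)
  coeff_hol k := by
    induction k using Nat.strong_induction_on with
    | _ k ih =>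
      have e : (fun z => quotCoeff (fun j => u' j z) (fun j => v' j z) k) = fun z => u' k z -
          ∑ i ∈ Finset.range k, v' (k - i) z *
            quotCoeff (fun j => u' j z) (fun j => v' j z) i := by
        ext z; exact quotCoeff_eq _ _ k
      rw [e]
      exact (Hu.coeff_hol k).sub (DifferentiableOn.fun_sum fun i hi =>
        (Hv.coeff_hol _).mul (ih i (Finset.mem_range.1 hi)))
  bound z hz n h hh := by
    have hvz := hv z hz h hh
    have hvz0 : v z h ≠ 0 := fun h' => by rw [h'] at hvz; norm_num at hvz
    set q := quotCoeff (fun j => u' j z) (fun j => v' j z) with hq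
    have hL1 : M ≤ M * (1 + 6 * A) := le_mul_of_one_le_right hM (by linarith)
    have hM' : 0 ≤ M * (1 + 6 * A) := by positivity
    have hb := norm_quotCoeff_le hM ((Hu.bound z hz).norm_coeff_le hδ hA hM)
      ((Hv.bound z hz).norm_coeff_le hδ hA hM)
    have key := rem_mul (fun j => v' j z) q h n (v z h) (u z h / v z h)
    rw [hq, conv_quotCoeff (hv0 z hz), ← hq, mul_div_cancel₀ _ hvz0] at key
    have h1 := ((Hu.mono subset_rfl subset_rfl le_rfl hA hM hL1).bound z hz) n h hh
    have h2 := norm_sum_rem_mul_le (G := q) (n := n) hM'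
      (fun j _ => ((Hv.mono subset_rfl subset_rfl le_rfl hA hM hL1).bound z hz) j h hh)
      fun j _ => hb j
    have h3 : ‖v z h‖ * ‖rem q h n (u z h / v z h)‖ ≤
        (A + 3 * A * (2 * A)) * (M * (1 + 6 * A)) ^ n * (n ! : ℝ) * ‖h‖ ^ n := by
      rw [← norm_mul, ← sub_eq_iff_eq_add.2 key]
      refine (norm_sub_le _ _).trans ((add_le_add h1 h2).trans (le_of_eq ?_))
      ring
    have h4 := mul_le_mul_of_nonneg_right hvz (norm_nonneg (rem q h n (u z h / v z h)))
    linarith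

/-- The `2 × 2` matrix `[[β / 2, γ], [-α, -β / 2]]`, whose projective flow is the Riccati
equation. -/
noncomputable def riccatiMatrix (α β γ : ℂ) : (ℂ × ℂ) →L[ℂ] (ℂ × ℂ) :=
  β • ((1 / 2 : ℂ) • (ContinuousLinearMap.fst ℂ ℂ ℂ).prod (-ContinuousLinearMap.snd ℂ ℂ ℂ)) +
    γ • (ContinuousLinearMap.snd ℂ ℂ ℂ).prod 0 -
    α • (0 : (ℂ × ℂ) →L[ℂ] ℂ).prod (ContinuousLinearMap.fst ℂ ℂ ℂ)

lemma riccatiMatrix_apply (α β γ : ℂ) (X : ℂ × ℂ) :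
    riccatiMatrix α β γ X = (β / 2 * X.1 + γ * X.2, -(α * X.1) - β / 2 * X.2) := by
  simp only [riccatiMatrix]
  ext
  · simp; ring
  · simp; ring

lemma GevreyFun.riccatiMatrix {U D : Set ℂ} {C M : ℝ} {α β γ : ℂ → ℂ → ℂ} {α' β' γ' : ℕ → ℂ → ℂ}
    (hα : GevreyFun U D C M α α') (hβ : GevreyFun U D C M β β') (hγ : GevreyFun U D C M γ γ') :
    ∃ c : ℝ, 0 ≤ c ∧ GevreyFun U D (c * C) M (fun z h => WKB.riccatiMatrix (α z h) (β z h) (γ z h))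
      (fun k z => WKB.riccatiMatrix (α' k z) (β' k z) (γ' k z)) := by
  set L₁ := ContinuousLinearMap.toSpanSingleton ℂ
    ((1 / 2 : ℂ) • (ContinuousLinearMap.fst ℂ ℂ ℂ).prod (-ContinuousLinearMap.snd ℂ ℂ ℂ))
  set L₂ := ContinuousLinearMap.toSpanSingleton ℂ
    ((ContinuousLinearMap.snd ℂ ℂ ℂ).prod (0 : (ℂ × ℂ) →L[ℂ] ℂ))
  set L₃ := -ContinuousLinearMap.toSpanSingleton ℂ
    ((0 : (ℂ × ℂ) →L[ℂ] ℂ).prod (ContinuousLinearMap.fst ℂ ℂ ℂ))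
  refine ⟨‖L₁‖ + ‖L₂‖ + ‖L₃‖, by positivity, ?_⟩
  have := ((hβ.map L₁).add (hγ.map L₂)).add (hα.map L₃)
  rw [add_mul, add_mul]
  have e : ∀ α β γ : ℂ, WKB.riccatiMatrix α β γ = L₁ β + L₂ γ + L₃ α := fun α β γ => by
    simp [WKB.riccatiMatrix, L₁, L₂, L₃, sub_eq_add_neg]
  simpa only [e] using this

/-- The exact solution in the coordinate `z`, on an open set on which the leading-order solution is
bounded. -/
theorem exists_exact_riccati {θ : ℝ} {ε : ℤˣ} {r r₁ δ C M : ℝ} (hδ : 0 < δ) (hr₁ : 0 < r₁)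
    (hr : r₁ < r) (hC : 0 ≤ C) (hM : 0 ≤ M) {α β γ : ℂ → ℂ → ℂ} {α' β' γ' : ℕ → ℂ → ℂ}
    (hα : GevreyFun (halfstrip θ ε r) (borelDisc θ δ) C M α α')
    (hβ : GevreyFun (halfstrip θ ε r) (borelDisc θ δ) C M β β')
    (hγ : GevreyFun (halfstrip θ ε r) (borelDisc θ δ) C M γ γ')
    {w : ℂ → ℂ}
    (hw : DifferentiableOn ℂ w (halfstrip θ ε r))
    (hαw : ∀ z ∈ halfstrip θ ε r, α' 0 z * w z = (1 - β' 0 z) / 2)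
    (hγw : ∀ z ∈ halfstrip θ ε r, w z * ((1 + β' 0 z) / 2) = -γ' 0 z) {K : Set ℂ} (hKr : K ⊆ halfstrip θ ε r₁) {R : ℝ} (hR : ∀ z ∈ K, ‖w z‖ ≤ R) :
    ∃ δ' > 0, δ' ≤ δ ∧ ∃ C' ≥ 0, ∃ M' ≥ 0, ∃ (q : ℕ → ℂ → ℂ) (f : ℂ → ℂ → ℂ),
      (∀ z ∈ K, q 0 z = w z) ∧ GevreyFun K (borelDisc θ δ') C' M' f q ∧
      ∀ z ∈ K, ∀ h ∈ borelDisc θ δ', ((ε : ℤ) : ℂ) * h * deriv (fun z => f z h) z =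
        α z h * f z h ^ 2 + β z h * f z h + γ z h := by
  obtain ⟨c, hc, hm⟩ := hα.riccatiMatrix hβ hγ
  set P : ℂ → (ℂ × ℂ) →L[ℂ] (ℂ × ℂ) := fun z =>
    (1 / 2 : ℂ) • (1 : (ℂ × ℂ) →L[ℂ] (ℂ × ℂ)) - riccatiMatrix (α' 0 z) (β' 0 z) (γ' 0 z) with hP
  -- `P` has rank one with image spanned by `(w, 1)`, the eigenvector of the leading matrix for the
  -- eigenvalue `-1/2`.
  have hPX : ∀ z ∈ halfstrip θ ε r, ∀ X : ℂ × ℂ,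
      P z X = (α' 0 z * X.1 + (1 + β' 0 z) / 2 * X.2) • (w z, (1 : ℂ)) := fun z hz X => by
    have e : P z X = (1 / 2 : ℂ) • X - riccatiMatrix (α' 0 z) (β' 0 z) (γ' 0 z) X := by simp [hP]
    rw [e, riccatiMatrix_apply]
    ext
    · simp only [Prod.fst_sub, Prod.smul_fst, smul_eq_mul]
      linear_combination -X.1 * hαw z hz - X.2 * hγw z hz
    · simp only [Prod.snd_sub, Prod.smul_snd, smul_eq_mul]
      ring
  have hPw : ∀ z ∈ halfstrip θ ε r, P z (w z, 1) = (w z, 1) := fun z hz => by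
    rw [hPX z hz]
    have : α' 0 z * w z + (1 + β' 0 z) / 2 * 1 = 1 := by rw [hαw z hz]; ring
    simp only [this, one_smul]
  obtain ⟨δ₁, hδ₁, hδ₁δ, M', hM', N, f, hN0, hf, hline⟩ := exists_exact_line hδ hr₁ hr
    (mul_nonneg hc hC) hM hm (P := P) (fun z => by rw [hP]; simp) fun z hz => by
      refine ContinuousLinearMap.ext fun X => ?_
      change P z (P z X) = P z X
      rw [hPX z hz X, map_smul, hPw z hz]
  have hKr' : K ⊆ halfstrip θ ε r := hKr.trans (halfstrip_mono hr.le)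
  set R' := max R 1 with hR'
  have hR'0 : 0 ≤ R' := zero_le_one.trans (le_max_right _ _)
  have hwR : ∀ z ∈ K, ‖(w z, (1 : ℂ))‖ ≤ R' := fun z hz => by
    rw [Prod.norm_mk, norm_one]; exact max_le_max (hR z hz) le_rfl
  have hwd : DifferentiableOn ℂ (fun z => (w z, (1 : ℂ))) K :=
    (hw.mono hKr').prodMk (differentiableOn_const _)
  -- The series of the perturbation starts at order one, so its norm is at most `4 M' ‖h‖`. On this
  -- disc it moves the second component of `(w, 1)` by at most `1 / 2`.
  set δ' := min δ₁ (1 / (8 * M' * R' + 1)) with hδ'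
  have hδ'0 : 0 < δ' := by rw [hδ']; positivity
  have hδ'1 : 4 * M' * δ' * R' ≤ 1 / 2 := by
    have h1 : δ' ≤ 1 / (8 * M' * R' + 1) := min_le_right _ _
    rw [le_div_iff₀ (by positivity)] at h1
    nlinarith
  have hDD : borelDisc θ δ' ⊆ borelDisc θ δ₁ := borelDisc_mono hδ'0 (min_le_left _ _)
  have hNw : GevreyFun K (borelDisc θ δ') (4 * R') M' (fun z h => f z h (w z, 1))
      (fun k z => N k z (w z, 1)) := {
    hol := (hf.hol.mono (prod_mono hKr hDD)).clm_apply
      (hwd.comp differentiableOn_fst fun p hp => hp.1)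
    coeff_hol := fun k => ((hf.coeff_hol k).mono hKr).clm_apply hwd
    bound := fun z hz n h hh => by
      have e := rem_map (ContinuousLinearMap.apply ℂ (ℂ × ℂ) (w z, (1 : ℂ))) (fun k => N k z) h n
        (f z h)
      refine le_trans (le_of_eq (congrArg _ e)) (((rem (fun k => N k z) h n (f z h)).le_opNorm
        (w z, 1)).trans ?_)
      refine (mul_le_mul (hf.bound z (hKr hz) n h (hDD hh)) (hwR z hz) (norm_nonneg _)
        (by positivity)).trans (le_of_eq ?_)
      ring }
  have hy := (GevreyFun.of_leading (D := borelDisc θ δ') hwd hwR hM').add hNw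
  set A := R' + 4 * R' with hA
  have hA0 : 0 ≤ A := by positivity
  set y : ℂ → ℂ → ℂ × ℂ := fun z h => (w z, (1 : ℂ)) + f z h (w z, 1) with hydef
  have hu := (hy.map (ContinuousLinearMap.fst ℂ ℂ ℂ)).mono subset_rfl subset_rfl
    (mul_le_of_le_one_left hA0 (ContinuousLinearMap.norm_fst_le _ _ _)) hA0 hM' le_rfl
  have hv := (hy.map (ContinuousLinearMap.snd ℂ ℂ ℂ)).mono subset_rfl subset_rfl
    (mul_le_of_le_one_left hA0 (ContinuousLinearMap.norm_snd_le _ _ _)) hA0 hM' le_rfl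
  have hv2 : ∀ z ∈ K, ∀ h ∈ borelDisc θ δ', 1 / 2 ≤ ‖(y z h).2‖ := fun z hz h hh => by
    have h1 : ‖f z h‖ ≤ 4 * M' * δ' := by
      have h2 := hf.bound z (hKr hz) 1 h (hDD hh)
      have h3 : rem (fun k => N k z) h 1 (f z h) = f z h := by
        rw [rem_succ, rem_zero, hN0]; simp
      rw [h3] at h2
      have h4 : ‖h‖ ≤ δ' := (norm_lt_of_mem_borelDisc hδ'0 hh).le
      simp only [pow_one, Nat.factorial_one, Nat.cast_one, mul_one] at h2
      exact h2.trans (by gcongr)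
    have h2 : ‖(f z h (w z, 1)).2‖ ≤ 1 / 2 := by
      refine (norm_snd_le _).trans (((f z h).le_opNorm _).trans (le_trans ?_ hδ'1))
      exact mul_le_mul h1 (hwR z hz) (norm_nonneg _) (by positivity)
    have h3 := norm_sub_le_norm_add (1 : ℂ) (f z h (w z, 1)).2
    rw [norm_one] at h3
    have h4 : (y z h).2 = 1 + (f z h (w z, 1)).2 := rfl
    rw [h4]
    linarith
  have hq := GevreyFun.div hδ'0 hA0 hM' hu hv (fun z hz => by simp [hN0]) hv2
  refine ⟨δ', hδ'0, (min_le_left _ _).trans hδ₁δ, _, by positivity, _, by positivity, _, _, ?_, hq, ?_⟩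
  · intro z hz
    rw [quotCoeff_eq]
    simp [hN0]
  · intro z hz h hh
    obtain ⟨l1, l2⟩ := hline z (hKr hz) h (hDD hh)
    have hzr := hKr' hz
    have hn := (isOpen_halfstrip θ ε r₁).mem_nhds (hKr hz)
    have hPd : DifferentiableAt ℂ P z :=
      ((differentiableOn_const _).sub (hm.coeff_hol 0)).differentiableAt
        ((isOpen_halfstrip θ ε r).mem_nhds hzr)
    have hfd : DifferentiableAt ℂ (fun z => f z h) z :=
      (DifferentiableOn.slice hf.hol (hDD hh)).differentiableAt hn
    -- Because `N (1 - P) = 0`, the map `P + N` factors through `P`; its image is the line spanned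
    -- by `y = (P + N)(w, 1)`.
    have hPf : ∀ X : ℂ × ℂ, ∃ c : ℂ, P z X + f z h X = c • y z h := fun X => by
      have h1 : f z h (X - P z X) = 0 := congrArg (fun L : (ℂ × ℂ) →L[ℂ] (ℂ × ℂ) => L X) l1
      rw [map_sub, sub_eq_zero] at h1
      refine ⟨α' 0 z * X.1 + (1 + β' 0 z) / 2 * X.2, ?_⟩
      rw [h1, hPX z hzr X, map_smul, ← smul_add]
    have hyd : HasDerivAt (fun z => y z h) (deriv (fun z => P z + f z h) z (w z, 1) +
        (P z + f z h) (deriv w z, 0)) z := by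
      have d1 := ((hPd.fun_add hfd).hasDerivAt).clm_apply
        ((((hw.differentiableAt ((isOpen_halfstrip θ ε r).mem_nhds hzr)).hasDerivAt).prodMk
          (hasDerivAt_const z (1 : ℂ))))
      refine d1.congr_of_eventuallyEq ?_
      filter_upwards [(isOpen_halfstrip θ ε r).mem_nhds hzr] with x hx
      change _ = P x (w x, 1) + f x h (w x, 1)
      rw [hPw x hx]
    set T : ℂ × ℂ := (((ε : ℤ) : ℂ) * h) • deriv (fun z => P z + f z h) z (w z, 1) -
      riccatiMatrix (α z h) (β z h) (γ z h) (y z h) with hT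
    have hT1 : T - (P z T + f z h T) = 0 := by
      have h1 : (((ε : ℤ) : ℂ) * h) • deriv (fun z => P z + f z h) z (w z, 1) -
          riccatiMatrix (α z h) (β z h) (γ z h) (P z (w z, 1) + f z h (w z, 1)) = T := by
        rw [hPw z hzr]
      rw [← h1]
      exact congrArg (fun L : (ℂ × ℂ) →L[ℂ] (ℂ × ℂ) => L (w z, 1)) l2
    obtain ⟨c₁, hc₁⟩ := hPf T
    obtain ⟨c₂, hc₂⟩ := hPf (deriv w z, 0)
    -- Invariance of the line gives the linear system up to a multiple of `y`. This multiple drops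
    -- out of the equation for the ratio of the components.
    have hyode : (((ε : ℤ) : ℂ) * h) • deriv (fun z => y z h) z =
        riccatiMatrix (α z h) (β z h) (γ z h) (y z h) + (c₁ + ((ε : ℤ) : ℂ) * h * c₂) • y z h := by
      have h1 : T = c₁ • y z h := by rw [← hc₁, ← sub_eq_zero, hT1]
      have h2 : (P z + f z h) (deriv w z, 0) = c₂ • y z h := hc₂
      rw [hyd.deriv, smul_add, h2, add_smul, ← h1, hT, smul_smul]
      abel
    rw [riccatiMatrix_apply] at hyode
    have d1 : HasDerivAt (fun z => (y z h).1) (deriv (fun z => y z h) z).1 z :=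
      hyd.differentiableAt.hasDerivAt.fst
    have d2 : HasDerivAt (fun z => (y z h).2) (deriv (fun z => y z h) z).2 z :=
      hyd.differentiableAt.hasDerivAt.snd
    have hv0 : (y z h).2 ≠ 0 := fun h0 => by
      have := hv2 z hz h hh
      rw [h0] at this
      norm_num at this
    have e1 := congrArg Prod.fst hyode
    have e2 := congrArg Prod.snd hyode
    simp only [Prod.smul_fst, Prod.smul_snd, Prod.fst_add, Prod.snd_add, smul_eq_mul] at e1 e2
    have d3 := (d1.fun_div d2 hv0).deriv
    change _ * deriv (fun z => (y z h).1 / (y z h).2) z = α z h * ((y z h).1 / (y z h).2) ^ 2 +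
      β z h * ((y z h).1 / (y z h).2) + γ z h
    rw [d3]
    field_simp
    linear_combination (y z h).2 * e1 - (y z h).1 * e2

/-! ### The formal Riccati equation -/

/-- The formal series `A F² + B F + C`. -/
noncomputable def formalRiccati (A B C F : ℕ → ℂ) : PowerSeries ℂ :=
  PowerSeries.mk A * PowerSeries.mk F ^ 2 + PowerSeries.mk B * PowerSeries.mk F + PowerSeries.mk C

/-- The difference of the two quadratic expressions is `(F - F') (A (F + F') + B)`, and `F - F'` is
divisible by `X ^ (n + 1)`. The next coefficient is thus governed by the linearisation at the
leading term, both for existence and for uniqueness. -/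
lemma coeff_formalRiccati_sub {A B C F F' : ℕ → ℂ} {n : ℕ} (h : ∀ j ≤ n, F j = F' j) :
    PowerSeries.coeff (n + 1) (formalRiccati A B C F) -
      PowerSeries.coeff (n + 1) (formalRiccati A B C F') =
      (2 * A 0 * F 0 + B 0) * (F (n + 1) - F' (n + 1)) := by
  have hd : PowerSeries.mk F = PowerSeries.mk F' +
      PowerSeries.X ^ (n + 1) * PowerSeries.mk (fun k => F (k + (n + 1)) - F' (k + (n + 1))) := by
    ext k
    rw [map_add, PowerSeries.coeff_X_pow_mul', PowerSeries.coeff_mk, PowerSeries.coeff_mk]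
    split_ifs with hk
    · rw [PowerSeries.coeff_mk, Nat.sub_add_cancel hk]; ring
    · rw [h k (by omega), add_zero]
  have e : formalRiccati A B C F - formalRiccati A B C F' = PowerSeries.X ^ (n + 1) *
      (PowerSeries.mk (fun k => F (k + (n + 1)) - F' (k + (n + 1))) *
        (PowerSeries.mk A * (PowerSeries.mk F + PowerSeries.mk F') + PowerSeries.mk B)) := by
    rw [formalRiccati, formalRiccati]
    linear_combination (PowerSeries.mk A * (PowerSeries.mk F + PowerSeries.mk F') +
      PowerSeries.mk B) * hd
  rw [← map_sub, e, PowerSeries.coeff_X_pow_mul', if_pos le_rfl, Nat.sub_self,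
    PowerSeries.coeff_zero_eq_constantCoeff_apply]
  simp only [map_mul, map_add, PowerSeries.constantCoeff_mk, zero_add]
  rw [← h 0 (Nat.zero_le _)]
  ring

lemma differentiableOn_coeff_mul {p q : ℂ → PowerSeries ℂ} {W : Set ℂ} {n : ℕ}
    (hp : ∀ k, DifferentiableOn ℂ (fun x => PowerSeries.coeff k (p x)) W)
    (hq : ∀ k, DifferentiableOn ℂ (fun x => PowerSeries.coeff k (q x)) W) :
    DifferentiableOn ℂ (fun x => PowerSeries.coeff n (p x * q x)) W := by
  simp only [PowerSeries.coeff_mul]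
  exact DifferentiableOn.fun_sum fun i _ => (hp _).mul (hq _)

lemma differentiableOn_coeff_formalRiccati {A B C F : ℕ → ℂ → ℂ} {W : Set ℂ} {n : ℕ}
    (hA : ∀ k, DifferentiableOn ℂ (A k) W) (hB : ∀ k, DifferentiableOn ℂ (B k) W)
    (hC : ∀ k, DifferentiableOn ℂ (C k) W) (hF : ∀ k, DifferentiableOn ℂ (F k) W) :
    DifferentiableOn ℂ (fun x => PowerSeries.coeff n (formalRiccati (fun k => A k x)
      (fun k => B k x) (fun k => C k x) (fun k => F k x))) W := by
  have h : ∀ {G : ℕ → ℂ → ℂ}, (∀ k, DifferentiableOn ℂ (G k) W) → ∀ k,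
      DifferentiableOn ℂ (fun x => PowerSeries.coeff k (PowerSeries.mk fun k => G k x)) W :=
    fun hG k => by simpa only [PowerSeries.coeff_mk] using hG k
  simp only [formalRiccati, map_add, pow_two]
  exact ((differentiableOn_coeff_mul (h hA) fun k => differentiableOn_coeff_mul (h hF) (h hF)).add
    (differentiableOn_coeff_mul (h hB) (h hF))).add (h hC n)

/-- Formal solutions of `ε h ∂ F = A F² + B F + C` are determined by the leading term. -/
lemma formal_unique {K : Set ℂ} (hK : IsOpen K) {e : ℂ} {A B C F F' : ℕ → ℂ → ℂ}
    (hF : ∀ z ∈ K, PowerSeries.X * PowerSeries.mk (fun k => e * deriv (F k) z) =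
      formalRiccati (fun k => A k z) (fun k => B k z) (fun k => C k z) (fun k => F k z))
    (hF' : ∀ z ∈ K, PowerSeries.X * PowerSeries.mk (fun k => e * deriv (F' k) z) =
      formalRiccati (fun k => A k z) (fun k => B k z) (fun k => C k z) (fun k => F' k z))
    (h0 : EqOn (F 0) (F' 0) K) (hne : ∀ z ∈ K, 2 * A 0 z * F 0 z + B 0 z ≠ 0) (k : ℕ) :
    EqOn (F k) (F' k) K := by
  induction k using Nat.strong_induction_on with
  | _ k ih =>
    rcases k with _ | n
    · exact h0
    · intro z hz
      have h1 := coeff_formalRiccati_sub (A := fun k => A k z) (B := fun k => B k z)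
        (C := fun k => C k z) (F := fun k => F k z) (F' := fun k => F' k z) (n := n)
        fun j hj => ih j (Nat.lt_succ_of_le hj) hz
      have h2 : deriv (F n) z = deriv (F' n) z :=
        Filter.EventuallyEq.deriv_eq (Filter.eventuallyEq_of_mem (hK.mem_nhds hz)
          (ih n (Nat.lt_succ_self n)))
      rw [← hF z hz, ← hF' z hz, PowerSeries.coeff_succ_X_mul, PowerSeries.coeff_succ_X_mul,
        PowerSeries.coeff_mk, PowerSeries.coeff_mk, h2, sub_self] at h1
      exact sub_eq_zero.1 ((mul_eq_zero.1 h1.symm).resolve_left (hne z hz))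

/-! ### The leading-order solution and the formal solution it generates -/

section LeadingOrder

variable {W : Set ℂ} {A B C : ℕ → ℂ → ℂ} {s : ℂ → ℂ} {ε : ℤˣ}

/-- Away from the zeros of `a₀` this is the quadratic formula. At a zero the sign is `+` and `√D₀ =
b₀ ≠ 0`, so the equation is linear. In both cases the linearisation is `±√D₀`, hence nonzero. -/
lemma leadingOrder_spec {x : ℂ} (hsq : s x ^ 2 = discriminant A B C x) (hs : s x ≠ 0)
    (hneg : ε = -1 → A 0 x ≠ 0) (hpos : ε = 1 → A 0 x = 0 → s x = B 0 x) :
    A 0 x * leadingOrder ε s A B C x ^ 2 + B 0 x * leadingOrder ε s A B C x + C 0 x = 0 ∧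
      2 * A 0 x * leadingOrder ε s A B C x + B 0 x = ((ε : ℤ) : ℂ) * s x := by
  have hε := units_cast_sq ε
  rw [discriminant] at hsq
  by_cases h0 : A 0 x = 0
  · have h1 : ε = 1 := (Int.units_eq_one_or ε).resolve_right fun h => hneg h h0
    have h2 := hpos h1 h0
    have h3 : B 0 x ≠ 0 := h2 ▸ hs
    rw [leadingOrder, if_pos h0, h0, h1, h2]
    constructor
    · field_simp; ring
    · simp
  · rw [leadingOrder, if_neg h0]
    constructor
    · field_simp
      linear_combination s x ^ 2 * hε + hsq
    · field_simp; ring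

lemma differentiableOn_leadingOrder (hW : IsOpen W) (hA : DifferentiableOn ℂ (A 0) W)
    (hB : DifferentiableOn ℂ (B 0) W) (hC : DifferentiableOn ℂ (C 0) W)
    (hs : DifferentiableOn ℂ s W) (hsq : ∀ x ∈ W, s x ^ 2 = discriminant A B C x)
    (hs0 : ∀ x ∈ W, s x ≠ 0) (hneg : ε = -1 → ∀ x ∈ W, A 0 x ≠ 0)
    (hpos : ε = 1 → ∀ x ∈ W, A 0 x = 0 → s x = B 0 x) :
    DifferentiableOn ℂ (leadingOrder ε s A B C) W := by
  intro x hx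
  refine DifferentiableAt.differentiableWithinAt ?_
  have hn := hW.mem_nhds hx
  have dA := hA.differentiableAt hn
  have dB := hB.differentiableAt hn
  have dC := hC.differentiableAt hn
  have ds := hs.differentiableAt hn
  by_cases h0 : A 0 x = 0
  · have h1 : ε = 1 := (Int.units_eq_one_or ε).resolve_right fun h => hneg h x hx h0
    have h2 : B 0 x + s x ≠ 0 := by
      rw [← hpos h1 x hx h0, ← two_mul]; exact mul_ne_zero two_ne_zero (hs0 x hx)
    -- The rationalised quadratic formula is regular at a zero of `a₀`, where its denominator is `2
    -- √D₀`.
    have d : DifferentiableAt ℂ (fun y => -2 * C 0 y / (B 0 y + s y)) x :=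
      ((dC.const_mul _).div (dB.add ds) h2)
    refine d.congr_of_eventuallyEq ?_
    filter_upwards [hn, (dB.add ds).continuousAt.eventually_ne h2] with y hy hy2
    obtain ⟨e1, e2⟩ := leadingOrder_spec (C := C) (hsq y hy) (hs0 y hy) (fun h => hneg h y hy)
      fun h => hpos h y hy
    rw [h1] at e2
    have hy3 : B 0 y + s y ≠ 0 := hy2
    rw [eq_div_iff hy3]
    rw [h1] at e1 ⊢
    simp only [Units.val_one, Int.cast_one, one_mul] at e2
    linear_combination 2 * e1 - leadingOrder 1 s A B C y * e2
  · have d : DifferentiableAt ℂ (fun y => (-B 0 y + ((ε : ℤ) : ℂ) * s y) / (2 * A 0 y)) x :=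
      (dB.neg.add (ds.const_mul _)).div (dA.const_mul 2) (mul_ne_zero two_ne_zero h0)
    refine d.congr_of_eventuallyEq ?_
    filter_upwards [dA.continuousAt.eventually_ne h0] with y hy
    rw [leadingOrder, if_neg hy]

/-- The formal solution with the given leading order. -/
noncomputable def formalSolution (ε : ℤˣ) (s : ℂ → ℂ) (A B C : ℕ → ℂ → ℂ) : ℕ → ℂ → ℂ :=
  strongSeq fun n t => match n with
    | 0 => leadingOrder ε s A B C
    | n + 1 => fun x => (deriv (t n) x - PowerSeries.coeff (n + 1) (formalRiccati (fun k => A k x)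
        (fun k => B k x) (fun k => C k x) (fun k => t k x))) / (((ε : ℤ) : ℂ) * s x)

lemma formalSolution_zero : formalSolution ε s A B C 0 = leadingOrder ε s A B C := by
  rw [formalSolution, strongSeq_eq]

lemma formalSolution_succ (n : ℕ) :
    formalSolution ε s A B C (n + 1) = fun x => (deriv (formalSolution ε s A B C n) x -
      PowerSeries.coeff (n + 1) (formalRiccati (fun k => A k x) (fun k => B k x) (fun k => C k x)
        (fun k => (if k < n + 1 then formalSolution ε s A B C k else 0) x))) /
          (((ε : ℤ) : ℂ) * s x) := by
  rw [formalSolution, strongSeq_eq]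
  simp only [Nat.lt_succ_self, if_true]

theorem isFormalSolution_formalSolution (hW : IsOpen W) (hA : ∀ k, DifferentiableOn ℂ (A k) W)
    (hB : ∀ k, DifferentiableOn ℂ (B k) W) (hC : ∀ k, DifferentiableOn ℂ (C k) W)
    (hs : DifferentiableOn ℂ s W) (hsq : ∀ x ∈ W, s x ^ 2 = discriminant A B C x)
    (hs0 : ∀ x ∈ W, s x ≠ 0) (hneg : ε = -1 → ∀ x ∈ W, A 0 x ≠ 0)
    (hpos : ε = 1 → ∀ x ∈ W, A 0 x = 0 → s x = B 0 x) :
    IsFormalSolution W A B C (formalSolution ε s A B C) := by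
  have hε : ((ε : ℤ) : ℂ) ≠ 0 := fun h => by
    have := units_cast_sq ε
    rw [h] at this
    norm_num at this
  refine ⟨fun k => ?_, fun x hx => ?_⟩
  · induction k using Nat.strong_induction_on with
    | _ k ih =>
      rcases k with _ | n
      · rw [formalSolution_zero]
        exact differentiableOn_leadingOrder hW (hA 0) (hB 0) (hC 0) hs hsq hs0 hneg hpos
      · rw [formalSolution_succ]
        refine DifferentiableOn.div (((ih n (Nat.lt_succ_self n)).deriv hW).sub
          (differentiableOn_coeff_formalRiccati hA hB hC fun k => ?_)) (hs.const_mul _)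
          fun x hx => mul_ne_zero hε (hs0 x hx)
        split_ifs with hk
        · exact ih k hk
        · exact differentiableOn_const 0
  · obtain ⟨e1, e2⟩ := leadingOrder_spec (C := C) (hsq x hx) (hs0 x hx) (fun h => hneg h x hx)
      fun h => hpos h x hx
    change _ = formalRiccati (fun k => A k x) (fun k => B k x) (fun k => C k x)
      (fun k => formalSolution ε s A B C k x)
    ext n
    rcases n with _ | n
    · rw [PowerSeries.coeff_zero_X_mul, formalRiccati]
      simp only [PowerSeries.coeff_zero_eq_constantCoeff_apply, map_mul, map_add, map_pow,
        PowerSeries.constantCoeff_mk, formalSolution_zero]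
      linear_combination -e1
    -- Comparison with the truncation after order `n`, whose coefficient of order `n + 1` is zero,
    -- isolates `±√D₀` times the new coefficient.
    · have h1 := coeff_formalRiccati_sub (A := fun k => A k x) (B := fun k => B k x)
        (C := fun k => C k x) (F := fun k => formalSolution ε s A B C k x)
        (F' := fun k => (if k < n + 1 then formalSolution ε s A B C k else 0) x) (n := n)
        fun j hj => by simp only [if_pos (Nat.lt_succ_of_le hj)]
      simp only [formalSolution_zero, e2, lt_irrefl, if_false, Pi.zero_apply, sub_zero] at h1
      rw [PowerSeries.coeff_succ_X_mul, PowerSeries.coeff_mk, eq_comm, ← sub_eq_zero,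
        sub_eq_iff_eq_add.1 h1, formalSolution_succ]
      beta_reduce
      rw [mul_div_cancel₀ _ (mul_ne_zero hε (hs0 x hx))]
      ring

end LeadingOrder

/-! ### Formal solutions from exact solutions -/

/-- `y(h)`, `h ∈ D`, has the asymptotic expansion `∑ F k h ^ k`. -/
def AsympAt (D : Set ℂ) (y : ℂ → ℂ) (F : ℕ → ℂ) : Prop :=
  ∀ n, ∃ C : ℝ, ∀ h ∈ D, ‖rem F h n (y h)‖ ≤ C * ‖h‖ ^ n

lemma GevreyAt.asympAt {D : Set ℂ} {C M : ℝ} {y : ℂ → ℂ} {F : ℕ → ℂ} (H : GevreyAt D C M y F) :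
    AsympAt D y F := fun n => ⟨_, H n⟩

lemma AsympAt.add {D : Set ℂ} {x y : ℂ → ℂ} {F G : ℕ → ℂ} (hF : AsympAt D x F)
    (hG : AsympAt D y G) : AsympAt D (fun h => x h + y h) (F + G) := fun n => by
  obtain ⟨a, ha⟩ := hF n
  obtain ⟨b, hb⟩ := hG n
  refine ⟨a + b, fun h hh => ?_⟩
  rw [rem_add, add_mul]
  exact (norm_add_le _ _).trans (add_le_add (ha h hh) (hb h hh))

lemma AsympAt.mul {D : Set ℂ} {x y : ℂ → ℂ} {F G : ℕ → ℂ} (hF : AsympAt D x F)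
    (hG : AsympAt D y G) : AsympAt D (fun h => x h * y h) (conv F G) := fun n => by
  choose a ha using hF
  choose b hb using hG
  refine ⟨a 0 * b n + ∑ k ∈ Finset.range n, a (n - k) * ‖G k‖, fun h hh => ?_⟩
  have h0 : ‖x h‖ ≤ a 0 := by simpa using ha 0 h hh
  rw [rem_mul, add_mul, Finset.sum_mul, mul_assoc]
  refine (norm_add_le _ _).trans (add_le_add ?_ ((norm_sum_le _ _).trans
    (Finset.sum_le_sum fun k hk => ?_)))
  · rw [norm_mul]
    exact mul_le_mul h0 (hb n h hh) (norm_nonneg _) ((norm_nonneg _).trans h0)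
  · have hk' := (Finset.mem_range.1 hk).le
    rw [norm_mul, norm_smul, norm_pow]
    calc _ ≤ a (n - k) * ‖h‖ ^ (n - k) * (‖h‖ ^ k * ‖G k‖) := by gcongr; exact ha _ h hh
      _ = a (n - k) * ‖G k‖ * (‖h‖ ^ (n - k) * ‖h‖ ^ k) := by ring
      _ = _ := by rw [← pow_add, Nat.sub_add_cancel hk']

lemma AsympAt.unique {θ δ : ℝ} (hδ : 0 < δ) {y : ℂ → ℂ} {F G : ℕ → ℂ}
    (hF : AsympAt (borelDisc θ δ) y F) (hG : AsympAt (borelDisc θ δ) y G) : F = G := by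
  funext n
  induction n using Nat.strong_induction_on with
  | _ n ih =>
    obtain ⟨a, ha⟩ := hF (n + 1)
    obtain ⟨b, hb⟩ := hG (n + 1)
    rw [← sub_eq_zero, ← norm_le_zero_iff]
    refine le_of_forall_pos_le_add fun e he => ?_
    obtain ⟨h, hh, hs⟩ := exists_mem_borelDisc_norm_lt θ hδ (η := e / (|a| + |b| + 1))
      (by positivity)
    have h0 : 0 < ‖h‖ := norm_pos_iff.2 (ne_zero_of_mem_borelDisc hδ hh)
    have e1 : h ^ n * (F n - G n) = rem G h (n + 1) (y h) - rem F h (n + 1) (y h) := by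
      have : ∑ k ∈ Finset.range n, h ^ k • F k = ∑ k ∈ Finset.range n, h ^ k • G k :=
        Finset.sum_congr rfl fun k hk => by rw [ih k (Finset.mem_range.1 hk)]
      rw [rem_succ, rem_succ, rem, rem, this, smul_eq_mul, smul_eq_mul]
      ring
    have e2 : ‖h‖ ^ n * ‖F n - G n‖ ≤ ‖h‖ ^ n * ((|a| + |b|) * ‖h‖) := by
      rw [← norm_pow, ← norm_mul, e1, norm_pow]
      refine (norm_sub_le _ _).trans ((add_le_add (hb h hh) (ha h hh)).trans ?_)
      rw [← add_mul, pow_succ, add_comm b a]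
      have : a + b ≤ |a| + |b| := add_le_add (le_abs_self a) (le_abs_self b)
      calc _ ≤ (|a| + |b|) * (‖h‖ ^ n * ‖h‖) := by gcongr
        _ = _ := by ring
    have e3 := le_of_mul_le_mul_left e2 (by positivity)
    rw [lt_div_iff₀ (by positivity)] at hs
    nlinarith

lemma coeff_mk_mul_mk (F G : ℕ → ℂ) (n : ℕ) :
    PowerSeries.coeff n (PowerSeries.mk F * PowerSeries.mk G) = conv F G n := by
  rw [mul_comm, PowerSeries.coeff_mul, conv,
    Finset.Nat.sum_antidiagonal_eq_sum_range_succ (fun i j => PowerSeries.coeff i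
      (PowerSeries.mk G) * PowerSeries.coeff j (PowerSeries.mk F))]
  exact Finset.sum_congr rfl fun k _ => by
    rw [PowerSeries.coeff_mk, PowerSeries.coeff_mk, mul_comm]

lemma mk_conv (F G : ℕ → ℂ) :
    PowerSeries.mk (conv F G) = PowerSeries.mk F * PowerSeries.mk G := by
  ext n
  rw [coeff_mk_mul_mk, PowerSeries.coeff_mk]

/-- The expansion of the derivative of a function with uniform expansion. -/
lemma GevreyFun.asympAt_deriv {K D : Set ℂ} {C M : ℝ} {f : ℂ → ℂ → ℂ} {F : ℕ → ℂ → ℂ}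
    (H : GevreyFun K D C M f F) (hK : IsOpen K) {z : ℂ} (hz : z ∈ K) :
    AsympAt D (fun h => deriv (fun z => f z h) z) (fun k => deriv (F k) z) := by
  obtain ⟨ρ, hρ, hsub⟩ := Metric.nhds_basis_closedBall.mem_iff.1 (hK.mem_nhds hz)
  intro n
  refine ⟨C * M ^ n * (n ! : ℝ) / ρ, fun h hh => ?_⟩
  have hd : ∀ k, DifferentiableAt ℂ (F k) z := fun k =>
    (H.coeff_hol k).differentiableAt (hK.mem_nhds hz)
  have hfd := DifferentiableOn.slice H.hol hh
  have hrem : DifferentiableOn ℂ (fun x => rem (fun k => F k x) h n (f x h)) K := by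
    exact hfd.sub (DifferentiableOn.fun_sum fun k _ => (H.coeff_hol k).const_smul (h ^ k))
  have e : deriv (fun x => rem (fun k => F k x) h n (f x h)) z =
      rem (fun k => deriv (F k) z) h n (deriv (fun z => f z h) z) := by
    have h1 : HasDerivAt (fun x => ∑ k ∈ Finset.range n, h ^ k • F k x)
        (∑ k ∈ Finset.range n, h ^ k • deriv (F k) z) z :=
      HasDerivAt.fun_sum fun k _ => (hd k).hasDerivAt.fun_const_smul (h ^ k)
    exact ((hfd.differentiableAt (hK.mem_nhds hz)).hasDerivAt.sub h1).deriv
  rw [← e, div_mul_eq_mul_div]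
  exact norm_deriv_le_of_forall_mem (hrem.mono hsub) hρ subset_rfl fun w hw => H.bound w (hsub hw) n h hh

lemma AsympAt.mul_self_left {θ δ : ℝ} (hδ : 0 < δ) {y : ℂ → ℂ} {F : ℕ → ℂ}
    (hF : AsympAt (borelDisc θ δ) y F) : AsympAt (borelDisc θ δ) (fun h => h * y h)
      (fun k => PowerSeries.coeff k (PowerSeries.X * PowerSeries.mk F)) := fun n => by
  rcases n with _ | n
  · obtain ⟨a, ha⟩ := hF 0
    refine ⟨δ * a, fun h hh => ?_⟩
    have := ha h hh
    rw [rem_zero, pow_zero, mul_one] at this ⊢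
    rw [norm_mul]
    exact mul_le_mul (norm_lt_of_mem_borelDisc hδ hh).le this (norm_nonneg _) hδ.le
  · obtain ⟨a, ha⟩ := hF n
    refine ⟨a, fun h hh => ?_⟩
    have e : rem (fun k => PowerSeries.coeff k (PowerSeries.X * PowerSeries.mk F)) h (n + 1)
        (h * y h) = h * rem F h n (y h) := by
      rw [rem, rem, Finset.sum_range_succ', mul_sub, Finset.mul_sum]
      simp only [PowerSeries.coeff_succ_X_mul, PowerSeries.coeff_zero_X_mul, PowerSeries.coeff_mk,
        smul_zero, add_zero]
      congr 1
      exact Finset.sum_congr rfl fun k _ => by rw [smul_eq_mul, smul_eq_mul, pow_succ']; ring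
    rw [e, norm_mul, pow_succ']
    calc _ ≤ ‖h‖ * (a * ‖h‖ ^ n) := by gcongr; exact ha h hh
      _ = _ := by ring

/-- The coefficients of the expansion of an exact solution form a formal solution. -/
lemma GevreyFun.formal {K : Set ℂ} {θ δ C M C' M' : ℝ} {e : ℂ} {α β γ f : ℂ → ℂ → ℂ}
    {α' β' γ' q : ℕ → ℂ → ℂ} (hK : IsOpen K) (hδ : 0 < δ)
    (hα : GevreyFun K (borelDisc θ δ) C' M' α α') (hβ : GevreyFun K (borelDisc θ δ) C' M' β β')
    (hγ : GevreyFun K (borelDisc θ δ) C' M' γ γ') (hf : GevreyFun K (borelDisc θ δ) C M f q)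
    (hode : ∀ z ∈ K, ∀ h ∈ borelDisc θ δ, e * h * deriv (fun z => f z h) z =
      α z h * f z h ^ 2 + β z h * f z h + γ z h) {z : ℂ} (hz : z ∈ K) :
    PowerSeries.X * PowerSeries.mk (fun k => e * deriv (q k) z) =
      formalRiccati (fun k => α' k z) (fun k => β' k z) (fun k => γ' k z) (fun k => q k z) := by
  have hfz := (hf.bound z hz).asympAt
  have h1 := ((((hα.bound z hz).asympAt.mul (hfz.mul hfz))).add
    ((hβ.bound z hz).asympAt.mul hfz)).add (hγ.bound z hz).asympAt
  have h2 : AsympAt (borelDisc θ δ) (fun h => e * deriv (fun z => f z h) z)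
      (fun k => e * deriv (q k) z) := fun n => by
    obtain ⟨a, ha⟩ := hf.asympAt_deriv hK hz n
    refine ⟨‖e‖ * a, fun h hh => ?_⟩
    have := rem_map (ContinuousLinearMap.lsmul ℂ ℂ e) (fun k => deriv (q k) z) h n
      (deriv (fun z => f z h) z)
    refine (le_of_eq (congrArg _ this)).trans ?_
    rw [ContinuousLinearMap.lsmul_apply, norm_smul, mul_assoc]
    gcongr
    exact ha h hh
  have h3 := h2.mul_self_left hδ
  have h4 : AsympAt (borelDisc θ δ) (fun h => h * (e * deriv (fun z => f z h) z))
      (conv (fun k => α' k z) (conv (fun k => q k z) (fun k => q k z)) +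
        conv (fun k => β' k z) (fun k => q k z) + fun k => γ' k z) := fun n => by
    obtain ⟨a, ha⟩ := h1 n
    refine ⟨a, fun h hh => ?_⟩
    have e1 : h * (e * deriv (fun z => f z h) z) = α z h * (f z h * f z h) + β z h * f z h + γ z h := by
      linear_combination hode z hz h hh
    have := ha h hh
    beta_reduce at this ⊢
    rwa [← e1] at this
  have h5 := h3.unique hδ h4
  have h6 : PowerSeries.mk (fun k => PowerSeries.coeff k
      (PowerSeries.X * PowerSeries.mk (fun k => e * deriv (q k) z) : PowerSeries ℂ)) =
      PowerSeries.X * PowerSeries.mk (fun k => e * deriv (q k) z) := by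
    ext k; rw [PowerSeries.coeff_mk]
  have h7 : ∀ F G : ℕ → ℂ, PowerSeries.mk (F + G) = PowerSeries.mk F + PowerSeries.mk G :=
    fun F G => by ext k; simp
  rw [← h6, h5, h7, h7, mk_conv, mk_conv, mk_conv, formalRiccati, pow_two]

/-! ### Borel sums -/

/-- `v` is the value at `h` of a function with Gevrey expansion `F` on a Borel disc. -/
def HasBorelSum (θ : ℝ) (F : ℕ → ℂ) (h v : ℂ) : Prop :=
  ∃ δ > 0, ∃ C ≥ 0, ∃ M > 0, ∃ y : ℂ → ℂ, DifferentiableOn ℂ y (borelDisc θ δ) ∧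
    GevreyAt (borelDisc θ δ) C M y F ∧ h ∈ borelDisc θ δ ∧ y h = v

/-- The difference of two functions with the same Gevrey expansion is flat, so Watson's lemma
applies. This makes the sum a function of the series and of `h` only. -/
lemma HasBorelSum.unique {θ : ℝ} {F : ℕ → ℂ} {h v v' : ℂ} (H : HasBorelSum θ F h v)
    (H' : HasBorelSum θ F h v') : v = v' := by
  obtain ⟨δ, hδ, C, hC, M, hM, y, hy, hg, hh, rfl⟩ := H
  obtain ⟨δ', hδ', C', hC', M', hM', y', hy', hg', hh', rfl⟩ := H'
  set D := borelDisc θ (min δ δ')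
  have hmin : 0 < min δ δ' := lt_min hδ hδ'
  have hD : D ⊆ borelDisc θ δ := borelDisc_mono hmin (min_le_left _ _)
  have hD' : D ⊆ borelDisc θ δ' := borelDisc_mono hmin (min_le_right _ _)
  -- The two discs are nested, so the smaller one is one of them and contains `h`.
  have hhD : h ∈ D := by
    rcases le_total δ δ' with h1 | h1
    · rwa [show D = borelDisc θ δ by simp only [D, min_eq_left h1]]
    · rwa [show D = borelDisc θ δ' by simp only [D, min_eq_right h1]]
  have hMM : 0 < max M M' := lt_max_of_lt_left hM
  rw [← sub_eq_zero]
  refine eq_zero_of_gevrey_flat hmin (f := fun h => y h - y' h) ((hy.mono hD).sub (hy'.mono hD'))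
    (C := C + C') (M := max M M') (by positivity) hMM (fun n h hh => ?_) hhD
  have e : y h - y' h = rem F h n (y h) - rem F h n (y' h) := by rw [rem, rem]; ring
  have h1 := hg.mono hD le_rfl hC hM.le (le_max_left M M') n h hh
  have h2 := hg'.mono hD' le_rfl hC' hM'.le (le_max_right M M') n h hh
  rw [e]
  refine (norm_sub_le _ _).trans ((add_le_add h1 h2).trans (le_of_eq ?_))
  ring

open Classical in
/-- The Borel sum in the direction `θ` of the formal series `F` (`0` where it does not exist). -/
noncomputable def borelSum (θ : ℝ) (F : ℕ → ℂ) (h : ℂ) : ℂ :=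
  if H : ∃ v, HasBorelSum θ F h v then H.choose else 0

lemma HasBorelSum.borelSum_eq {θ : ℝ} {F : ℕ → ℂ} {h v : ℂ} (H : HasBorelSum θ F h v) :
    borelSum θ F h = v := by
  have H' : ∃ v, HasBorelSum θ F h v := ⟨v, H⟩
  rw [borelSum, dif_pos H']
  exact H'.choose_spec.unique H

lemma GevreyFun.borelSum_eq {θ δ C M : ℝ} {K : Set ℂ} {f : ℂ → ℂ → ℂ} {F : ℕ → ℂ → ℂ} (hδ : 0 < δ)
    (hC : 0 ≤ C) (hM : 0 ≤ M) (H : GevreyFun K (borelDisc θ δ) C M f F) {z h : ℂ} (hz : z ∈ K)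
    (hh : h ∈ borelDisc θ δ) : borelSum θ (fun k => F k z) h = f z h :=
  HasBorelSum.borelSum_eq ⟨δ, hδ, C, hC, M + 1, by positivity, f z,
    DifferentiableOn.slice_right H.hol hz,
    (H.bound z hz).mono subset_rfl le_rfl hC hM (by linarith), hh, rfl⟩

lemma remainder_eq (f : ℂ × ℂ → ℂ) (F : ℕ → ℂ → ℂ) (n : ℕ) (x h : ℂ) :
    remainder f F n x h = rem (fun k => F k x) h n (f (x, h)) := by
  rw [remainder, rem]
  congr 1
  exact Finset.sum_congr rfl fun k _ => by rw [smul_eq_mul, mul_comm]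

/-- Near the origin, a function with a Gevrey expansion on a sectorial domain is the Borel sum of
its expansion. -/
lemma UnifGevrey.exists_eq_borelSum {θ : ℝ} {U S : Set ℂ} {f : ℂ × ℂ → ℂ} {F : ℕ → ℂ → ℂ}
    (H : UnifGevrey θ U S 1 f F) (hf : DifferentiableOn ℂ f (U ×ˢ S)) :
    ∃ δ > 0, borelDisc θ δ ⊆ S ∧
      ∀ x ∈ U, ∀ h ∈ borelDisc θ δ, f (x, h) = borelSum θ (fun k => F k x) h := by
  obtain ⟨S₁, hS₁, hsec, C, hC, M, hM, hb⟩ := H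
  obtain ⟨δ, hδ, hD⟩ := hsec.borel
  refine ⟨δ, hδ, hD.trans hS₁, fun x hx h hh => (HasBorelSum.borelSum_eq ⟨δ, hδ, C, hC.le, M, hM,
    fun h => f (x, h), ?_, fun n h hh => ?_, hh, rfl⟩).symm⟩
  · exact hf.comp (by fun_prop) fun h hh => ⟨hx, hS₁ (hD hh)⟩
  · have := hb n x hx h (hD hh)
    rwa [remainder_eq, Pi.one_apply, norm_one, one_mul] at this

/-! ### WKB halfstrips -/

section Halfstrip

variable {X : Set ℂ} {D₀ s Ψ : ℂ → ℂ} {θ r : ℝ} {ε : ℤˣ} {x₁ : ℂ}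

lemma IsWKBHalfstrip.deriv_ne_zero (hW : IsWKBHalfstrip X D₀ s θ ε x₁ r Ψ) {z : ℂ}
    (hz : z ∈ halfstrip θ ε r) : deriv Ψ z ≠ 0 := fun h => by
  have := hW.inverse z hz
  rw [h, mul_zero] at this
  exact zero_ne_one this

lemma IsWKBHalfstrip.branch_ne_zero (hW : IsWKBHalfstrip X D₀ s θ ε x₁ r Ψ) {x : ℂ}
    (hx : x ∈ wkbHalfstrip θ ε Ψ r) : s x ≠ 0 := by
  obtain ⟨z, hz, rfl⟩ := hx
  intro h
  have := hW.inverse z hz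
  rw [h, zero_mul] at this
  exact zero_ne_one this

lemma IsWKBHalfstrip.hasStrictDerivAt (hW : IsWKBHalfstrip X D₀ s θ ε x₁ r Ψ) {z : ℂ}
    (hz : z ∈ halfstrip θ ε r) : HasStrictDerivAt Ψ (deriv Ψ z) z :=
  (hW.holo.analyticAt ((isOpen_halfstrip θ ε r).mem_nhds hz)).hasStrictDerivAt

lemma IsWKBHalfstrip.isOpen_image (hW : IsWKBHalfstrip X D₀ s θ ε x₁ r Ψ) {K : Set ℂ}
    (hK : IsOpen K) (hKr : K ⊆ halfstrip θ ε r) : IsOpen (Ψ '' K) := by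
  rw [isOpen_iff_mem_nhds]
  rintro _ ⟨z, hz, rfl⟩
  rw [← (hW.hasStrictDerivAt (hKr hz)).map_nhds_eq (hW.deriv_ne_zero (hKr hz))]
  exact Filter.image_mem_map (hK.mem_nhds hz)

lemma IsWKBHalfstrip.isOpen (hW : IsWKBHalfstrip X D₀ s θ ε x₁ r Ψ) :
    IsOpen (wkbHalfstrip θ ε Ψ r) :=
  hW.isOpen_image (isOpen_halfstrip θ ε r) subset_rfl

lemma IsWKBHalfstrip.isPreconnected (hW : IsWKBHalfstrip X D₀ s θ ε x₁ r Ψ) :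
    IsPreconnected (wkbHalfstrip θ ε Ψ r) :=
  (convex_halfstrip θ ε r).isPreconnected.image _ hW.holo.continuousOn

/-- The coefficients of the equation, in the coordinate `z`. -/
lemma IsWKBHalfstrip.exists_gevreyFun (hW : IsWKBHalfstrip X D₀ s θ ε x₁ r Ψ) {S : Set ℂ}
    {a : ℂ × ℂ → ℂ} {A : ℕ → ℂ → ℂ} (ha : DifferentiableOn ℂ a (X ×ˢ S))
    (hA : ∀ k, DifferentiableOn ℂ (A k) X) (haG : UnifGevrey θ (wkbHalfstrip θ ε Ψ r) S s a A) :
    ∃ δ > 0, borelDisc θ δ ⊆ S ∧ ∃ C ≥ 0, ∃ M ≥ 0, GevreyFun (halfstrip θ ε r) (borelDisc θ δ) C M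
      (fun z h => ((ε : ℤ) : ℂ) / s (Ψ z) * a (Ψ z, h))
      (fun k z => ((ε : ℤ) : ℂ) / s (Ψ z) * A k (Ψ z)) := by
  obtain ⟨S₁, hS₁, hsec, C, hC, M, hM, hb⟩ := haG
  obtain ⟨δ, hδ, hD⟩ := hsec.borel
  have hmem : MapsTo Ψ (halfstrip θ ε r) (wkbHalfstrip θ ε Ψ r) := fun z hz => ⟨z, hz, rfl⟩
  have hsd : DifferentiableOn ℂ (fun z => ((ε : ℤ) : ℂ) / s (Ψ z)) (halfstrip θ ε r) :=
    (differentiableOn_const _).div (hW.branch_holo.comp hW.holo hmem) fun z hz =>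
      hW.branch_ne_zero (hmem hz)
  refine ⟨δ, hδ, hD.trans hS₁, C, hC.le, M, hM.le, ?_, fun k => ?_, fun z hz n h hh => ?_⟩
  · have h1 : DifferentiableOn ℂ (fun p : ℂ × ℂ => a (Ψ p.1, p.2))
        (halfstrip θ ε r ×ˢ borelDisc θ δ) :=
      ha.comp ((hW.holo.comp differentiableOn_fst fun p hp => hp.1).prodMk differentiableOn_snd)
        fun p hp => ⟨hW.subset (hmem hp.1), hS₁ (hD hp.2)⟩
    exact (hsd.comp differentiableOn_fst fun p hp => hp.1).mul h1
  · exact hsd.mul ((hA k).comp hW.holo fun z hz => hW.subset (hmem hz))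
  · have h1 := hb n (Ψ z) (hmem hz) h (hD hh)
    rw [remainder_eq] at h1
    have h2 := rem_map (ContinuousLinearMap.lsmul ℂ ℂ (((ε : ℤ) : ℂ) / s (Ψ z)))
      (fun k => A k (Ψ z)) h n (a (Ψ z, h))
    refine (le_of_eq (congrArg _ h2)).trans ?_
    -- The factor `1 / √D₀` of the coordinate change cancels the scale `√D₀` of the hypothesis,
    -- leaving constants uniform in `z`.
    have hs : 0 < ‖s (Ψ z)‖ := norm_pos_iff.2 (hW.branch_ne_zero (hmem hz))
    rw [ContinuousLinearMap.lsmul_apply, norm_smul, norm_div, norm_units_cast, one_div,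
      inv_mul_le_iff₀ hs]
    refine h1.trans (le_of_eq ?_)
    ring

/-- Open sets in the coordinate `z` on which the leading-order solution is bounded carry exact
solutions. -/
theorem IsWKBHalfstrip.exists_exact {S : Set ℂ} {a b c : ℂ × ℂ → ℂ} {A B C : ℕ → ℂ → ℂ}
    (ha : DifferentiableOn ℂ a (X ×ˢ S)) (hb : DifferentiableOn ℂ b (X ×ˢ S))
    (hc : DifferentiableOn ℂ c (X ×ˢ S)) (hA : ∀ k, DifferentiableOn ℂ (A k) X)
    (hB : ∀ k, DifferentiableOn ℂ (B k) X) (hC : ∀ k, DifferentiableOn ℂ (C k) X)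
    (hW : IsWKBHalfstrip X (discriminant A B C) s θ ε x₁ r Ψ)
    (hneg : ε = -1 → ∀ x ∈ wkbHalfstrip θ ε Ψ r, A 0 x ≠ 0)
    (hpos : ε = 1 → ∀ x ∈ wkbHalfstrip θ ε Ψ r, A 0 x = 0 → s x = B 0 x)
    (haG : UnifGevrey θ (wkbHalfstrip θ ε Ψ r) S s a A)
    (hbG : UnifGevrey θ (wkbHalfstrip θ ε Ψ r) S s b B)
    (hcG : UnifGevrey θ (wkbHalfstrip θ ε Ψ r) S s c C)
    {F : ℕ → ℂ → ℂ} (hF : IsFormalSolution (wkbHalfstrip θ ε Ψ r) A B C F)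
    (hF0 : EqOn (F 0) (leadingOrder ε s A B C) (wkbHalfstrip θ ε Ψ r)) {r₁ : ℝ} (hr₁ : 0 < r₁)
    (hr : r₁ < r) {K : Set ℂ} (hK : IsOpen K) (hKr : K ⊆ halfstrip θ ε r₁) {R : ℝ}
    (hR : ∀ z ∈ K, ‖leadingOrder ε s A B C (Ψ z)‖ ≤ R) :
    ∃ δ > 0, borelDisc θ δ ⊆ S ∧ ∃ C' ≥ 0, ∃ M ≥ 0, ∃ f : ℂ → ℂ → ℂ,
      GevreyFun K (borelDisc θ δ) C' M f (fun k z => F k (Ψ z)) ∧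
      ∀ z ∈ K, ∀ h ∈ borelDisc θ δ, h * deriv (fun z => f z h) z * s (Ψ z) =
        a (Ψ z, h) * f z h ^ 2 + b (Ψ z, h) * f z h + c (Ψ z, h) := by
  obtain ⟨δa, hδa, hSa, Ca, hCa, Ma, hMa, Ga⟩ := hW.exists_gevreyFun ha hA haG
  obtain ⟨δb, hδb, hSb, Cb, hCb, Mb, hMb, Gb⟩ := hW.exists_gevreyFun hb hB hbG
  obtain ⟨δc, hδc, hSc, Cc, hCc, Mc, hMc, Gc⟩ := hW.exists_gevreyFun hc hC hcG
  set δ₀ := min δa (min δb δc) with hδ₀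
  have hδ₀0 : 0 < δ₀ := lt_min hδa (lt_min hδb hδc)
  have hDa : borelDisc θ δ₀ ⊆ borelDisc θ δa := borelDisc_mono hδ₀0 (min_le_left _ _)
  have hDb : borelDisc θ δ₀ ⊆ borelDisc θ δb :=
    borelDisc_mono hδ₀0 ((min_le_right _ _).trans (min_le_left _ _))
  have hDc : borelDisc θ δ₀ ⊆ borelDisc θ δc :=
    borelDisc_mono hδ₀0 ((min_le_right _ _).trans (min_le_right _ _))
  set C₀ := Ca + Cb + Cc with hC₀
  set M₀ := Ma + Mb + Mc with hM₀
  have hC₀0 : 0 ≤ C₀ := by positivity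
  have hM₀0 : 0 ≤ M₀ := by positivity
  replace Ga := Ga.mono (C' := C₀) (M' := M₀) subset_rfl hDa (by linarith) hC₀0 hMa (by linarith)
  replace Gb := Gb.mono (C' := C₀) (M' := M₀) subset_rfl hDb (by linarith) hC₀0 hMb (by linarith)
  replace Gc := Gc.mono (C' := C₀) (M' := M₀) subset_rfl hDc (by linarith) hC₀0 hMc (by linarith)
  have hmem : MapsTo Ψ (halfstrip θ ε r) (wkbHalfstrip θ ε Ψ r) := fun z hz => ⟨z, hz, rfl⟩
  have hKr' : K ⊆ halfstrip θ ε r := hKr.trans (halfstrip_mono hr.le)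
  have hε := units_cast_sq ε
  have hε0 : ((ε : ℤ) : ℂ) ≠ 0 := fun h => by rw [h] at hε; norm_num at hε
  have hspec := fun z (hz : z ∈ halfstrip θ ε r) => leadingOrder_spec (C := C)
    (hW.branch_sq _ (hmem hz)) (hW.branch_ne_zero (hmem hz)) (fun h => hneg h _ (hmem hz))
    fun h => hpos h _ (hmem hz)
  have hWo := hW.isOpen
  have hw : DifferentiableOn ℂ (fun z => leadingOrder ε s A B C (Ψ z)) (halfstrip θ ε r) :=
    (differentiableOn_leadingOrder hWo ((hA 0).mono hW.subset) ((hB 0).mono hW.subset)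
      ((hC 0).mono hW.subset) hW.branch_holo hW.branch_sq (fun x hx => hW.branch_ne_zero hx) hneg
      hpos).comp hW.holo hmem
  have hαw : ∀ z ∈ halfstrip θ ε r, ((ε : ℤ) : ℂ) / s (Ψ z) * A 0 (Ψ z) *
      leadingOrder ε s A B C (Ψ z) = (1 - ((ε : ℤ) : ℂ) / s (Ψ z) * B 0 (Ψ z)) / 2 := by
    intro z hz
    obtain ⟨e1, e2⟩ := hspec z hz
    have hs := hW.branch_ne_zero (hmem hz)
    field_simp
    linear_combination ((ε : ℤ) : ℂ) * e2 + s (Ψ z) * hε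
  have hγw : ∀ z ∈ halfstrip θ ε r, leadingOrder ε s A B C (Ψ z) *
      ((1 + ((ε : ℤ) : ℂ) / s (Ψ z) * B 0 (Ψ z)) / 2) =
        -(((ε : ℤ) : ℂ) / s (Ψ z) * C 0 (Ψ z)) := by
    intro z hz
    obtain ⟨e1, e2⟩ := hspec z hz
    have hs := hW.branch_ne_zero (hmem hz)
    field_simp
    linear_combination 2 * ((ε : ℤ) : ℂ) * e1 - ((ε : ℤ) : ℂ) * leadingOrder ε s A B C (Ψ z) * e2 -
      leadingOrder ε s A B C (Ψ z) * s (Ψ z) * hε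
  obtain ⟨δ, hδ, hδδ, C', hC', M, hM, q, f, hq0, hf, hode⟩ := exists_exact_riccati hδ₀0 hr₁ hr hC₀0
    hM₀0 Ga Gb Gc hw hαw hγw hKr hR
  have hDD : borelDisc θ δ ⊆ borelDisc θ δ₀ := borelDisc_mono hδ hδδ
  -- The expansion of the exact solution and the pullback of `F` solve the same formal equation with
  -- the same leading term. The linearisation there is `1`, so they coincide.
  have hqF : ∀ k, EqOn (q k) (fun z => F k (Ψ z)) K := by
    refine fun k => formal_unique (F' := fun k z => F k (Ψ z)) hK (e := ((ε : ℤ) : ℂ))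
      (fun z hz => GevreyFun.formal hK hδ (Ga.mono hKr' hDD le_rfl hC₀0 hM₀0 le_rfl)
        (Gb.mono hKr' hDD le_rfl hC₀0 hM₀0 le_rfl) (Gc.mono hKr' hDD le_rfl hC₀0 hM₀0 le_rfl) hf
        hode hz) (fun z hz => ?_) (fun z hz => ?_) (fun z hz => ?_) k
    · have hz' := hKr' hz
      have h1 : ∀ k, deriv (fun z => F k (Ψ z)) z = deriv (F k) (Ψ z) * deriv Ψ z := fun k =>
        (((hF.1 k).differentiableAt (hWo.mem_nhds (hmem hz'))).hasDerivAt.comp z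
          (hW.holo.differentiableAt
            ((isOpen_halfstrip θ ε r).mem_nhds hz')).hasDerivAt).deriv
      have hs := hW.branch_ne_zero (hmem hz')
      have h2 : deriv Ψ z = (s (Ψ z))⁻¹ := eq_inv_of_mul_eq_one_right (hW.inverse z hz')
      have h3 : ∀ G : ℕ → ℂ, PowerSeries.mk (fun k => ((ε : ℤ) : ℂ) / s (Ψ z) * G k) =
          PowerSeries.C (((ε : ℤ) : ℂ) / s (Ψ z)) * PowerSeries.mk G := fun G => by
        ext k; simp
      have h4 := hF.2 (Ψ z) (hmem hz')
      have h5 : PowerSeries.mk (fun k => ((ε : ℤ) : ℂ) * deriv (fun z => F k (Ψ z)) z) =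
          PowerSeries.C (((ε : ℤ) : ℂ) / s (Ψ z)) * PowerSeries.mk (fun k => deriv (F k) (Ψ z)) := by
        rw [← h3]
        congr 1
        funext k
        rw [h1, h2]
        ring
      rw [h5, formalRiccati, h3, h3, h3]
      linear_combination PowerSeries.C (((ε : ℤ) : ℂ) / s (Ψ z)) * h4
    · rw [hq0 z hz]
      exact (hF0 (hmem (hKr' hz))).symm
    · rw [hq0 z hz]
      have hs := hW.branch_ne_zero (hmem (hKr' hz))
      have h1 := (hspec z (hKr' hz)).2
      have h2 : 2 * (((ε : ℤ) : ℂ) / s (Ψ z) * A 0 (Ψ z)) * leadingOrder ε s A B C (Ψ z) +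
          ((ε : ℤ) : ℂ) / s (Ψ z) * B 0 (Ψ z) = 1 := by
        field_simp
        linear_combination ((ε : ℤ) : ℂ) * h1 + s (Ψ z) * hε
      rw [h2]
      exact one_ne_zero
  refine ⟨δ, hδ, (hDD.trans hDa).trans hSa, C', hC', M, hM, f, ⟨hf.hol, fun k => ?_,
    fun z hz n h hh => ?_⟩, fun z hz h hh => ?_⟩
  · exact (hf.coeff_hol k).congr fun z hz => (hqF k hz).symm
  · have e : (fun k => F k (Ψ z)) = fun k => q k z := funext fun k => (hqF k hz).symm
    rw [e]
    exact hf.bound z hz n h hh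
  · have h1 := hode z hz h hh
    have hs := hW.branch_ne_zero (hmem (hKr' hz))
    field_simp at h1
    have h2 : ((ε : ℤ) : ℂ) * (h * deriv (fun z => f z h) z * s (Ψ z)) = ((ε : ℤ) : ℂ) *
        (a (Ψ z, h) * f z h ^ 2 + b (Ψ z, h) * f z h + c (Ψ z, h)) := by
      linear_combination ((ε : ℤ) : ℂ) * h1
    exact mul_left_cancel₀ hε0 h2

end Halfstrip

/-! ### Gluing -/

/-- The Borel sums of the values of a formal series with coefficients `F`. -/
noncomputable def borelSumFun (θ : ℝ) (F : ℕ → ℂ → ℂ) (p : ℂ × ℂ) : ℂ :=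
  borelSum θ (fun k => F k p.1) p.2

/-- A product `U × borelDisc θ δ` on which the Borel sum of `F` is an exact solution, with uniform
Gevrey asymptotics; the sets `U` are to have the base point `x₁` in common. -/
structure IsExactBox (θ : ℝ) (W S : Set ℂ) (a b c : ℂ × ℂ → ℂ) (F : ℕ → ℂ → ℂ) (x₁ : ℂ)
    (U : Set ℂ) (δ : ℝ) : Prop where
  isOpen : IsOpen U
  isPreconnected : IsPreconnected U
  base : x₁ ∈ U
  subset : U ⊆ W
  pos : 0 < δ
  disc_subset : borelDisc θ δ ⊆ S
  solution : IsHolomorphicSolution (U ×ˢ borelDisc θ δ) a b c (borelSumFun θ F)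
  gevrey : UnifGevrey θ U (borelDisc θ δ) 1 (borelSumFun θ F) F

/-- The union of all products on which the Borel sum is an exact solution. -/
def exactDomain (θ : ℝ) (W S : Set ℂ) (a b c : ℂ × ℂ → ℂ) (F : ℕ → ℂ → ℂ) (x₁ : ℂ) :
    Set (ℂ × ℂ) :=
  {p | ∃ U δ, IsExactBox θ W S a b c F x₁ U δ ∧ p ∈ U ×ˢ borelDisc θ δ}

section ExactDomain

variable {θ : ℝ} {W S : Set ℂ} {a b c : ℂ × ℂ → ℂ} {F : ℕ → ℂ → ℂ} {x₁ : ℂ}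

lemma IsExactBox.subset_exactDomain {U : Set ℂ} {δ : ℝ} (H : IsExactBox θ W S a b c F x₁ U δ) :
    U ×ˢ borelDisc θ δ ⊆ exactDomain θ W S a b c F x₁ := fun _ hp => ⟨U, δ, H, hp⟩

lemma IsExactBox.isOpen_prod {U : Set ℂ} {δ : ℝ} (H : IsExactBox θ W S a b c F x₁ U δ) :
    IsOpen (U ×ˢ borelDisc θ δ) := H.isOpen.prod (isOpen_borelDisc H.pos)

lemma isOpen_exactDomain : IsOpen (exactDomain θ W S a b c F x₁) := by
  rw [isOpen_iff_mem_nhds]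
  rintro p ⟨U, δ, H, hp⟩
  exact Filter.mem_of_superset (H.isOpen_prod.mem_nhds hp) H.subset_exactDomain

/-- Any two boxes meet above the common base point, at each `h` in the smaller of their Borel discs.
-/
lemma isPreconnected_exactDomain : IsPreconnected (exactDomain θ W S a b c F x₁) := by
  refine isPreconnected_of_forall_pair ?_
  rintro p ⟨U, δ, H, hp⟩ q ⟨U', δ', H', hq⟩
  refine ⟨U ×ˢ borelDisc θ δ ∪ U' ×ˢ borelDisc θ δ',
    union_subset H.subset_exactDomain H'.subset_exactDomain, Or.inl hp, Or.inr hq, ?_⟩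
  have hmin := lt_min H.pos H'.pos
  obtain ⟨h, hh, -⟩ := exists_mem_borelDisc_norm_lt θ hmin one_pos
  exact IsPreconnected.union' ⟨(x₁, h), ⟨H.base, borelDisc_mono hmin (min_le_left _ _) hh⟩,
    H'.base, borelDisc_mono hmin (min_le_right _ _) hh⟩
    (H.isPreconnected.prod (convex_borelDisc H.pos).isPreconnected)
    (H'.isPreconnected.prod (convex_borelDisc H'.pos).isPreconnected)

lemma isHolomorphicSolution_exactDomain :
    IsHolomorphicSolution (exactDomain θ W S a b c F x₁) a b c (borelSumFun θ F) := by
  refine ⟨?_, ?_⟩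
  · rintro p ⟨U, δ, H, hp⟩
    exact (H.solution.1.differentiableAt (H.isOpen_prod.mem_nhds hp)).differentiableWithinAt
  · rintro p ⟨U, δ, H, hp⟩
    exact H.solution.2 p hp

lemma isSemisectorialDomain_exactDomain (hne : W.Nonempty)
    (hbox : ∀ x ∈ W, ∃ U δ, IsExactBox θ W S a b c F x₁ U δ ∧ x ∈ U) :
    IsSemisectorialDomain θ W S (exactDomain θ W S a b c F x₁) where
  isOpen := isOpen_exactDomain
  isConnected := by
    obtain ⟨x, hx⟩ := hne
    obtain ⟨U, δ, H, hxU⟩ := hbox x hx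
    obtain ⟨h, hh, -⟩ := exists_mem_borelDisc_norm_lt θ H.pos one_pos
    exact ⟨⟨(x, h), H.subset_exactDomain ⟨hxU, hh⟩⟩, isPreconnected_exactDomain⟩
  subset := by
    rintro p ⟨U, δ, H, hp⟩
    exact ⟨H.subset hp.1, H.disc_subset hp.2⟩
  products x hx := by
    obtain ⟨U, δ, H, hxU⟩ := hbox x hx
    exact ⟨U, H.subset, H.isOpen, hxU, borelDisc θ δ, H.disc_subset,
      isSectorialDomain_borelDisc θ H.pos, H.subset_exactDomain⟩

/-- Every holomorphic function which is Gevrey asymptotic to `F` near a relatively compact set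
coincides with the Borel sum. -/
lemma exists_eqOn_of_compact (hbox : ∀ x ∈ W, ∃ U δ, IsExactBox θ W S a b c F x₁ U δ ∧ x ∈ U)
    {x₀ : ℂ} {U₀ S₀ : Set ℂ} {g : ℂ × ℂ → ℂ}
    (hg : IsCanonicalLocalSolution θ W S a b c F x₀ U₀ S₀ g) :
    ∃ S₁ ⊆ S₀, IsSectorialDomain θ S₁ ∧ U₀ ×ˢ S₁ ⊆ exactDomain θ W S a b c F x₁ ∧
      EqOn g (borelSumFun θ F) (U₀ ×ˢ S₁) := by
  obtain ⟨δ₀, hδ₀, hD₀, hg₀⟩ := hg.gevrey.exists_eq_borelSum hg.solution.1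
  choose! U δ hU hxU using hbox
  -- Finitely many boxes cover the closure, so a single disc serves for all of them and for `g`.
  obtain ⟨t, ht, hcov⟩ := hg.compact.elim_nhds_subcover U fun x hx =>
    (hU x (hg.closure_subset hx)).isOpen.mem_nhds (hxU x (hg.closure_subset hx))
  have hδ : ∃ d > 0, d ≤ δ₀ ∧ ∀ x ∈ t, d ≤ δ x := by
    have htW : ∀ x ∈ t, x ∈ W := fun x hx => hg.closure_subset (ht x hx)
    clear hcov ht
    induction t using Finset.induction_on with
    | empty => exact ⟨δ₀, hδ₀, le_rfl, by simp⟩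
    | insert x t _ ih =>
      obtain ⟨d, hd, hd0, hdt⟩ := ih fun y hy => htW y (Finset.mem_insert_of_mem hy)
      refine ⟨min d (δ x), lt_min hd (hU x (htW x (Finset.mem_insert_self x t))).pos,
        (min_le_left _ _).trans hd0, fun y hy => ?_⟩
      rcases Finset.mem_insert.1 hy with rfl | hy
      · exact min_le_right _ _
      · exact (min_le_left _ _).trans (hdt y hy)
  obtain ⟨d, hd, hd0, hdt⟩ := hδ
  refine ⟨borelDisc θ d, (borelDisc_mono hd hd0).trans hD₀, isSectorialDomain_borelDisc θ hd, ?_, ?_⟩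
  · rintro ⟨x, h⟩ ⟨hx, hh⟩
    obtain ⟨y, hy, hxy⟩ := mem_iUnion₂.1 (hcov (subset_closure hx))
    exact (hU y (hg.closure_subset (ht y hy))).subset_exactDomain
      ⟨hxy, borelDisc_mono hd (hdt y hy) hh⟩
  · rintro ⟨x, h⟩ ⟨hx, hh⟩
    exact hg₀ x hx h (borelDisc_mono hd hd0 hh)

lemma IsSemisectorialDomain.exists_ball {V : Set (ℂ × ℂ)} (hV : IsSemisectorialDomain θ W S V)
    {x : ℂ} (hx : x ∈ W) : ∃ ρ > 0, ∃ δ > 0, Metric.ball x ρ ×ˢ borelDisc θ δ ⊆ V := by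
  obtain ⟨U, -, hU, hxU, S₀, -, hS₀, hsub⟩ := hV.products x hx
  obtain ⟨ρ, hρ, hball⟩ := Metric.isOpen_iff.1 hU x hxU
  obtain ⟨δ, hδ, hD⟩ := hS₀.borel
  exact ⟨ρ, hρ, δ, hδ, (prod_mono hball hD).trans hsub⟩

/-- Agreement near one point propagates along a connected set. -/
lemma agreeNear_of_agreeNear (hW : IsPreconnected W) {V V' : Set (ℂ × ℂ)} {f g : ℂ × ℂ → ℂ}
    (hV : IsSemisectorialDomain θ W S V) (hV' : IsSemisectorialDomain θ W S V')
    (hf : DifferentiableOn ℂ f V) (hg : DifferentiableOn ℂ g V') {x₀ : ℂ} (hx₀ : x₀ ∈ W)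
    (h₀ : AgreeNear θ V V' f g x₀) {x : ℂ} (hx : x ∈ W) : AgreeNear θ V V' f g x := by
  refine hW.subset_of_closure_inter_subset (u := {x | AgreeNear θ V V' f g x}) ?_ ⟨x₀, hx₀, h₀⟩
    ?_ hx
  · rw [isOpen_iff_mem_nhds]
    rintro y ⟨U, hU, hy, S₀, hS₀, hsub, heq⟩
    filter_upwards [hU.mem_nhds hy] with z hz
    exact ⟨U, hU, hz, S₀, hS₀, hsub, heq⟩
  · rintro y ⟨hyc, hyW⟩
    obtain ⟨ρ₁, hρ₁, δ₁, hδ₁, hb₁⟩ := hV.exists_ball hyW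
    obtain ⟨ρ₂, hρ₂, δ₂, hδ₂, hb₂⟩ := hV'.exists_ball hyW
    -- Both functions live on a ball around `y` times a Borel disc, and the ball contains a point
    -- `z` near which they agree. For each fixed `h` the identity theorem extends the agreement to
    -- the ball.
    obtain ⟨z, hz, hzy⟩ := Metric.mem_closure_iff.1 hyc _ (lt_min hρ₁ hρ₂)
    obtain ⟨U, hU, hzU, S₀, hS₀, hsub, heq⟩ := hz
    obtain ⟨δ₃, hδ₃, hD⟩ := hS₀.borel
    have hd : 0 < min (min δ₁ δ₂) δ₃ := lt_min (lt_min hδ₁ hδ₂) hδ₃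
    have hD₁ : borelDisc θ (min (min δ₁ δ₂) δ₃) ⊆ borelDisc θ δ₁ :=
      borelDisc_mono hd ((min_le_left _ _).trans (min_le_left _ _))
    have hD₂ : borelDisc θ (min (min δ₁ δ₂) δ₃) ⊆ borelDisc θ δ₂ :=
      borelDisc_mono hd ((min_le_left _ _).trans (min_le_right _ _))
    have hD₃ : borelDisc θ (min (min δ₁ δ₂) δ₃) ⊆ borelDisc θ δ₃ :=
      borelDisc_mono hd (min_le_right _ _)
    have hB₁ : Metric.ball y (min ρ₁ ρ₂) ⊆ Metric.ball y ρ₁ :=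
      Metric.ball_subset_ball (min_le_left _ _)
    have hB₂ : Metric.ball y (min ρ₁ ρ₂) ⊆ Metric.ball y ρ₂ :=
      Metric.ball_subset_ball (min_le_right _ _)
    refine ⟨Metric.ball y (min ρ₁ ρ₂), Metric.isOpen_ball, Metric.mem_ball_self (lt_min hρ₁ hρ₂),
      _, isSectorialDomain_borelDisc θ hd,
      subset_inter ((prod_mono hB₁ hD₁).trans hb₁) ((prod_mono hB₂ hD₂).trans hb₂), ?_⟩
    rintro ⟨w, h⟩ ⟨hw, hh⟩
    have af : AnalyticOnNhd ℂ (fun x => f (x, h)) (Metric.ball y (min ρ₁ ρ₂)) :=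
      (hf.comp (by fun_prop) fun x hx => hb₁ ⟨hB₁ hx, hD₁ hh⟩ :
        DifferentiableOn ℂ (f ∘ fun x => (x, h)) _).analyticOnNhd Metric.isOpen_ball
    have ag : AnalyticOnNhd ℂ (fun x => g (x, h)) (Metric.ball y (min ρ₁ ρ₂)) :=
      (hg.comp (by fun_prop) fun x hx => hb₂ ⟨hB₂ hx, hD₂ hh⟩ :
        DifferentiableOn ℂ (g ∘ fun x => (x, h)) _).analyticOnNhd Metric.isOpen_ball
    refine af.eqOn_of_preconnected_of_eventuallyEq ag (convex_ball _ _).isPreconnected (z₀ := z)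
      (by rw [Metric.mem_ball, dist_comm]; exact hzy) ?_ hw
    filter_upwards [hU.mem_nhds hzU] with x hxU
    exact heq ⟨hxU, hD (hD₃ hh)⟩

/-- By Watson's lemma both functions are, for small `h`, the Borel sum of the same series. -/
lemma agreeNear_of_gevreyNear (hbox : ∀ x ∈ W, ∃ U δ, IsExactBox θ W S a b c F x₁ U δ ∧ x ∈ U)
    {V' : Set (ℂ × ℂ)} {g : ℂ × ℂ → ℂ} (hg : DifferentiableOn ℂ g V') {x₀ : ℂ} (hx₀ : x₀ ∈ W)
    (H : GevreyNear θ W S V' g F x₀) :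
    AgreeNear θ (exactDomain θ W S a b c F x₁) V' (borelSumFun θ F) g x₀ := by
  obtain ⟨U, δ, HU, hxU⟩ := hbox x₀ hx₀
  obtain ⟨U', -, hU', hxU', S₀, -, -, hsub, hG⟩ := H
  obtain ⟨δ', hδ', hD', heq⟩ := hG.exists_eq_borelSum (hg.mono hsub)
  have hd := lt_min HU.pos hδ'
  refine ⟨U ∩ U', HU.isOpen.inter hU', ⟨hxU, hxU'⟩, borelDisc θ (min δ δ'),
    isSectorialDomain_borelDisc θ hd, subset_inter ?_ ?_, ?_⟩
  · exact (prod_mono inter_subset_left (borelDisc_mono hd (min_le_left _ _))).trans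
      HU.subset_exactDomain
  · exact (prod_mono inter_subset_right
      ((borelDisc_mono hd (min_le_right _ _)).trans hD')).trans hsub
  · rintro ⟨x, h⟩ ⟨hx, hh⟩
    exact (heq x hx.2 h (borelDisc_mono hd (min_le_right _ _) hh)).symm

end ExactDomain

/-! ### Descent from the halfstrip to its image -/

section Image

variable {X : Set ℂ} {D₀ s Ψ : ℂ → ℂ} {θ r : ℝ} {ε : ℤˣ} {x₁ : ℂ}

/-- An exact solution in the coordinate `z` descends to the image under `Ψ`. -/
theorem IsWKBHalfstrip.isExactBox_image (hW : IsWKBHalfstrip X D₀ s θ ε x₁ r Ψ) {S : Set ℂ}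
    {a b c : ℂ × ℂ → ℂ} {F : ℕ → ℂ → ℂ} {K : Set ℂ} (hK : IsOpen K) (hKc : Convex ℝ K)
    (hK0 : (0 : ℂ) ∈ K) (hKr : K ⊆ halfstrip θ ε r) {δ C M : ℝ} (hδ : 0 < δ)
    (hD : borelDisc θ δ ⊆ S) (hC : 0 ≤ C) (hM : 0 ≤ M) {f : ℂ → ℂ → ℂ}
    (hf : GevreyFun K (borelDisc θ δ) C M f (fun k z => F k (Ψ z)))
    (hode : ∀ z ∈ K, ∀ h ∈ borelDisc θ δ, h * deriv (fun z => f z h) z * s (Ψ z) =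
        a (Ψ z, h) * f z h ^ 2 + b (Ψ z, h) * f z h + c (Ψ z, h)) :
    IsExactBox θ (wkbHalfstrip θ ε Ψ r) S a b c F x₁ (Ψ '' K) δ := by
  -- The coefficients of the expansion of `f` depend on `Ψ z` only, so `f` takes equal values at
  -- points with the same image, and descent needs no injectivity.
  have hfs : ∀ z ∈ K, ∀ h ∈ borelDisc θ δ, borelSumFun θ F (Ψ z, h) = f z h := fun z hz h hh =>
    hf.borelSum_eq hδ hC hM hz hh
  have hU := hW.isOpen_image hK hKr
  have hhol : DifferentiableOn ℂ (borelSumFun θ F) ((Ψ '' K) ×ˢ borelDisc θ δ) := by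
    rintro ⟨_, h⟩ ⟨⟨z, hz, rfl⟩, hh⟩
    refine DifferentiableAt.differentiableWithinAt ?_
    have hst := hW.hasStrictDerivAt (hKr hz)
    have h0 := hW.deriv_ne_zero (hKr hz)
    -- A local inverse of `Ψ` expresses the Borel sum near `Ψ z` as a composition with `f`, which
    -- gives holomorphy.
    set L := hst.localInverse Ψ (deriv Ψ z) z h0 with hL
    have hLd : HasDerivAt L (deriv Ψ z)⁻¹ (Ψ z) := (hst.to_localInverse h0).hasDerivAt
    have hLz : L (Ψ z) = z := (hst.eventually_left_inverse h0).self_of_nhds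
    have hfd : DifferentiableAt ℂ (Function.uncurry f) (L (Ψ z), h) := by
      rw [hLz]
      exact hf.hol.differentiableAt ((hK.prod (isOpen_borelDisc hδ)).mem_nhds ⟨hz, hh⟩)
    have hL1 : DifferentiableAt ℂ (fun p : ℂ × ℂ => L p.1) (Ψ z, h) :=
      DifferentiableAt.comp (g := L) (Ψ z, h) hLd.differentiableAt differentiableAt_fst
    have hLp : DifferentiableAt ℂ (fun p : ℂ × ℂ => (L p.1, p.2)) (Ψ z, h) :=
      hL1.prodMk differentiableAt_snd
    have hcomp : DifferentiableAt ℂ (fun p : ℂ × ℂ => Function.uncurry f (L p.1, p.2)) (Ψ z, h) :=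
      DifferentiableAt.comp (g := Function.uncurry f) (Ψ z, h) hfd hLp
    refine hcomp.congr_of_eventuallyEq ?_
    have e1 : ∀ᶠ p : ℂ × ℂ in 𝓝 (Ψ z, h), L p.1 ∈ K :=
      hL1.continuousAt.eventually (hK.mem_nhds (by change L (Ψ z) ∈ K; rwa [hLz]))
    have e2 : ∀ᶠ p : ℂ × ℂ in 𝓝 (Ψ z, h), Ψ (L p.1) = p.1 :=
      (continuousAt_fst (p := (Ψ z, h))).eventually (p := fun x => Ψ (L x) = x)
        (hst.eventually_right_inverse h0)
    have e3 : ∀ᶠ p : ℂ × ℂ in 𝓝 (Ψ z, h), p.2 ∈ borelDisc θ δ :=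
      continuousAt_snd.eventually ((isOpen_borelDisc hδ).mem_nhds hh)
    filter_upwards [e1, e2, e3] with p h1 h2 h3
    change _ = f (L p.1) p.2
    rw [← hfs _ h1 _ h3, h2]
  have hsub : Ψ '' K ⊆ wkbHalfstrip θ ε Ψ r := image_mono hKr
  refine ⟨hU, hKc.isPreconnected.image _ (hW.holo.continuousOn.mono hKr), ⟨0, hK0, hW.base⟩, hsub,
    hδ, hD, ⟨hhol, ?_⟩, ?_⟩
  · rintro ⟨_, h⟩ ⟨⟨z, hz, rfl⟩, hh⟩
    have d1 : HasDerivAt (fun x => borelSumFun θ F (x, h))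
        (deriv (fun x => borelSumFun θ F (x, h)) (Ψ z)) (Ψ z) := by
      have : DifferentiableAt ℂ (fun x => borelSumFun θ F (x, h)) (Ψ z) :=
        DifferentiableAt.comp (g := borelSumFun θ F) (Ψ z)
          (hhol.differentiableAt ((hU.prod (isOpen_borelDisc hδ)).mem_nhds ⟨⟨z, hz, rfl⟩, hh⟩))
          (by fun_prop)
      exact this.hasDerivAt
    have d2 := (d1.comp z (hW.holo.differentiableAt
      ((isOpen_halfstrip θ ε r).mem_nhds (hKr hz))).hasDerivAt).deriv
    have d3 : deriv ((fun x => borelSumFun θ F (x, h)) ∘ Ψ) z = deriv (fun z => f z h) z :=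
      Filter.EventuallyEq.deriv_eq (Filter.eventuallyEq_of_mem (hK.mem_nhds hz)
        fun w hw => hfs w hw h hh)
    have h1 := hode z hz h hh
    have h2 := hW.inverse z (hKr hz)
    rw [← d3, d2] at h1
    rw [hfs z hz h hh]
    linear_combination h1 - h * deriv (fun x => borelSumFun θ F (x, h)) (Ψ z) * h2
  · refine ⟨_, subset_rfl, isSectorialDomain_borelDisc θ hδ, C + 1, by positivity, M + 1,
      by positivity, ?_⟩
    rintro n _ ⟨z, hz, rfl⟩ h hh
    rw [remainder_eq, hfs z hz h hh, Pi.one_apply, norm_one, one_mul]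
    exact (hf.bound z hz).mono subset_rfl (by linarith) (by positivity) hM (by linarith) n h hh

/-- Every point of the halfstrip lies in a bounded convex open set around the base point whose
closure is contained in the halfstrip. -/
lemma exists_convex_of_mem_halfstrip {z : ℂ} (hr : 0 < r) (hz : z ∈ halfstrip θ ε r)
    {u : ℂ → ℂ} (hu : ContinuousOn u (halfstrip θ ε r)) :
    ∃ K : Set ℂ, IsOpen K ∧ Convex ℝ K ∧ (0 : ℂ) ∈ K ∧ z ∈ K ∧
      (∃ r₁ > 0, r₁ < r ∧ K ⊆ halfstrip θ ε r₁) ∧ ∃ R, ∀ w ∈ K, ‖u w‖ ≤ R := by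
  -- A slightly thinner halfstrip cut by a large ball is relatively compact in the given one, whence
  -- the bound on `u`.
  obtain ⟨r₁, h1, h2⟩ := exists_between (max_lt hr (show Metric.infDist z (ray θ ε) < r from hz))
  have hr₁ : 0 < r₁ := (le_max_left _ _).trans_lt h1
  have hcomp : IsCompact ({w | Metric.infDist w (ray θ ε) ≤ r₁} ∩ Metric.closedBall 0 (‖z‖ + 1)) :=
    (isCompact_closedBall _ _).inter_left
      (isClosed_le (Metric.continuous_infDist_pt _) continuous_const)
  obtain ⟨R, hR⟩ := hcomp.exists_bound_of_continuousOn
    (hu.mono fun w hw => lt_of_le_of_lt (show Metric.infDist w (ray θ ε) ≤ r₁ from hw.1) h2)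
  refine ⟨halfstrip θ ε r₁ ∩ Metric.ball 0 (‖z‖ + 1), (isOpen_halfstrip θ ε r₁).inter
    Metric.isOpen_ball, (convex_halfstrip θ ε r₁).inter (convex_ball _ _),
    ⟨zero_mem_halfstrip θ ε hr₁, Metric.mem_ball_self (by positivity)⟩,
    ⟨(le_max_right _ _).trans_lt h1, by simp⟩, ⟨r₁, hr₁, h2, inter_subset_left⟩, R, fun w hw => ?_⟩
  exact hR w ⟨le_of_lt (show Metric.infDist w (ray θ ε) < r₁ from hw.1),
    Metric.ball_subset_closedBall hw.2⟩

end Image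

end WKB

/-! ### Assembly of the main theorem -/

theorem mainTheorem10
    (θ : ℝ) (X S : Set ℂ) (hXo : IsOpen X) (hXc : IsConnected X)
    (hS : WKB.IsSectorialDomain θ S)
    -- the coefficients of the Riccati equation and their asymptotic expansions
    (a b c : ℂ × ℂ → ℂ) (A B C : ℕ → ℂ → ℂ)
    (ha : DifferentiableOn ℂ a (X ×ˢ S)) (hb : DifferentiableOn ℂ b (X ×ˢ S))
    (hc : DifferentiableOn ℂ c (X ×ˢ S))
    (hA : ∀ k, DifferentiableOn ℂ (A k) X) (hB : ∀ k, DifferentiableOn ℂ (B k) X)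
    (hC : ∀ k, DifferentiableOn ℂ (C k) X)
    (haA : WKB.LocUnifAsymptotic θ X S a A) (hbB : WKB.LocUnifAsymptotic θ X S b B)
    (hcC : WKB.LocUnifAsymptotic θ X S c C)
    -- the sign, the branch of the square root, and the WKB halfstrip
    (ε : ℤˣ) (s : ℂ → ℂ) (x₀ x₁ : ℂ) (r : ℝ) (Ψ : ℂ → ℂ)
    (hW : WKB.IsWKBHalfstrip X (WKB.discriminant A B C) s θ ε x₁ r Ψ)
    (hx₀ : x₀ ∈ WKB.wkbHalfstrip θ ε Ψ r)
    (hneg : ε = -1 → ∀ x ∈ WKB.wkbHalfstrip θ ε Ψ r, A 0 x ≠ 0)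
    (hpos : ε = 1 → ∀ x ∈ WKB.wkbHalfstrip θ ε Ψ r, A 0 x = 0 → s x = B 0 x)
    -- Gevrey asymptotics of the coefficients with respect to the scale `√D₀`
    (haG : WKB.UnifGevrey θ (WKB.wkbHalfstrip θ ε Ψ r) S s a A)
    (hbG : WKB.UnifGevrey θ (WKB.wkbHalfstrip θ ε Ψ r) S s b B)
    (hcG : WKB.UnifGevrey θ (WKB.wkbHalfstrip θ ε Ψ r) S s c C) :
    -- the formal solution with the given leading order
    ∃ F : ℕ → ℂ → ℂ,
      (WKB.IsFormalSolution (WKB.wkbHalfstrip θ ε Ψ r) A B C F ∧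
        EqOn (F 0) (WKB.leadingOrder ε s A B C) (WKB.wkbHalfstrip θ ε Ψ r)) ∧
      (∀ F' : ℕ → ℂ → ℂ, WKB.IsFormalSolution (WKB.wkbHalfstrip θ ε Ψ r) A B C F' →
        EqOn (F' 0) (WKB.leadingOrder ε s A B C) (WKB.wkbHalfstrip θ ε Ψ r) →
        ∀ k, EqOn (F' k) (F k) (WKB.wkbHalfstrip θ ε Ψ r)) ∧
      -- the exact solution on the halfstrip, with locally uniform Gevrey asymptotics
      ∃ (V : Set (ℂ × ℂ)) (f : ℂ × ℂ → ℂ),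
        WKB.IsSemisectorialDomain θ (WKB.wkbHalfstrip θ ε Ψ r) S V ∧
        WKB.IsHolomorphicSolution V a b c f ∧
        (∀ x ∈ WKB.wkbHalfstrip θ ε Ψ r,
          WKB.GevreyNear θ (WKB.wkbHalfstrip θ ε Ψ r) S V f F x) ∧
        -- it extends every representative of the canonical local exact solution near `x₀`
        (∀ (U₀ S₀ : Set ℂ) (g : ℂ × ℂ → ℂ),
          WKB.IsCanonicalLocalSolution θ (WKB.wkbHalfstrip θ ε Ψ r) S a b c F x₀ U₀ S₀ g →
          ∃ S₁ ⊆ S₀, WKB.IsSectorialDomain θ S₁ ∧ U₀ ×ˢ S₁ ⊆ V ∧ EqOn g f (U₀ ×ˢ S₁)) ∧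
        -- the extension is unique
        (∀ (V' : Set (ℂ × ℂ)) (g : ℂ × ℂ → ℂ),
          WKB.IsSemisectorialDomain θ (WKB.wkbHalfstrip θ ε Ψ r) S V' →
          WKB.IsHolomorphicSolution V' a b c g →
          WKB.GevreyNear θ (WKB.wkbHalfstrip θ ε Ψ r) S V' g F x₀ →
          ∀ x ∈ WKB.wkbHalfstrip θ ε Ψ r, WKB.AgreeNear θ V V' f g x) ∧
        -- uniform Gevrey asymptotics on `W₀ × S₀` for the thinner halfstrips `W₀`
        (∀ r₀ : ℝ, 0 < r₀ → r₀ < r →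
          (∃ K : ℝ, ∀ x ∈ WKB.wkbHalfstrip θ ε Ψ r₀, ‖WKB.leadingOrder ε s A B C x‖ ≤ K) →
          ∃ S₀ ⊆ S, WKB.IsSectorialDomain θ S₀ ∧ WKB.wkbHalfstrip θ ε Ψ r₀ ×ˢ S₀ ⊆ V ∧
            WKB.UnifGevrey θ (WKB.wkbHalfstrip θ ε Ψ r₀) S₀ 1 f F) := by
  set W := WKB.wkbHalfstrip θ ε Ψ r with hWdef
  have hWo : IsOpen W := hW.isOpen
  have hs0 : ∀ x ∈ W, s x ≠ 0 := fun x hx => hW.branch_ne_zero hx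
  have hA' := fun k => (hA k).mono hW.subset
  have hB' := fun k => (hB k).mono hW.subset
  have hC' := fun k => (hC k).mono hW.subset
  have hmem : MapsTo Ψ (WKB.halfstrip θ ε r) W := fun z hz => ⟨z, hz, rfl⟩
  set F := WKB.formalSolution ε s A B C with hFdef
  have hF : WKB.IsFormalSolution W A B C F := WKB.isFormalSolution_formalSolution hWo hA' hB' hC'
    hW.branch_holo hW.branch_sq hs0 hneg hpos
  have hF0 : EqOn (F 0) (WKB.leadingOrder ε s A B C) W := fun x _ => by
    rw [hFdef, WKB.formalSolution_zero]
  have hε : ((ε : ℤ) : ℂ) ≠ 0 := norm_ne_zero_iff.1 (by rw [WKB.norm_units_cast]; exact one_ne_zero)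
  have exact_box : ∀ {r₁ R : ℝ} {K : Set ℂ}, 0 < r₁ → r₁ < r → IsOpen K → Convex ℝ K →
      (0 : ℂ) ∈ K → K ⊆ WKB.halfstrip θ ε r₁ →
      (∀ z ∈ K, ‖WKB.leadingOrder ε s A B C (Ψ z)‖ ≤ R) →
      ∃ δ, WKB.IsExactBox θ W S a b c F x₁ (Ψ '' K) δ := by
    intro r₁ R K hr₁ hr hK hKc hK0 hKr hR
    obtain ⟨δ, hδ, hD, C', hC0, M, hM, f, hf, hode⟩ := WKB.IsWKBHalfstrip.exists_exact ha hb hc hA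
      hB hC hW hneg hpos haG hbG hcG hF hF0 hr₁ hr hK hKr hR
    exact ⟨δ, hW.isExactBox_image hK hKc hK0 (hKr.trans (WKB.halfstrip_mono hr.le)) hδ hD hC0 hM hf
      hode⟩
  have hcont : ContinuousOn (fun z => WKB.leadingOrder ε s A B C (Ψ z)) (WKB.halfstrip θ ε r) :=
    (WKB.differentiableOn_leadingOrder hWo (hA' 0) (hB' 0) (hC' 0) hW.branch_holo hW.branch_sq hs0
      hneg hpos).continuousOn.comp hW.holo.continuousOn hmem
  -- Bounded convex pieces suffice here: the leading-order solution is bounded on them, even if it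
  -- is not bounded on any thinner halfstrip.
  have hbox : ∀ x ∈ W, ∃ U δ, WKB.IsExactBox θ W S a b c F x₁ U δ ∧ x ∈ U := by
    rintro _ ⟨z, hz, rfl⟩
    obtain ⟨K, hK, hKc, hK0, hzK, ⟨r₁, hr₁, hr, hKr⟩, R, hR⟩ :=
      WKB.exists_convex_of_mem_halfstrip hW.pos hz hcont
    obtain ⟨δ, hδ⟩ := exact_box hr₁ hr hK hKc hK0 hKr hR
    exact ⟨_, δ, hδ, z, hzK, rfl⟩
  have hV := WKB.isSemisectorialDomain_exactDomain ⟨x₀, hx₀⟩ hbox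
  refine ⟨F, ⟨hF, hF0⟩, fun F' hF' hF0' => WKB.formal_unique (e := 1) (A := A) (B := B) (C := C) hWo
    (fun x hx => ?_) (fun x hx => ?_) (fun x hx => (hF0' hx).trans (hF0 hx).symm)
    fun x hx => ?_, WKB.exactDomain θ W S a b c F x₁, WKB.borelSumFun θ F, hV,
    WKB.isHolomorphicSolution_exactDomain, fun x hx => ?_,
    fun U₀ S₀ g hg => WKB.exists_eqOn_of_compact hbox hg, fun V' g hV' hg hG x hx =>
      WKB.agreeNear_of_agreeNear hW.isPreconnected hV hV' WKB.isHolomorphicSolution_exactDomain.1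
        hg.1 hx₀ (WKB.agreeNear_of_gevreyNear hbox hg.1 hx₀ hG) hx, ?_⟩
  · simpa only [one_mul, WKB.formalRiccati] using hF'.2 x hx
  · simpa only [one_mul, WKB.formalRiccati] using hF.2 x hx
  · rw [hF0' hx, (WKB.leadingOrder_spec (hW.branch_sq x hx) (hs0 x hx) (fun h => hneg h x hx)
      fun h => hpos h x hx).2]
    exact mul_ne_zero hε (hs0 x hx)
  · obtain ⟨U, δ, H, hxU⟩ := hbox x hx
    exact ⟨U, H.subset, H.isOpen, hxU, _, H.disc_subset, WKB.isSectorialDomain_borelDisc θ H.pos,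
      H.subset_exactDomain, H.gevrey⟩
  · rintro r₀ hr₀ hr ⟨R, hR⟩
    -- Under the boundedness hypothesis the whole thinner halfstrip is an admissible piece, and its
    -- single Borel disc gives the uniform statement.
    obtain ⟨δ, H⟩ := exact_box hr₀ hr (WKB.isOpen_halfstrip θ ε r₀) (WKB.convex_halfstrip θ ε r₀)
      (WKB.zero_mem_halfstrip θ ε hr₀) subset_rfl fun z hz => hR _ ⟨z, hz, rfl⟩
    exact ⟨_, H.disc_subset, WKB.isSectorialDomain_borelDisc θ H.pos, H.subset_exactDomain,
      H.gevrey⟩
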